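/- **Model.** Let $A,B$ be two sets of players, $|A|=|B|=n$. Every player $z\in A\cup B$ holds a preference list, i.e. a ranking $\pi_z$ of the $n$ players of the other side. For a matching (bijection) $M:A\to B$, a pair $(x,y)\in A\times B$ is *blocking* if $x$ prefers $y$ to $M(x)$ and $y$ prefers $x$ to $M^{-1}(y)$. Initially the $2n$ lists are independent and uniformly random. In each time-step $t=1,2,\dots$ the algorithm may make one query $(z,u,v)$, whose answer is whether $z$ currently ranks $u$ before $v$; then $\alpha$ independent evolution events occur, where $\alpha\ge 1$ is a fixed integer: each chooses $z\in A\cup B$ and $i\in\{1,\dots,n-1\}$ uniformly at random and swaps the elements at positions $i$ and $i+1$ of the list of $z$. Computation and random choices of the algorithm between queries are free. **Algorithm (with parameter $C$).** On even time-steps the algorithm makes the queries of a *sorting process*, on odd time-steps those of a *matching process*. *Sorting process.* Approximate lists $\tilde\pi_x$, $x\in A$, are kept; initially they are independent uniformly random orders of $B$. A run sorts the lists of all $x\in A$ one after another by randomized quicksort (uniformly random pivots; the elements are initially arranged in the order $\tilde\pi_x$), using comparison queries to the current $\pi_x$. When a run is complete, its results replace the $\tilde\pi_x$ and a new run starts.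 *Matching process.* A run uses the $\tilde\pi_x$ that are available when it starts. It begins with the empty matching. For each $x\in A$ in turn, let $p=x$ and repeat: let $S$ be the set of the $\lceil C\log n\rceil$ elements of $B$ (or of all of them, if there are fewer) ranked highest by $\tilde\pi_p$ among those to which $p$ has not yet proposed in this run; find the best element $y$ of $S$ by scanning $S$ in the order $\tilde\pi_p$ and comparing each element with the best one so far, by queries to the current $\pi_p$; $p$ proposes to $y$. If $y$ is unmatched, match $p$ with $y$ and go to the next $x$. Otherwise query whether $y$ currently prefers $p$ to its partner $p'$; if so, match $y$ with $p$ and continue with $p'$ in the role of $p$; if not, continue with the same $p$. When a run is complete, its matching becomes the maintained output, and a new run starts. (Before the first run is complete the output is an arbitrary fixed matching.) **Theorem.** Let $\alpha\ge1$ be a fixed integer. For every sufficiently large constant $C$ there is a constant $c_0>0$ such that the following holds. For every constant $c$ there are constants $n_0,c_1,c_2>0$ such that for all $n\ge n_0$ and all time-steps $t\ge c_0n^2\log n$, the output maintained by the algorithm is always a matching, and the number $X_{n,t}$ of blocking pairs that it has at the end of time-step $t$, with respect to the current preference lists, satisfies $$\mathbb E[X_{n,t}]\le c_1(\log n)^2\qquad\text{and}\qquad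 \Pr\bigl[X_{n,t}>c_2(\log n)^2\bigr]\le n^{-c}.$$ -/

import Mathlib

namespace EvolvingMatching

/-! ## Instances of stable matching -/

/-- The `2n` players: `Sum.inl x` is the player `x ∈ A` and `Sum.inr y` is the player `y ∈ B`,
where both sides are indexed by `Fin n`. -/
abbrev Agent (n : ℕ) : Type := Fin n ⊕ Fin n

/-- The preference lists. `π z u` is the rank that the player `z` gives to the player `u` of the
other side; ranks start at `0`, and rank `0` is the most preferred one. -/
abbrev Prefs (n : ℕ) : Type := Agent n → Equiv.Perm (Fin n)

/-- A partial assignment of players of `A` to players of `B`: `M y = some x` means that `x ∈ A`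
and `y ∈ B` are matched, and `M y = none` means that `y` is unmatched. -/
abbrev Assignment (n : ℕ) : Type := Fin n → Option (Fin n)

/-- `M` is a matching, that is, a bijection between `A` and `B`. -/
def IsMatching {n : ℕ} (M : Assignment n) : Prop :=
  ∃ e : Fin n ≃ Fin n, ∀ x : Fin n, M (e x) = some x

/-- The pair `(x, y) ∈ A × B` is blocking: `y` prefers `x` to its partner, and `x` prefers `y`
to its partner. -/
def IsBlocking {n : ℕ} (π : Prefs n) (M : Assignment n) (x y : Fin n) : Prop :=
  (∀ x₀, M y = some x₀ → π (Sum.inr y) x < π (Sum.inr y) x₀) ∧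
    (∀ y₀, M y₀ = some x → π (Sum.inl x) y < π (Sum.inl x) y₀)

/-- The number of blocking pairs of `M` for the preference lists `π`. -/
noncomputable def numBlocking {n : ℕ} (π : Prefs n) (M : Assignment n) : ℕ :=
  {q : Fin n × Fin n | IsBlocking π M q.1 q.2}.ncard

/-! ## Evolution of the preference lists -/

/-- The effect of the evolution event `(z, i)`: the elements at the adjacent positions `i` and
`i + 1` of the list of `z` are swapped. -/
def swapAt {n : ℕ} (π : Prefs n) (z : Agent n) (i : Fin (n - 1)) : Prefs n :=
  Function.update π z
    ((π z).trans (Equiv.swap ⟨i.val, by omega⟩ ⟨i.val + 1, by omega⟩))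

/-- One evolution event: `z ∈ A ∪ B` and the position `i` are chosen uniformly at random. (A list
with fewer than two elements has no adjacent elements, and does not change.) -/
noncomputable def evolve {n : ℕ} (π : Prefs n) : PMF (Prefs n) :=
  if h : 2 ≤ n then
    haveI : Nonempty (Agent n × Fin (n - 1)) :=
      ⟨(Sum.inl ⟨0, by omega⟩, ⟨0, by omega⟩)⟩
    (PMF.uniformOfFintype (Agent n × Fin (n - 1))).map fun e => swapAt π e.1 e.2
  else PMF.pure π

/-- `α` independent evolution events, one after the other. -/
noncomputable def evolveMany {n : ℕ} : ℕ → Prefs n → PMF (Prefs n)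
  | 0, π => PMF.pure π
  | k + 1, π => (evolve π).bind (evolveMany k)

/-! ## Randomized algorithms with query access -/

/-- A query `(z, u, v)`: does the player `z` currently prefer `u` to `v`? -/
structure Query (n : ℕ) where
  agent : Agent n
  fst : Fin n
  snd : Fin n

/-- The answer to a query, on the current preference lists. -/
def Query.answer {n : ℕ} (q : Query n) (π : Prefs n) : Bool :=
  decide (π q.agent q.fst < π q.agent q.snd)

/-- A randomized algorithm that has only query access to the preference lists and returns an
element of `R`. It returns a value, or makes a query and continues according to the answer, or
draws a uniformly random element of `Fin (k + 1)` and continues according to the outcome. -/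
inductive Prog (n : ℕ) (R : Type) : Type where
  | done : R → Prog n R
  | ask : Query n → (Bool → Prog n R) → Prog n R
  | rand : (k : ℕ) → (Fin (k + 1) → Prog n R) → Prog n R

namespace Prog

/-- Sequential composition. -/
def bind {n : ℕ} {R R₁ : Type} : Prog n R → (R → Prog n R₁) → Prog n R₁
  | done r, g => g r
  | ask q k, g => ask q fun b => bind (k b) g
  | rand m k, g => rand m fun i => bind (k i) g

instance (n : ℕ) : Monad (Prog n) where
  pure := done
  bind := bind

/-- Make a query and return its answer. -/
def query {n : ℕ} (z : Agent n) (u v : Fin n) : Prog n Bool := ask ⟨z, u, v⟩ done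

/-- Draw random numbers until the algorithm either has returned or is about to make a query. -/
noncomputable def settle {n : ℕ} {R : Type} : Prog n R → PMF (Prog n R)
  | done r => PMF.pure (done r)
  | ask q k => PMF.pure (ask q k)
  | rand m k => (PMF.uniformOfFintype (Fin (m + 1))).bind fun i => settle (k i)

/-- The part of the execution that falls into one time-step, when the preference lists are `π`:
(at most) one query is made. Everything else is free, so the execution continues until the
algorithm has returned or is about to make its next query. -/
noncomputable def turn {n : ℕ} {R : Type} (π : Prefs n) (p : Prog n R) : PMF (Prog n R) :=
  (settle p).bind fun
    | ask q k => settle (k (q.answer π))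
    | p₁ => PMF.pure p₁

end Prog

/-! ## Sequential quicksort -/

/-- Compare all elements of a list with the pivot `p`, in the order of the list, according to the
player `z`. Returns the elements that are found to be ranked before `p`, and the others. -/
def partition {n : ℕ} (z : Agent n) (p : Fin n) :
    List (Fin n) → Prog n (List (Fin n) × List (Fin n))
  | [] => pure ([], [])
  | v :: l => do
      let b ← Prog.query z v p
      let (lo, hi) ← partition z p l
      if b then pure (v :: lo, hi) else pure (lo, v :: hi)

/-- Randomized quicksort of a list of elements according to the player `z`: the pivot is uniformly
random, and first the smaller and then the larger elements are sorted recursively. The first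
argument bounds the depth of the recursion; the length of the list is always sufficient, because
both recursive calls are on shorter lists. -/
def quicksort {n : ℕ} (z : Agent n) : ℕ → List (Fin n) → Prog n (List (Fin n))
  | 0, _ => pure []
  | _ + 1, [] => pure []
  | d + 1, a :: l =>
      Prog.rand l.length fun i => do
        let (lo, hi) ← partition z ((a :: l).get i) ((a :: l).eraseIdx i)
        let lo₁ ← quicksort z d lo
        let hi₁ ← quicksort z d hi
        pure (lo₁ ++ (a :: l).get i :: hi₁)

/-- Approximations to the lists of the players of `A`: for every `x ∈ A`, the elements of `B` in
the order of (approximate) preference, beginning with the most preferred one. -/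
abbrev Approx (n : ℕ) : Type := Fin n → List (Fin n)

/-- Sort the lists of all `x ∈ A`, one after another. The array in which quicksort rearranges the
elements of `B` for `x` initially holds the present approximation. -/
def sequentialSort {n : ℕ} (a : Approx n) : Prog n (Approx n) :=
  (List.finRange n).foldlM
    (fun a₁ x => do
      let l ← quicksort (Sum.inl x) n (a₁ x)
      pure (Function.update a₁ x l)) a

/-! ## The modified Gale–Shapley algorithm -/

/-- Find the best element of `b :: l` according to the current list of `z`, by comparing the best
element so far with the next one. -/
def best {n : ℕ} (z : Agent n) : Fin n → List (Fin n) → Prog n (Fin n)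
  | b, [] => pure b
  | b, v :: l => do
      let c ← Prog.query z v b
      best z (if c then v else b) l

/-- The variables of the modified Gale–Shapley algorithm. -/
structure GSState (n : ℕ) where
  /-- The present partial matching. -/
  M : Assignment n
  /-- The pairs `(x, y)` such that `x` has already proposed to `y`. -/
  proposed : Finset (Fin n × Fin n)

/-- The while loop of the modified Gale–Shapley algorithm, with the present proposer `p`. The
proposal goes to the best, according to the current list of `p`, of the `K` highest-ranked elements
of `B` per `a p` to which `p` has not yet proposed. The first argument bounds the number of rounds;
`n * n` is always sufficient, because every round makes a proposal that was not made before. -/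
def propose {n : ℕ} (K : ℕ) (a : Approx n) : ℕ → Fin n → GSState n → Prog n (GSState n)
  | 0, _, s => pure s
  | r + 1, p, s =>
      match ((a p).filter fun y => (p, y) ∉ s.proposed).take K with
      | [] => pure s
      | b :: l => do
          let y ← best (Sum.inl p) b l
          let prop := insert (p, y) s.proposed
          match s.M y with
          | none => pure ⟨Function.update s.M y (some p), prop⟩
          | some p₁ =>
              let c ← Prog.query (Sum.inr y) p p₁
              if c then propose K a r p₁ ⟨Function.update s.M y (some p), prop⟩
              else propose K a r p ⟨s.M, prop⟩

/-- The modified Gale–Shapley algorithm, with `K` candidates per proposal and the (static)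
approximations `a`. -/
def modifiedGS {n : ℕ} (K : ℕ) (a : Approx n) : Prog n (Assignment n) := do
  let s ← (List.finRange n).foldlM (fun s x => propose K a (n * n) x s) ⟨fun _ => none, ∅⟩
  pure s.M

/-! ## Interleaving -/

/-- The joint state of nature and of the interleaved algorithm between two time-steps. -/
structure State (n : ℕ) where
  /-- The preference lists. -/
  prefs : Prefs n
  /-- The result of the last completed sorting run. -/
  approx : Approx n
  /-- What remains to be done in the present sorting run. -/
  sorter : Prog n (Approx n)
  /-- What remains to be done in the present matching run. -/
  matcher : Prog n (Assignment n)
  /-- The matching that is maintained: the result of the last completed matching run. -/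
  output : Assignment n

/-- The initial state: uniformly random and independent preference lists, and uniformly random
initial approximations. The output is arbitrary until the first matching run is complete. -/
noncomputable def initial (n K : ℕ) : PMF (State n) :=
  (PMF.uniformOfFintype (Prefs n)).bind fun π =>
    (PMF.uniformOfFintype (Fin n → Equiv.Perm (Fin n))).map fun σ =>
      let a : Approx n := fun x => List.ofFn (σ x)
      { prefs := π
        approx := a
        sorter := sequentialSort a
        matcher := modifiedGS K a
        output := some }

/-- The sorting process uses a time-step. As soon as a sorting run is complete, its result replaces
the approximations and the next run starts. -/
noncomputable def sortTurn {n : ℕ} (s : State n) : PMF (State n) :=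
  (s.sorter.turn s.prefs).map fun
    | Prog.done a => { s with approx := a, sorter := sequentialSort a }
    | p => { s with sorter := p }

/-- The matching process uses a time-step. As soon as a matching run is complete, its result
becomes the output and the next run starts, with the present approximations. -/
noncomputable def matchTurn {n : ℕ} (K : ℕ) (s : State n) : PMF (State n) :=
  (s.matcher.turn s.prefs).map fun
    | Prog.done M => { s with output := M, matcher := modifiedGS K s.approx }
    | p => { s with matcher := p }

/-- The time-step number `t`: the algorithm makes a query, for the sorting process if `t` is even
and for the matching process if `t` is odd, and then `α` evolution events occur. -/
noncomputable def timeStep {n : ℕ} (K α t : ℕ) (s : State n) : PMF (State n) :=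
  (if Even t then sortTurn s else matchTurn K s).bind fun s₁ =>
    (evolveMany α s₁.prefs).map fun π => { s₁ with prefs := π }

/-- The distribution of the state after `t` time-steps. -/
noncomputable def law (n K α : ℕ) : ℕ → PMF (State n)
  | 0 => initial n K
  | t + 1 => (law n K α t).bind (timeStep K α (t + 1))

/-- The distribution of the number of blocking pairs of the maintained matching, for the preference
lists at the end of time-step `t`. -/
noncomputable def blockingLaw (n K α t : ℕ) : PMF ℕ :=
  (law n K α t).map fun s => numBlocking s.prefs s.output

/-- The number of candidates per proposal, `C log n`. -/
noncomputable def numCandidates (C : ℝ) (n : ℕ) : ℕ := ⌈C * Real.log n⌉₊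

end EvolvingMatching

open scoped ENNReal
namespace EvolvingMatching
open Prog
variable {n : ℕ}

/-! ## Expectations under discrete distributions -/

/-! Everything is reduced to exponential moments. An execution carries a weight `ξ` for every
time-step (`wp`). A weight above 1 turns a bound on the weighted expectation into a tail bound for
the length of a run; a weight below 1 absorbs the growth that evolution causes in a potential.

Length of a sorting run. Evolution spoils a partition step of quicksort only if it moves the pivot,
which happens with probability O(1/n) during the step. Hence the static recursion survives almost
unchanged: the exponential moment for `m` elements is at most exp(3 m log m / n)
(`wp_quicksort_le`), and a run takes O(n² log n) steps with high probability.

Length of a matching run. The approximations are correlated with the lists, but the joint law of the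
lists, the approximations and the sorting process is invariant under renaming the elements of `B`,
separately in the list of every player of `A` (`expect_law_relabel`). Averaged over the renamings
that fix all past proposals, the next proposal is uniform among the players not yet proposed to,
however the lists evolve. So proposals collect coupons (`sum_wp_propose_le`), and with K candidates
per proposal a run takes O(K n log n) = O(n log² n) steps.

Accuracy. Fix a reference time about n² log n steps in the past and count, for every x and u, the
events that have moved u in the list of x since then. If R is the largest counter of x, a sorting
run begun after the reference time errs by a multiple of R. The first of the K candidates of x is
then worse than at most 6R players that are neither candidates nor already proposed to, and worse
than none of them unless K ≤ 10R (`scanPotential_start`). For K ≥ C log n the sum of these excesses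
over x is O(log n) with high probability (`prob_totalExcess_le`).

Blocking pairs. Charge a blocking pair (x, y) to y if x has proposed to y, and to x otherwise. Up to
the excess, no step of Gale–Shapley creates such a violation; only an event that moves the element
held by a player does, and it creates at most one. So 2^(violations − excess) grows in expectation
by at most 1 + 2/(n−1) per event (`expect_blockPotential_le`), and a matching run started with
accurate approximations has weighted potential at most 1 (`wp_modifiedGS_le_one`). The output stems
from a run begun O(n log² n) steps ago, so its expected potential is exp(O(log² n)), and Markov's
inequality leaves O(log² n) blocking pairs. `prob_numBlocking_le` combines the possible failures;
the bound on the expectation follows from the tail because there are never more than n² blocking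
pairs. -/

/-- The expectation of a nonnegative function. -/
noncomputable def expect {Ω : Type*} (p : PMF Ω) (f : Ω → ℝ≥0∞) : ℝ≥0∞ := ∑' a, p a * f a

section Expect

variable {Ω Ω' : Type*}

@[simp] theorem expect_pure (a : Ω) (f : Ω → ℝ≥0∞) : expect (PMF.pure a) f = f a := by
  classical
  unfold expect
  rw [tsum_eq_single a]
  · simp
  · intro b hb; simp [PMF.pure_apply, hb]

theorem expect_bind (p : PMF Ω) (g : Ω → PMF Ω') (f : Ω' → ℝ≥0∞) :
    expect (p.bind g) f = expect p fun a => expect (g a) f := by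
  unfold expect
  simp only [PMF.bind_apply, ← ENNReal.tsum_mul_right, ← ENNReal.tsum_mul_left]
  rw [ENNReal.tsum_comm]
  simp only [mul_assoc]

theorem expect_map (p : PMF Ω) (g : Ω → Ω') (f : Ω' → ℝ≥0∞) :
    expect (p.map g) f = expect p fun a => f (g a) := by
  rw [PMF.map, expect_bind]; simp

theorem expect_mono_support {p : PMF Ω} {f g : Ω → ℝ≥0∞} (h : ∀ a ∈ p.support, f a ≤ g a) :
    expect p f ≤ expect p g := by
  refine ENNReal.tsum_le_tsum fun a => ?_
  by_cases ha : a ∈ p.support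
  · exact mul_le_mul_right (h a ha) _
  · rw [PMF.mem_support_iff, not_not] at ha; simp [ha]

theorem expect_mono {p : PMF Ω} {f g : Ω → ℝ≥0∞} (h : ∀ a, f a ≤ g a) : expect p f ≤ expect p g :=
  expect_mono_support fun a _ => h a

@[simp] theorem expect_const (p : PMF Ω) (c : ℝ≥0∞) : expect p (fun _ => c) = c := by
  simp [expect, ENNReal.tsum_mul_right]

theorem expect_add (p : PMF Ω) (f g : Ω → ℝ≥0∞) :
    expect p (fun a => f a + g a) = expect p f + expect p g := by
  simp [expect, mul_add, ENNReal.tsum_add]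

theorem expect_mul_left (p : PMF Ω) (c : ℝ≥0∞) (f : Ω → ℝ≥0∞) :
    expect p (fun a => c * f a) = c * expect p f := by
  simp [expect, ← ENNReal.tsum_mul_left, mul_left_comm]

theorem expect_sum {ι : Type*} (s : Finset ι) (p : PMF Ω) (f : ι → Ω → ℝ≥0∞) :
    expect p (fun a => ∑ i ∈ s, f i a) = ∑ i ∈ s, expect p (f i) := by
  classical
  induction s using Finset.induction_on with
  | empty => simp
  | insert i s hi ih => simp only [Finset.sum_insert hi, expect_add, ih]

theorem expect_uniform [Fintype Ω] [Nonempty Ω] (f : Ω → ℝ≥0∞) :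
    expect (PMF.uniformOfFintype Ω) f = (Fintype.card Ω : ℝ≥0∞)⁻¹ * ∑ a, f a := by
  simp [expect, tsum_fintype, Finset.mul_sum]

theorem expect_iInf_le {ι : Sort*} (p : PMF Ω) (f : ι → Ω → ℝ≥0∞) :
    expect p (fun a => ⨅ i, f i a) ≤ ⨅ i, expect p (f i) :=
  le_iInf fun i => expect_mono fun _ => iInf_le _ i

/-- Markov's inequality for an event. -/
theorem expect_indicator_le {p : PMF Ω} {P : Ω → Prop} [DecidablePred P] {f : Ω → ℝ≥0∞}
    {c : ℝ≥0∞} (h : ∀ a ∈ p.support, P a → c ≤ f a) :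
    c * expect p (fun a => if P a then 1 else 0) ≤ expect p f := by
  rw [← expect_mul_left]
  refine expect_mono_support fun a ha => ?_
  split_ifs with hP
  · simpa using h a ha hP
  · simp

end Expect

/-! ## Programs in an evolving environment -/

/-- One block of evolution, with weight `ξ`. -/
noncomputable def tick {E : Type*} (ξ : ℝ≥0∞) (κ : E → PMF E) (f : E → ℝ≥0∞) (e : E) : ℝ≥0∞ :=
  ξ * expect (κ e) f

section Tick

variable {E : Type*} {ξ : ℝ≥0∞} {κ : E → PMF E}

theorem tick_mono {f g : E → ℝ≥0∞} {e : E} (h : ∀ e, f e ≤ g e) : tick ξ κ f e ≤ tick ξ κ g e :=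
  mul_le_mul_right (expect_mono h) _

theorem tick_mono_support {f g : E → ℝ≥0∞} {e : E} (h : ∀ e' ∈ (κ e).support, f e' ≤ g e') :
    tick ξ κ f e ≤ tick ξ κ g e :=
  mul_le_mul_right (expect_mono_support h) _

@[simp] theorem tick_const (c : ℝ≥0∞) (e : E) : tick ξ κ (fun _ => c) e = ξ * c := by simp [tick]

theorem tick_mul_left (c : ℝ≥0∞) (f : E → ℝ≥0∞) (e : E) :
    tick ξ κ (fun e => c * f e) e = c * tick ξ κ f e := by
  simp [tick, expect_mul_left, mul_left_comm]

theorem tick_sum {ι : Type*} (s : Finset ι) (f : ι → E → ℝ≥0∞) (e : E) :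
    tick ξ κ (fun e => ∑ i ∈ s, f i e) e = ∑ i ∈ s, tick ξ κ (f i) e := by
  simp [tick, expect_sum, Finset.mul_sum]

theorem tick_tick_mul_left (c : ℝ≥0∞) (f : E → ℝ≥0∞) (e : E) :
    tick ξ κ (tick ξ κ fun e => c * f e) e = c * tick ξ κ (tick ξ κ f) e := by
  rw [← tick_mul_left]
  exact congrArg (tick ξ κ · e) (funext (tick_mul_left c f))

theorem tick_tick_sum {ι : Type*} (s : Finset ι) (f : ι → E → ℝ≥0∞) (e : E) :
    tick ξ κ (tick ξ κ fun e => ∑ i ∈ s, f i e) e = ∑ i ∈ s, tick ξ κ (tick ξ κ (f i)) e := by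
  rw [← tick_sum]
  exact congrArg (tick ξ κ · e) (funext (tick_sum s f))

end Tick

/-! ### Returned values of programs and single turns of an execution. -/

namespace Prog

variable {n : ℕ} {R R' : Type}

@[simp] theorem pure_eq (r : R) : (pure r : Prog n R) = done r := rfl
@[simp] theorem bind_eq (p : Prog n R) (g : R → Prog n R') : p >>= g = p.bind g := rfl

/-- All values that the program can return satisfy `Q`. -/
def Leaves (Q : R → Prop) : Prog n R → Prop
  | done r => Q r
  | ask _ k => ∀ b, Leaves Q (k b)
  | rand _ k => ∀ i, Leaves Q (k i)

theorem Leaves.mono {Q Q' : R → Prop} (h : ∀ r, Q r → Q' r) {p : Prog n R} (hp : Leaves Q p) :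
    Leaves Q' p := by
  induction p with
  | done r => exact h r hp
  | ask q k ih => exact fun b => ih b (hp b)
  | rand m k ih => exact fun i => ih i (hp i)

theorem Leaves.bind {Q : R → Prop} {Q' : R' → Prop} {p : Prog n R} {g : R → Prog n R'}
    (hp : Leaves Q p) (hg : ∀ r, Q r → Leaves Q' (g r)) : Leaves Q' (p.bind g) := by
  induction p with
  | done r => exact hg r hp
  | ask q k ih => exact fun b => ih b (hp b)
  | rand m k ih => exact fun i => ih i (hp i)

theorem Leaves.settle {Q : R → Prop} {p p' : Prog n R} (hp : Leaves Q p)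
    (h : p' ∈ (settle p).support) : Leaves Q p' := by
  induction p with
  | done r => simp only [Prog.settle, PMF.support_pure, Set.mem_singleton_iff] at h; exact h ▸ hp
  | ask q k ih => simp only [Prog.settle, PMF.support_pure, Set.mem_singleton_iff] at h; exact h ▸ hp
  | rand m k ih =>
    simp only [Prog.settle, PMF.mem_support_bind_iff] at h
    obtain ⟨i, -, hi⟩ := h
    exact ih i (hp i) hi

/-- The program is about to make a query or has returned. -/
def IsSettled : Prog n R → Prop
  | rand _ _ => False
  | _ => True

theorem isSettled_settle {p p' : Prog n R} (h : p' ∈ (settle p).support) : p'.IsSettled := by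
  induction p with
  | done r => simp only [Prog.settle, PMF.support_pure, Set.mem_singleton_iff] at h; subst h; trivial
  | ask q k ih =>
    simp only [Prog.settle, PMF.support_pure, Set.mem_singleton_iff] at h; subst h; trivial
  | rand m k ih =>
    simp only [Prog.settle, PMF.mem_support_bind_iff] at h
    obtain ⟨i, -, hi⟩ := h
    exact ih i hi

theorem mem_support_turn {π : Prefs n} {p p' : Prog n R} (h : p' ∈ (turn π p).support) :
    (p' ∈ (settle p).support ∧ ∃ r, p' = done r) ∨
      ∃ q k, ask q k ∈ (settle p).support ∧ p' ∈ (settle (k (q.answer π))).support := by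
  unfold turn at h
  rw [PMF.mem_support_bind_iff] at h
  obtain ⟨p₁, h₁, h₂⟩ := h
  have hs := isSettled_settle h₁
  cases p₁ with
  | done r =>
    simp only [PMF.support_pure, Set.mem_singleton_iff] at h₂
    subst h₂
    exact Or.inl ⟨h₁, r, rfl⟩
  | ask q k => exact Or.inr ⟨q, k, h₁, h₂⟩
  | rand m k => exact hs.elim

theorem isSettled_turn {π : Prefs n} {p p' : Prog n R} (h : p' ∈ (turn π p).support) :
    p'.IsSettled := by
  rcases mem_support_turn h with ⟨h, -⟩ | ⟨q, k, -, h⟩ <;> exact isSettled_settle h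

theorem Leaves.turn {Q : R → Prop} {π : Prefs n} {p p' : Prog n R} (hp : Leaves Q p)
    (h : p' ∈ (turn π p).support) : Leaves Q p' := by
  rcases mem_support_turn h with ⟨h, -⟩ | ⟨q, k, h₁, h⟩
  · exact hp.settle h
  · exact Leaves.settle (hp.settle h₁ _) h

/-! ### Weighted expectations along an execution. -/

section WP

variable {E : Type*} (ξ : ℝ≥0∞) (κ : E → PMF E) (pr : E → Prefs n)

/-- The weighted expectation of `F` at the end of an execution that starts in the environment `e`.
Before every query the environment evolves for two blocks, each of weight `ξ`. -/
noncomputable def wp (F : R → E → ℝ≥0∞) : Prog n R → E → ℝ≥0∞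
  | done r, e => F r e
  | ask q k, e => tick ξ κ (tick ξ κ fun e' => wp F (k (q.answer (pr e'))) e') e
  | rand m k, e => ((m + 1 : ℕ) : ℝ≥0∞)⁻¹ * ∑ i, wp F (k i) e

/-- The weighted expectation of `F` when the next query is made immediately. -/
noncomputable def wpNow (F : R → E → ℝ≥0∞) (p : Prog n R) (e : E) : ℝ≥0∞ :=
  expect (turn (pr e) p) fun p' => wp ξ κ pr F p' e

variable {ξ κ pr}

theorem wp_bind (F : R' → E → ℝ≥0∞) (p : Prog n R) (g : R → Prog n R') (e : E) :
    wp ξ κ pr F (p.bind g) e = wp ξ κ pr (fun r e' => wp ξ κ pr F (g r) e') p e := by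
  induction p generalizing e with
  | done r => rfl
  | ask q k ih => simp only [Prog.bind, wp, ih]
  | rand m k ih => simp only [Prog.bind, wp, ih]

/-- Monotonicity, relative to an invariant `I` of the environment and a property `Q` of the
returned values. -/
theorem wp_mono_of {I : E → Prop} (hI : ∀ e, I e → ∀ e' ∈ (κ e).support, I e') {Q : R → Prop}
    {F G : R → E → ℝ≥0∞} (h : ∀ r e, Q r → I e → F r e ≤ G r e) {p : Prog n R} (hp : p.Leaves Q)
    {e : E} (he : I e) : wp ξ κ pr F p e ≤ wp ξ κ pr G p e := by
  induction p generalizing e with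
  | done r => exact h r e hp he
  | ask q k ih =>
    refine tick_mono_support fun e₁ h₁ => tick_mono_support fun e₂ h₂ => ?_
    exact ih _ (hp _) (hI _ (hI _ he _ h₁) _ h₂)
  | rand m k ih =>
    exact mul_le_mul_right (Finset.sum_le_sum fun i _ => ih i (hp i) he) _

theorem wp_mono {F G : R → E → ℝ≥0∞} (h : ∀ r e, F r e ≤ G r e) (p : Prog n R) (e : E) :
    wp ξ κ pr F p e ≤ wp ξ κ pr G p e :=
  wp_mono_of (I := fun _ => True) (Q := fun _ => True) (fun _ _ _ _ => trivial)
    (fun r e _ _ => h r e)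
    (by induction p with
      | done r => trivial
      | ask q k ih => exact ih
      | rand m k ih => exact ih) trivial

theorem wp_sum {ι : Type*} (s : Finset ι) (F : ι → R → E → ℝ≥0∞) (p : Prog n R) (e : E) :
    wp ξ κ pr (fun r e' => ∑ i ∈ s, F i r e') p e = ∑ i ∈ s, wp ξ κ pr (F i) p e := by
  induction p generalizing e with
  | done r => rfl
  | ask q k ih =>
    simp only [wp, ih, tick_tick_sum]
  | rand m k ih =>
    simp only [wp, ih, Finset.mul_sum]
    rw [Finset.sum_comm]

theorem expect_settle_wp (F : R → E → ℝ≥0∞) (p : Prog n R) (e : E) :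
    expect (settle p) (fun p' => wp ξ κ pr F p' e) = wp ξ κ pr F p e := by
  induction p with
  | done r => simp [settle]
  | ask q k ih => simp [settle]
  | rand m k ih => simp only [settle, expect_bind, ih, expect_uniform, wp, Fintype.card_fin]

theorem wpNow_done (F : R → E → ℝ≥0∞) (r : R) (e : E) : wpNow ξ κ pr F (done r) e = F r e := by
  simp [wpNow, turn, settle, wp]

theorem wpNow_ask (F : R → E → ℝ≥0∞) (q : Query n) (k : Bool → Prog n R) (e : E) :
    wpNow ξ κ pr F (ask q k) e = wp ξ κ pr F (k (q.answer (pr e))) e := by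
  simp [wpNow, turn, settle, expect_settle_wp]

theorem wpNow_rand (F : R → E → ℝ≥0∞) (m : ℕ) (k : Fin (m + 1) → Prog n R) (e : E) :
    wpNow ξ κ pr F (rand m k) e = ((m + 1 : ℕ) : ℝ≥0∞)⁻¹ * ∑ i, wpNow ξ κ pr F (k i) e := by
  simp only [wpNow, turn, settle, expect_bind, expect_uniform, Fintype.card_fin]

theorem wp_ask_eq (F : R → E → ℝ≥0∞) (q : Query n) (k : Bool → Prog n R) (e : E) :
    wp ξ κ pr F (ask q k) e = tick ξ κ (tick ξ κ (wpNow ξ κ pr F (ask q k))) e := by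
  simp only [wp, funext (wpNow_ask (ξ := ξ) (κ := κ) (pr := pr) F q k)]

/-- If the program is about to ask, the two blocks on the left are those that `wp` inserts before
the query anyway. Only a program that returns without any query has to pay for them, and `c` is that
price. -/
theorem tick_wpNow_le {F : R → E → ℝ≥0∞} {c : ℝ≥0∞} (hc : 1 ≤ c)
    (hF : ∀ r e, tick ξ κ (tick ξ κ (F r)) e ≤ c * F r e) (p : Prog n R) (e : E) :
    tick ξ κ (tick ξ κ (wpNow ξ κ pr F p)) e ≤ c * wp ξ κ pr F p e := by
  induction p with
  | done r =>
    rw [funext (wpNow_done (ξ := ξ) (κ := κ) (pr := pr) F r)]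
    exact hF r e
  | ask q k ih => rw [← wp_ask_eq]; exact le_mul_of_one_le_left' hc
  | rand m k ih =>
    rw [funext (wpNow_rand (ξ := ξ) (κ := κ) (pr := pr) F m k)]
    rw [tick_tick_mul_left, tick_tick_sum, wp, mul_left_comm]
    refine mul_le_mul_right ?_ _
    rw [Finset.mul_sum]
    exact Finset.sum_le_sum fun i _ => ih i

theorem one_le_wp (hξ : 1 ≤ ξ) (p : Prog n R) (e : E) : 1 ≤ wp ξ κ pr (fun _ _ => 1) p e := by
  induction p generalizing e with
  | done r => exact le_rfl
  | ask q k ih =>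
    calc (1 : ℝ≥0∞) ≤ ξ * (ξ * 1) := by
          simpa using one_le_mul hξ hξ
      _ = tick ξ κ (tick ξ κ fun _ => 1) e := by simp [funext (tick_const (ξ := ξ) (κ := κ) _)]
      _ ≤ _ := tick_mono fun e₁ => tick_mono fun e₂ => ih _ _
  | rand m k ih =>
    calc (1 : ℝ≥0∞) = ((m + 1 : ℕ) : ℝ≥0∞)⁻¹ * ∑ i : Fin (m + 1), 1 := by
          simp only [Finset.sum_const, Finset.card_univ, Fintype.card_fin, nsmul_eq_mul, mul_one]
          rw [ENNReal.inv_mul_cancel (by simp) (ENNReal.natCast_ne_top _)]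
      _ ≤ _ := mul_le_mul_right (Finset.sum_le_sum fun i _ => ih i e) _

theorem one_le_wpNow (hξ : 1 ≤ ξ) (p : Prog n R) (e : E) :
    1 ≤ wpNow ξ κ pr (fun _ _ => 1) p e := by
  calc (1 : ℝ≥0∞) = expect (turn (pr e) p) fun _ => 1 := by simp
    _ ≤ _ := expect_mono fun p' => one_le_wp hξ p' e

end WP

end Prog

/-! ## Unfolding the programs -/

theorem best_nil (z : Agent n) (b : Fin n) : best z b [] = done b := rfl

theorem best_cons (z : Agent n) (b v : Fin n) (l : List (Fin n)) :
    best z b (v :: l) = ask ⟨z, v, b⟩ fun c => best z (if c then v else b) l := rfl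

theorem leaves_best (z : Agent n) (b : Fin n) (l : List (Fin n)) :
    (best z b l).Leaves fun y => y ∈ b :: l := by
  induction l generalizing b with
  | nil => simp [best_nil, Leaves]
  | cons v l ih =>
    rw [best_cons]
    intro c
    refine (ih _).mono fun y hy => ?_
    split_ifs at hy <;> simp only [List.mem_cons] at hy ⊢ <;> tauto

/-- The candidates for the next proposal of `p`. -/
def candidates (K : ℕ) (a : Approx n) (p : Fin n) (s : GSState n) : List (Fin n) :=
  ((a p).filter fun y => (p, y) ∉ s.proposed).take K

/-- What remains to be done when `p` has decided to propose to `y`. -/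
def proposal (K : ℕ) (a : Approx n) (r : ℕ) (p : Fin n) (s : GSState n) (y : Fin n) :
    Prog n (GSState n) :=
  match s.M y with
  | none => done ⟨Function.update s.M y (some p), insert (p, y) s.proposed⟩
  | some p₁ => ask ⟨Sum.inr y, p, p₁⟩ fun c =>
      if c then propose K a r p₁ ⟨Function.update s.M y (some p), insert (p, y) s.proposed⟩
      else propose K a r p ⟨s.M, insert (p, y) s.proposed⟩

theorem propose_cons {K : ℕ} {a : Approx n} {p : Fin n} {s : GSState n} {b : Fin n}
    {l : List (Fin n)} (h : candidates K a p s = b :: l) (r : ℕ) :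
    propose K a (r + 1) p s = (best (Sum.inl p) b l).bind (proposal K a r p s) := by
  unfold candidates at h
  rw [propose, h]
  change (best (Sum.inl p) b l).bind _ = _
  congr 1

theorem not_mem_proposed_of_mem_candidates {K : ℕ} {a : Approx n} {p : Fin n} {s : GSState n}
    {y : Fin n} (h : y ∈ candidates K a p s) : (p, y) ∉ s.proposed := by
  have := List.mem_of_mem_take h
  simpa using (List.mem_filter.1 this).2

/-- The main loop of the matching process, for the remaining players `L`. -/
def matchLoop (K : ℕ) (a : Approx n) : List (Fin n) → GSState n → Prog n (Assignment n)
  | [], s => done s.M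
  | x :: L, s => (propose K a (n * n) x s).bind (matchLoop K a L)

theorem Prog.bind_assoc {R R₁ R₂ : Type} (p : Prog n R) (g : R → Prog n R₁) (h : R₁ → Prog n R₂) :
    (p.bind g).bind h = p.bind fun r => (g r).bind h := by
  induction p with
  | done r => rfl
  | ask q k ih => simp only [Prog.bind, ih]
  | rand m k ih => simp only [Prog.bind, ih]

theorem modifiedGS_eq (K : ℕ) (a : Approx n) :
    modifiedGS K a = matchLoop K a (List.finRange n) ⟨fun _ => none, ∅⟩ := by
  unfold modifiedGS
  generalize (⟨fun _ => none, ∅⟩ : GSState n) = s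
  generalize List.finRange n = L
  simp only [bind_eq, pure_eq]
  induction L generalizing s with
  | nil => rfl
  | cons x L ih =>
    rw [List.foldlM_cons, matchLoop, bind_eq, Prog.bind_assoc]
    congr 1
    funext s'
    exact ih s'

/-! ## Invariants of the matching process -/

/-- The invariant of the matching process, where `U` consists of the unmatched players of `A`. -/
structure GSInv (s : GSState n) (U : List (Fin n)) : Prop where
  inj : ∀ y y' x, s.M y = some x → s.M y' = some x → y = y'
  nodup : U.Nodup
  free : ∀ x ∈ U, ∀ y, s.M y ≠ some x
  matched : ∀ x, x ∉ U → ∃ y, s.M y = some x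
  proposed : ∀ x y, s.M y = some x → (x, y) ∈ s.proposed
  untouched : ∀ y, s.M y = none → ∀ x, (x, y) ∉ s.proposed

theorem GSInv.initial : GSInv (⟨fun _ => none, ∅⟩ : GSState n) (List.finRange n) where
  inj := by simp
  nodup := List.nodup_finRange n
  free := by simp
  matched := by simp
  proposed := by simp
  untouched := by simp

/-- Pigeonhole: if all of `B` were matched, taking partners would be an injection between sets of
equal size, hence onto, although the proposer is nobody's partner. -/
theorem GSInv.exists_unmatched {s : GSState n} {p : Fin n} {L : List (Fin n)}
    (h : GSInv s (p :: L)) : ∃ y, s.M y = none := by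
  by_contra! hc
  choose f hf using fun y => Option.ne_none_iff_exists'.1 (hc y)
  have hinj : Function.Injective f := fun y y' he => h.inj y y' (f y) (hf y) (he ▸ hf y')
  obtain ⟨y, hy⟩ := Finite.surjective_of_injective hinj p
  exact h.free p (by simp) y (hy ▸ hf y)

theorem GSInv.isMatching {s : GSState n} (h : GSInv s []) : IsMatching s.M := by
  choose g hg using fun x => h.matched x (by simp)
  have hinj : Function.Injective g := fun x x' he => by
    have := hg x
    rw [he, hg x'] at this
    exact (Option.some.inj this).symm
  exact ⟨Equiv.ofBijective g (Finite.injective_iff_bijective.1 hinj), hg⟩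

theorem GSInv.accept_free {s : GSState n} {p y : Fin n} {L : List (Fin n)}
    (h : GSInv s (p :: L)) (hy : s.M y = none) :
    GSInv ⟨Function.update s.M y (some p), insert (p, y) s.proposed⟩ L := by
  have hp : ∀ y', s.M y' ≠ some p := h.free p (by simp)
  have hnd := List.nodup_cons.1 h.nodup
  refine ⟨fun y₁ y₂ x h₁ h₂ => ?_, hnd.2, fun x hx y' => ?_, fun x hx => ?_,
    fun x y' hxy => ?_, fun y' hy' x => ?_⟩
  · simp only [Function.update_apply] at h₁ h₂
    split_ifs at h₁ h₂ with e₁ e₂ e₂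
    · rw [e₁, e₂]
    · cases h₁; exact (hp _ h₂).elim
    · cases h₂; exact (hp _ h₁).elim
    · exact h.inj _ _ _ h₁ h₂
  · simp only [Function.update_apply]
    split_ifs with e
    · intro he; cases he; exact hnd.1 hx
    · exact h.free x (by simp [hx]) y'
  · by_cases hxp : x = p
    · exact ⟨y, by simp [hxp]⟩
    · obtain ⟨y', hy'⟩ := h.matched x (by simp [hx, hxp])
      refine ⟨y', ?_⟩
      dsimp only
      rw [Function.update_of_ne, hy']
      rintro rfl; simp [hy] at hy'
  · simp only [Function.update_apply] at hxy
    split_ifs at hxy with e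
    · cases hxy; simp [e]
    · exact Finset.mem_insert_of_mem (h.proposed _ _ hxy)
  · simp only [Function.update_apply] at hy'
    split_ifs at hy' with e
    simpa [e] using h.untouched y' hy' x

theorem GSInv.accept {s : GSState n} {p p₁ y : Fin n} {L : List (Fin n)}
    (h : GSInv s (p :: L)) (hy : s.M y = some p₁) :
    GSInv ⟨Function.update s.M y (some p), insert (p, y) s.proposed⟩ (p₁ :: L) := by
  have hp : ∀ y', s.M y' ≠ some p := h.free p (by simp)
  have hnd := List.nodup_cons.1 h.nodup
  refine ⟨fun y₁ y₂ x h₁ h₂ => ?_, List.nodup_cons.2 ⟨fun hp₁ => ?_, hnd.2⟩, fun x hx y' => ?_,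
    fun x hx => ?_, fun x y' hxy => ?_, fun y' hy' x => ?_⟩
  · simp only [Function.update_apply] at h₁ h₂
    split_ifs at h₁ h₂ with e₁ e₂ e₂
    · rw [e₁, e₂]
    · cases h₁; exact (hp _ h₂).elim
    · cases h₂; exact (hp _ h₁).elim
    · exact h.inj _ _ _ h₁ h₂
  · exact h.free p₁ (by simp [hp₁]) y hy
  · simp only [Function.update_apply]
    split_ifs with e
    · intro he; cases he
      rcases List.mem_cons.1 hx with rfl | hx
      · exact hp _ hy
      · exact hnd.1 hx
    · rcases List.mem_cons.1 hx with rfl | hx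
      · exact fun he => e (h.inj _ _ _ he hy)
      · exact h.free x (by simp [hx]) y'
  · by_cases hxp : x = p
    · exact ⟨y, by simp [hxp]⟩
    · simp only [List.mem_cons, not_or] at hx
      obtain ⟨y', hy'⟩ := h.matched x (by simp [hx.2, hxp])
      refine ⟨y', ?_⟩
      dsimp only
      rw [Function.update_of_ne, hy']
      rintro rfl; rw [hy] at hy'; cases hy'; exact hx.1 rfl
  · simp only [Function.update_apply] at hxy
    split_ifs at hxy with e
    · cases hxy; simp [e]
    · exact Finset.mem_insert_of_mem (h.proposed _ _ hxy)
  · simp only [Function.update_apply] at hy'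
    split_ifs at hy' with e
    simpa [e] using h.untouched y' hy' x

theorem GSInv.reject {s : GSState n} {p p₁ y : Fin n} {U : List (Fin n)}
    (h : GSInv s U) (hy : s.M y = some p₁) : GSInv ⟨s.M, insert (p, y) s.proposed⟩ U := by
  refine ⟨h.inj, h.nodup, h.free, h.matched,
    fun x y' hxy => Finset.mem_insert_of_mem (h.proposed _ _ hxy), fun y' hy' x => ?_⟩
  have : y' ≠ y := by rintro rfl; rw [hy] at hy'; cases hy'
  simpa [this] using h.untouched y' hy' x

/-- An unmatched player has had no proposal from anyone, so it is still available to every proposer.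
This keeps the list of candidates nonempty. -/
theorem GSInv.exists_not_proposed {s : GSState n} {p : Fin n} {L : List (Fin n)}
    (h : GSInv s (p :: L)) : ∃ y, ∀ x, (x, y) ∉ s.proposed := by
  obtain ⟨y, hy⟩ := h.exists_unmatched
  exact ⟨y, h.untouched y hy⟩

theorem GSInv.card_proposed_lt {s : GSState n} {p : Fin n} {L : List (Fin n)}
    (h : GSInv s (p :: L)) : s.proposed.card < n * n := by
  obtain ⟨y, hy⟩ := h.exists_not_proposed
  have : s.proposed ⊂ Finset.univ :=
    Finset.ssubset_univ_iff.2 fun he => hy p (he ▸ Finset.mem_univ _)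
  simpa using Finset.card_lt_card this

theorem GSInv.candidates_ne_nil {K : ℕ} (hK : 1 ≤ K) {a : Approx n} (ha : ∀ x y, y ∈ a x)
    {s : GSState n} {p : Fin n} {L : List (Fin n)} (h : GSInv s (p :: L)) :
    candidates K a p s ≠ [] := by
  obtain ⟨y, hy⟩ := h.exists_not_proposed
  have : y ∈ (a p).filter fun y => (p, y) ∉ s.proposed := by simp [ha, hy]
  unfold candidates
  rw [Ne, List.take_eq_nil_iff, not_or]
  exact ⟨by omega, List.ne_nil_of_mem this⟩

/-! ## Correctness of the programs -/

/-- All approximations are permutations of the other side. -/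
def IsPermApprox (a : Approx n) : Prop := ∀ x, (a x).Perm (List.finRange n)

theorem IsPermApprox.mem {a : Approx n} (h : IsPermApprox a) (x y : Fin n) : y ∈ a x :=
  (h x).mem_iff.2 (List.mem_finRange y)

theorem leaves_propose {K : ℕ} (hK : 1 ≤ K) {a : Approx n} (ha : ∀ x y, y ∈ a x) (r : ℕ)
    {p : Fin n} {s : GSState n} {L : List (Fin n)} (h : GSInv s (p :: L))
    (hr : n * n ≤ r + s.proposed.card) :
    (propose K a r p s).Leaves fun s' => GSInv s' L := by
  induction r generalizing p s with
  -- The rounds cannot run out: every round inserts a new pair, and not all pairs can have been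
  -- proposed.
  | zero => have := h.card_proposed_lt; omega
  | succ r ih =>
    obtain ⟨b, l, hbl⟩ := List.exists_cons_of_ne_nil (h.candidates_ne_nil hK ha)
    rw [propose_cons hbl]
    refine (leaves_best _ b l).bind fun y hy => ?_
    rw [← hbl] at hy
    have hy' := not_mem_proposed_of_mem_candidates hy
    have hcard : n * n ≤ r + (insert (p, y) s.proposed).card := by
      rw [Finset.card_insert_of_notMem hy']; omega
    unfold proposal
    cases hM : s.M y with
    | none => exact h.accept_free hM
    | some p₁ =>
      intro c
      cases c
      · exact ih (h.reject hM) hcard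
      · exact ih (h.accept hM) hcard

theorem leaves_modifiedGS {K : ℕ} (hK : 1 ≤ K) {a : Approx n} (ha : ∀ x y, y ∈ a x) :
    (modifiedGS K a).Leaves IsMatching := by
  rw [modifiedGS_eq]
  generalize hs : (⟨fun _ => none, ∅⟩ : GSState n) = s
  generalize hL : List.finRange n = L
  have h : GSInv s L := hs ▸ hL ▸ GSInv.initial
  clear hs hL
  induction L generalizing s with
  | nil => exact h.isMatching
  | cons x L ih =>
    exact (leaves_propose hK ha _ h (Nat.le_add_right _ _)).bind fun s' hs' => ih s' hs'

theorem partition_nil (z : Agent n) (p : Fin n) : partition z p [] = done ([], []) := rfl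

theorem partition_cons (z : Agent n) (p v : Fin n) (l : List (Fin n)) :
    partition z p (v :: l) = ask ⟨z, v, p⟩ fun b => (partition z p l).bind fun q =>
      if b then done (v :: q.1, q.2) else done (q.1, v :: q.2) := rfl

theorem quicksort_zero (z : Agent n) (l : List (Fin n)) : quicksort z 0 l = done [] := rfl

theorem quicksort_nil (z : Agent n) (d : ℕ) : quicksort z d [] = done [] := by
  cases d <;> rfl

theorem quicksort_cons (z : Agent n) (d : ℕ) (a : Fin n) (l : List (Fin n)) :
    quicksort z (d + 1) (a :: l) = rand l.length fun i =>
      (partition z ((a :: l).get i) ((a :: l).eraseIdx i)).bind fun q =>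
        (quicksort z d q.1).bind fun lo => (quicksort z d q.2).bind fun hi =>
          done (lo ++ (a :: l).get i :: hi) := rfl

theorem leaves_partition (z : Agent n) (p : Fin n) (l : List (Fin n)) :
    (partition z p l).Leaves fun q => (q.1 ++ q.2).Perm l := by
  induction l with
  | nil => simp [partition_nil, Leaves]
  | cons v l ih =>
    rw [partition_cons]
    intro b
    refine ih.bind fun q hq => ?_
    cases b
    · exact List.perm_middle.trans (hq.cons v)
    · exact hq.cons v

theorem leaves_quicksort (z : Agent n) (d : ℕ) (l : List (Fin n)) (hd : l.length ≤ d) :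
    (quicksort z d l).Leaves fun l' => l'.Perm l := by
  induction d generalizing l with
  | zero => simp [List.length_eq_zero_iff.1 (Nat.le_zero.1 hd), quicksort_zero, Leaves]
  | succ d ih =>
    cases l with
    | nil => simp [quicksort_nil, Leaves]
    | cons a l =>
      rw [quicksort_cons]
      intro i
      refine (leaves_partition _ _ _).bind fun q hq => ?_
      have hlen := hq.length_eq
      rw [List.length_append, List.length_eraseIdx_of_lt i.2] at hlen
      simp only [List.length_cons] at hlen hd
      refine (ih q.1 (by omega)).bind fun lo hlo => ?_
      refine (ih q.2 (by omega)).bind fun hi hhi => ?_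
      change (lo ++ (a :: l).get i :: hi).Perm (a :: l)
      refine List.perm_middle.trans (((hlo.append hhi).trans hq).cons _ |>.trans ?_)
      exact List.getElem_cons_eraseIdx_perm i.2

/-- The sorting process for the remaining players `L`. -/
def sortLoop : List (Fin n) → Approx n → Prog n (Approx n)
  | [], a => done a
  | x :: L, a => (quicksort (Sum.inl x) n (a x)).bind fun l => sortLoop L (Function.update a x l)

theorem sequentialSort_eq (a : Approx n) : sequentialSort a = sortLoop (List.finRange n) a := by
  unfold sequentialSort
  generalize List.finRange n = L
  induction L generalizing a with
  | nil => rfl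
  | cons x L ih =>
    rw [List.foldlM_cons, sortLoop, bind_eq, bind_eq, Prog.bind_assoc]
    congr 1
    funext l
    exact ih _

theorem leaves_sequentialSort {a : Approx n} (ha : IsPermApprox a) :
    (sequentialSort a).Leaves IsPermApprox := by
  rw [sequentialSort_eq]
  generalize List.finRange n = L
  induction L generalizing a with
  | nil => exact ha
  | cons x L ih =>
    refine (leaves_quicksort _ n (a x) (by simp [(ha x).length_eq])).bind fun l hl => ih fun x' => ?_
    by_cases hx : x' = x
    · subst hx; simpa using hl.trans (ha x')
    · simpa [hx] using ha x'

/-! ## Support of the joint process -/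

/-- The properties that all reachable states have. -/
structure State.Sound (s : State n) : Prop where
  approx : IsPermApprox s.approx
  sorter : s.sorter.Leaves IsPermApprox
  matcher : s.matcher.Leaves IsMatching
  output : IsMatching s.output

theorem sound_sortTurn {s s' : State n} (hs : s.Sound) (h : s' ∈ (sortTurn s).support) :
    s'.Sound := by
  unfold sortTurn at h
  rw [PMF.mem_support_map_iff] at h
  obtain ⟨p, hp, rfl⟩ := h
  have hl := hs.sorter.turn hp
  cases p with
  | done a => exact ⟨hl, leaves_sequentialSort hl, hs.matcher, hs.output⟩
  | ask q k => exact ⟨hs.approx, hl, hs.matcher, hs.output⟩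
  | rand m k => exact ⟨hs.approx, hl, hs.matcher, hs.output⟩

theorem sound_matchTurn {K : ℕ} (hK : 1 ≤ K) {s s' : State n} (hs : s.Sound)
    (h : s' ∈ (matchTurn K s).support) : s'.Sound := by
  unfold matchTurn at h
  rw [PMF.mem_support_map_iff] at h
  obtain ⟨p, hp, rfl⟩ := h
  have hl := hs.matcher.turn hp
  cases p with
  | done a => exact ⟨hs.approx, hs.sorter, leaves_modifiedGS hK hs.approx.mem, hl⟩
  | ask q k => exact ⟨hs.approx, hs.sorter, hl, hs.output⟩
  | rand m k => exact ⟨hs.approx, hs.sorter, hl, hs.output⟩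

theorem sound_timeStep {K : ℕ} (hK : 1 ≤ K) (α t : ℕ) {s s' : State n} (hs : s.Sound)
    (h : s' ∈ (timeStep K α t s).support) : s'.Sound := by
  unfold timeStep at h
  rw [PMF.mem_support_bind_iff] at h
  obtain ⟨s₁, h₁, h₂⟩ := h
  have hs₁ : s₁.Sound := by
    split_ifs at h₁
    · exact sound_sortTurn hs h₁
    · exact sound_matchTurn hK hs h₁
  rw [PMF.mem_support_map_iff] at h₂
  obtain ⟨π, -, rfl⟩ := h₂
  exact ⟨hs₁.approx, hs₁.sorter, hs₁.matcher, hs₁.output⟩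

theorem isPermApprox_ofFn (σ : Fin n → Equiv.Perm (Fin n)) :
    IsPermApprox fun x => List.ofFn (σ x) := fun x => by
  dsimp only
  rw [List.ofFn_eq_map]
  exact (List.perm_ext_iff_of_nodup ((List.nodup_finRange n).map (σ x).injective)
    (List.nodup_finRange n)).2 fun y => by simpa using ⟨(σ x).symm y, by simp⟩

theorem sound_law {K : ℕ} (hK : 1 ≤ K) (α t : ℕ) {s : State n} (h : s ∈ (law n K α t).support) :
    s.Sound := by
  induction t generalizing s with
  | zero =>
    simp only [law, initial, PMF.mem_support_bind_iff, PMF.mem_support_map_iff] at h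
    obtain ⟨π, -, σ, -, rfl⟩ := h
    have ha := isPermApprox_ofFn σ
    exact ⟨ha, leaves_sequentialSort ha, leaves_modifiedGS hK ha.mem, Equiv.refl _, fun x => rfl⟩
  | succ t ih =>
    rw [law, PMF.mem_support_bind_iff] at h
    obtain ⟨s₁, h₁, h₂⟩ := h
    exact sound_timeStep hK α _ (ih h₁) h₂

/-! ## Relabelling the elements of the lists of `A` -/

/-- For every `x ∈ A`, the elements of the list of `x` are renamed by `σ x`. -/
def relabelPrefs (σ : Fin n → Equiv.Perm (Fin n)) (π : Prefs n) : Prefs n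
  | Sum.inl x => (σ x).symm.trans (π (Sum.inl x))
  | Sum.inr y => π (Sum.inr y)

/-- The approximations after renaming. -/
def relabelApprox (σ : Fin n → Equiv.Perm (Fin n)) (a : Approx n) : Approx n :=
  fun x => (a x).map (σ x)

/-- A query after renaming. -/
def relabelQuery (σ : Fin n → Equiv.Perm (Fin n)) : Query n → Query n
  | ⟨Sum.inl x, u, v⟩ => ⟨Sum.inl x, σ x u, σ x v⟩
  | ⟨Sum.inr y, u, v⟩ => ⟨Sum.inr y, u, v⟩

/-- A program after renaming in all queries; the results are changed by `f`. -/
def relabelProg {R R' : Type} (σ : Fin n → Equiv.Perm (Fin n)) (f : R → R') :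
    Prog n R → Prog n R'
  | done r => done (f r)
  | ask q k => ask (relabelQuery σ q) fun b => relabelProg σ f (k b)
  | rand m k => rand m fun i => relabelProg σ f (k i)

/-- The whole symmetry argument rests on this equivariance: a program sees only comparisons, so it
cannot notice a renaming applied to its queries and to the lists alike. -/
theorem relabelQuery_answer (σ : Fin n → Equiv.Perm (Fin n)) (q : Query n) (π : Prefs n) :
    (relabelQuery σ q).answer (relabelPrefs σ π) = q.answer π := by
  obtain ⟨z | z, u, v⟩ := q
  · simp [relabelQuery, Query.answer, relabelPrefs]
  · rfl

theorem swapAt_relabel (σ : Fin n → Equiv.Perm (Fin n)) (π : Prefs n) (z : Agent n)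
    (i : Fin (n - 1)) : swapAt (relabelPrefs σ π) z i = relabelPrefs σ (swapAt π z i) := by
  funext z'
  by_cases h : z' = z
  · subst h
    cases z' <;> simp [swapAt, relabelPrefs, Equiv.trans_assoc]
  · cases z' <;> simp [swapAt, relabelPrefs, h]

theorem evolve_relabel (σ : Fin n → Equiv.Perm (Fin n)) (π : Prefs n) :
    evolve (relabelPrefs σ π) = (evolve π).map (relabelPrefs σ) := by
  unfold evolve
  split_ifs
  · rw [PMF.map_comp]
    congr 1
    funext e
    exact swapAt_relabel σ π e.1 e.2
  · rw [PMF.pure_map]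

theorem evolveMany_relabel (σ : Fin n → Equiv.Perm (Fin n)) (α : ℕ) (π : Prefs n) :
    evolveMany α (relabelPrefs σ π) = (evolveMany α π).map (relabelPrefs σ) := by
  induction α generalizing π with
  | zero => simp [evolveMany, PMF.pure_map]
  | succ α ih =>
    rw [evolveMany, evolveMany, evolve_relabel, PMF.map_bind, PMF.bind_map]
    congr 1
    funext π'
    exact ih π'

theorem tick_relabel (σ : Fin n → Equiv.Perm (Fin n)) (ξ : ℝ≥0∞) (α : ℕ) (f : Prefs n → ℝ≥0∞)
    (π : Prefs n) : tick ξ (evolveMany α) f (relabelPrefs σ π) =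
      tick ξ (evolveMany α) (fun π' => f (relabelPrefs σ π')) π := by
  rw [tick, evolveMany_relabel, expect_map, tick]

theorem tick_tick_relabel (σ : Fin n → Equiv.Perm (Fin n)) (ξ : ℝ≥0∞) (α : ℕ)
    (f : Prefs n → ℝ≥0∞) (π : Prefs n) :
    tick ξ (evolveMany α) (tick ξ (evolveMany α) f) (relabelPrefs σ π) =
      tick ξ (evolveMany α) (tick ξ (evolveMany α) fun π' => f (relabelPrefs σ π')) π := by
  rw [tick_relabel]
  exact congrArg (tick ξ (evolveMany α) · π) (funext fun π' => tick_relabel σ ξ α f π')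

theorem wp_relabel {R R' : Type} (σ : Fin n → Equiv.Perm (Fin n)) (f : R → R') (ξ : ℝ≥0∞) (α : ℕ)
    (F : R' → Prefs n → ℝ≥0∞) (p : Prog n R) (π : Prefs n) :
    wp ξ (evolveMany α) id F (relabelProg σ f p) (relabelPrefs σ π) =
      wp ξ (evolveMany α) id (fun r π' => F (f r) (relabelPrefs σ π')) p π := by
  induction p generalizing π with
  | done r => rfl
  | ask q k ih =>
    simp only [relabelProg, wp, tick_tick_relabel, id, relabelQuery_answer]
    congr 2
    funext π'
    exact ih _ π'
  | rand m k ih => simp only [relabelProg, wp, ih]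

theorem relabelProg_bind {R R' R₁ R₁' : Type} (σ : Fin n → Equiv.Perm (Fin n)) (f : R → R')
    (f₁ : R₁ → R₁') (p : Prog n R) (g : R → Prog n R₁) (g' : R' → Prog n R₁')
    (h : ∀ r, relabelProg σ f₁ (g r) = g' (f r)) :
    relabelProg σ f₁ (p.bind g) = (relabelProg σ f p).bind g' := by
  induction p with
  | done r => exact h r
  | ask q k ih => simp only [Prog.bind, relabelProg, ih]
  | rand m k ih => simp only [Prog.bind, relabelProg, ih]

theorem best_relabel (σ : Fin n → Equiv.Perm (Fin n)) (x b : Fin n) (l : List (Fin n)) :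
    relabelProg σ (σ x) (best (Sum.inl x) b l) = best (Sum.inl x) (σ x b) (l.map (σ x)) := by
  induction l generalizing b with
  | nil => rfl
  | cons v l ih =>
    simp only [best_cons, List.map_cons, relabelProg, relabelQuery, ih, apply_ite (σ x)]

theorem relabelPrefs_mul (σ τ : Fin n → Equiv.Perm (Fin n)) (π : Prefs n) :
    relabelPrefs (σ * τ) π = relabelPrefs σ (relabelPrefs τ π) := by
  funext z
  cases z <;> rfl

theorem relabelApprox_mul (σ τ : Fin n → Equiv.Perm (Fin n)) (a : Approx n) :
    relabelApprox (σ * τ) a = relabelApprox σ (relabelApprox τ a) := by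
  funext x
  simp [relabelApprox]

theorem mem_relabelApprox {σ : Fin n → Equiv.Perm (Fin n)} {a : Approx n}
    (ha : ∀ x y, y ∈ a x) (x y : Fin n) : y ∈ relabelApprox σ a x :=
  List.mem_map.2 ⟨(σ x).symm y, ha _ _, by simp⟩

/-! ## Relabellings that fix the revealed elements -/

/-- The relabellings that fix the given elements. -/
def fixing (P : Finset (Fin n × Fin n)) : Finset (Fin n → Equiv.Perm (Fin n)) :=
  Finset.univ.filter fun σ => ∀ q ∈ P, σ q.1 q.2 = q.2

theorem mem_fixing {P : Finset (Fin n × Fin n)} {σ : Fin n → Equiv.Perm (Fin n)} :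
    σ ∈ fixing P ↔ ∀ x y, (x, y) ∈ P → σ x y = y := by
  simp [fixing]

theorem mem_iff_of_mem_fixing {P : Finset (Fin n × Fin n)} {σ : Fin n → Equiv.Perm (Fin n)}
    (h : σ ∈ fixing P) (x y : Fin n) : (x, σ x y) ∈ P ↔ (x, y) ∈ P := by
  rw [mem_fixing] at h
  constructor
  · intro hy
    have := (σ x).injective (h x _ hy)
    rwa [this] at hy
  · intro hy; rwa [h x y hy]

/-- The exchange of `u` and `v` in the list of `p`. -/
def exchange (p u v : Fin n) : Fin n → Equiv.Perm (Fin n) := Pi.mulSingle p (Equiv.swap u v)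

theorem exchange_self (p u v : Fin n) : exchange p u v p = Equiv.swap u v := by simp [exchange]

theorem exchange_of_ne {p x : Fin n} (h : x ≠ p) (u v : Fin n) : exchange p u v x = 1 := by
  simp [exchange, h]

theorem exchange_mul_self (p u v : Fin n) : exchange p u v * exchange p u v = 1 := by
  rw [exchange, ← Pi.mulSingle_mul, Equiv.swap_mul_self, Pi.mulSingle_one]

theorem exchange_apply_of_mem {P : Finset (Fin n × Fin n)} {p u v x y : Fin n}
    (hu : (p, u) ∉ P) (hv : (p, v) ∉ P) (h : (x, y) ∈ P) : exchange p u v x y = y := by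
  by_cases hx : x = p
  · subst hx
    rw [exchange_self, Equiv.swap_apply_of_ne_of_ne] <;> rintro rfl <;> contradiction
  · rw [exchange_of_ne hx]; rfl

/-- Classify the renamings by the image `y` of `y₀`; right multiplication by an exchange carries
each class onto the renamings that also fix `(p, y)`. Read probabilistically, and with the classes
of equal size by the next lemma: under a random renaming that respects the past, the player proposed
to is uniform among the admissible ones, and afterwards the renaming is again uniform subject to one
more constraint. -/
theorem sum_fixing {P : Finset (Fin n × Fin n)} {p y₀ : Fin n} (h₀ : (p, y₀) ∉ P)
    (f : (Fin n → Equiv.Perm (Fin n)) → ℝ≥0∞) :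
    ∑ σ ∈ fixing P, f σ = ∑ y ∈ Finset.univ.filter fun y => (p, y) ∉ P,
      ∑ τ ∈ fixing (insert (p, y) P), f (τ * exchange p y₀ y) := by
  rw [← Finset.sum_fiberwise_of_maps_to (s := fixing P)
    (t := Finset.univ.filter fun y => (p, y) ∉ P) (g := fun σ => σ p y₀)
    (fun σ hσ => by simpa [mem_iff_of_mem_fixing hσ] using h₀)]
  refine Finset.sum_congr rfl fun y hy => ?_
  have hy : (p, y) ∉ P := by simpa using hy
  refine Finset.sum_nbij' (fun σ => σ * exchange p y₀ y) (fun τ => τ * exchange p y₀ y)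
    (fun σ hσ => ?_) (fun τ hτ => ?_) (fun σ _ => ?_) (fun τ _ => ?_) (fun σ _ => ?_)
  · rw [Finset.mem_filter, mem_fixing] at hσ
    rw [mem_fixing]
    intro x y' hxy
    rcases Finset.mem_insert.1 hxy with he | hxy
    · cases he
      simp [exchange_self, hσ.2]
    · rw [Pi.mul_apply, Equiv.Perm.mul_apply, exchange_apply_of_mem h₀ hy hxy, hσ.1 x y' hxy]
  · rw [mem_fixing] at hτ
    rw [Finset.mem_filter, mem_fixing]
    refine ⟨fun x y' hxy => ?_, ?_⟩
    · rw [Pi.mul_apply, Equiv.Perm.mul_apply, exchange_apply_of_mem h₀ hy hxy,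
        hτ x y' (Finset.mem_insert_of_mem hxy)]
    · simp [exchange_self, hτ p y (Finset.mem_insert_self _ _)]
  · rw [mul_assoc, exchange_mul_self, mul_one]
  · rw [mul_assoc, exchange_mul_self, mul_one]
  · rw [mul_assoc, exchange_mul_self, mul_one]

/-- Conjugation by the exchange of `y` and `y'` is an injection; by symmetry the two cardinalities
are equal. -/
theorem card_fixing_insert_le {P : Finset (Fin n × Fin n)} {p y y' : Fin n} (hy : (p, y) ∉ P)
    (hy' : (p, y') ∉ P) :
    (fixing (insert (p, y) P)).card ≤ (fixing (insert (p, y') P)).card := by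
  refine Finset.card_le_card_of_injOn (fun τ => exchange p y y' * τ * exchange p y y')
    (fun τ hτ => ?_) (fun τ _ τ' _ h => by simpa using h)
  rw [Finset.mem_coe, mem_fixing] at hτ ⊢
  intro x u hxu
  rcases Finset.mem_insert.1 hxu with he | hxu
  · cases he
    have := hτ p y (Finset.mem_insert_self _ _)
    simp [exchange_self, this]
  · have := hτ x u (Finset.mem_insert_of_mem hxu)
    simp only [Pi.mul_apply, Equiv.Perm.mul_apply, exchange_apply_of_mem hy hy' hxu, this]

theorem card_fixing_insert {P : Finset (Fin n × Fin n)} {p y : Fin n} (hy : (p, y) ∉ P) :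
    (fixing P).card = (Finset.univ.filter fun y => (p, y) ∉ P).card *
      (fixing (insert (p, y) P)).card := by
  have h := sum_fixing hy fun _ => 1
  simp only [Finset.sum_const, nsmul_eq_mul, mul_one] at h
  rw [Finset.sum_congr rfl fun y' hy' => congrArg Nat.cast (le_antisymm
    (card_fixing_insert_le (by simpa using hy') hy)
    (card_fixing_insert_le hy (by simpa using hy')))] at h
  simp only [Finset.sum_const, nsmul_eq_mul] at h
  exact_mod_cast h

/-! ## The number of queries of a matching run -/

theorem wp_best_le {E : Type*} {ξ : ℝ≥0∞} {κ : E → PMF E} {pr : E → Prefs n}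
    {F : Fin n → E → ℝ≥0∞} {c : ℝ≥0∞} (z : Agent n) (b : Fin n) (l : List (Fin n))
    (h : ∀ y ∈ b :: l, ∀ e, F y e ≤ c) (e : E) :
    wp ξ κ pr F (best z b l) e ≤ (ξ ^ 2) ^ l.length * c := by
  induction l generalizing b e with
  | nil => simpa [best_nil, wp] using h b (by simp) e
  | cons v l ih =>
    rw [best_cons, wp]
    calc _ ≤ tick ξ κ (tick ξ κ fun _ => (ξ ^ 2) ^ l.length * c) e := by
          refine tick_mono fun e₁ => tick_mono fun e₂ => ih _ (fun y hy => h y ?_) e₂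
          split_ifs at hy <;> simp only [List.mem_cons] at hy ⊢ <;> tauto
      _ = _ := by
          simp only [funext (tick_const (ξ := ξ) (κ := κ) _), tick_const, List.length_cons]
          ring

/-- The number of players of `B` that are unmatched. -/
def unmatched (s : GSState n) : ℕ := (Finset.univ.filter fun y => s.M y = none).card

theorem unmatched_update_none {s : GSState n} {y p : Fin n} (hy : s.M y = none)
    (P : Finset (Fin n × Fin n)) :
    unmatched ⟨Function.update s.M y (some p), P⟩ + 1 = unmatched s := by
  unfold unmatched
  rw [← Finset.card_insert_of_notMem (a := y) (by simp)]
  congr 1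
  ext y'
  by_cases h : y' = y
  · subst h; simp [hy]
  · simp [h]

theorem unmatched_update_some {s : GSState n} {y p p₁ : Fin n} (hy : s.M y = some p₁)
    (P : Finset (Fin n × Fin n)) :
    unmatched ⟨Function.update s.M y (some p), P⟩ = unmatched s := by
  unfold unmatched
  congr 1
  ext y'
  by_cases h : y' = y
  · subst h; simp [hy]
  · simp [h]

theorem candidates_relabel {K : ℕ} {a : Approx n} {p : Fin n} {s : GSState n}
    {σ : Fin n → Equiv.Perm (Fin n)} (h : σ ∈ fixing s.proposed) :
    candidates K (relabelApprox σ a) p s = (candidates K a p s).map (σ p) := by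
  unfold candidates relabelApprox
  rw [List.filter_map, List.map_take]
  congr 3
  funext y
  simp [mem_iff_of_mem_fixing h]

/-- `X / N` is the mean of the potential "unmatched players plus one" after a proposal to one of `N`
equally likely targets, `u` of them free. The relative decrease u / (N(u+1)) is at least 1/(2m),
because u + 1 ≤ 2u, and this pays for a factor `θ` of at most 1 + 1/(2m). -/
theorem proposal_drift {θ : ℝ≥0∞} {u N X m : ℕ} (hm : 1 ≤ m) (hθ : 2 * m * θ ≤ 2 * m + 1)
    (hu : 1 ≤ u) (hN : N ≤ m) (hX : X + u = N * (u + 1)) :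
    θ * X ≤ N * (u + 1 : ℕ) := by
  have h2 : (2 * m : ℝ≥0∞) ≠ 0 := by simp; omega
  have h3 : (2 * m : ℝ≥0∞) ≠ ⊤ := ENNReal.mul_ne_top (by simp) (by simp)
  rw [← ENNReal.mul_le_mul_iff_right h2 h3]
  calc 2 * m * (θ * X) = (2 * m * θ) * X := by ring
    _ ≤ (2 * m + 1) * X := mul_le_mul_left hθ _
    _ = ((2 * m + 1) * X : ℕ) := by push_cast; ring
    _ ≤ (2 * m * (N * (u + 1)) : ℕ) := by
        refine Nat.cast_le.2 ?_
        have : N * (u + 1) ≤ m * (2 * u) := Nat.mul_le_mul hN (by omega)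
        nlinarith
    _ = _ := by push_cast; ring

/-! ### Coupon-collector bound for a matching run, averaged over renamings. -/

section Coupon

variable {ξ : ℝ≥0∞} {α K : ℕ}

/-- What one proposal costs once its target is known. A free target ends the chain of proposals and
lowers the number of unmatched players; otherwise one query follows and this number is unchanged,
whatever the answer. The factor `ξ ^ 2` is granted in both cases for uniformity. -/
theorem sum_wp_proposal_le (hξ : 1 ≤ ξ) {a : Approx n} (ha : ∀ x y, y ∈ a x)
    {L : List (Fin n)} {r : ℕ}
    (hL : ∀ (a : Approx n) (s : GSState n) (π : Prefs n), (∀ x y, y ∈ a x) → GSInv s L →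
      ∑ σ ∈ fixing s.proposed, wp ξ (evolveMany α) id (fun _ _ => 1)
        (matchLoop K (relabelApprox σ a) L s) (relabelPrefs σ π) ≤
          (fixing s.proposed).card * (unmatched s + 1 : ℕ))
    (hr : ∀ (p : Fin n) (a : Approx n) (s : GSState n) (π : Prefs n), (∀ x y, y ∈ a x) →
      GSInv s (p :: L) → n * n ≤ r + s.proposed.card →
      ∑ σ ∈ fixing s.proposed, wp ξ (evolveMany α) id (fun _ _ => 1)
        ((propose K (relabelApprox σ a) r p s).bind (matchLoop K (relabelApprox σ a) L))
          (relabelPrefs σ π) ≤ (fixing s.proposed).card * (unmatched s + 1 : ℕ))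
    {p : Fin n} {s : GSState n} (hs : GSInv s (p :: L)) (hfuel : n * n ≤ r + 1 + s.proposed.card)
    {y : Fin n} (hy : (p, y) ∉ s.proposed) (π : Prefs n) :
    ∑ τ ∈ fixing (insert (p, y) s.proposed), wp ξ (evolveMany α) id (fun _ _ => 1)
        ((proposal K (relabelApprox τ a) r p s y).bind (matchLoop K (relabelApprox τ a) L))
          (relabelPrefs τ π) ≤
      (fixing (insert (p, y) s.proposed)).card *
        (ξ ^ 2 * (if s.M y = none then unmatched s else unmatched s + 1 : ℕ)) := by
  have hcard : n * n ≤ r + (insert (p, y) s.proposed).card := by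
    rw [Finset.card_insert_of_notMem hy]; omega
  unfold proposal
  cases hM : s.M y with
  | none =>
    simp only [Prog.bind]
    refine (hL a _ π ha (hs.accept_free hM)).trans ?_
    rw [unmatched_update_none hM, if_pos trivial]
    exact mul_le_mul_right (le_mul_of_one_le_left' (one_le_pow₀ hξ)) _
  | some p₁ =>
    simp only [Prog.bind, wp, tick_tick_relabel, id]
    rw [← tick_tick_sum, if_neg (by simp)]
    calc _ ≤ tick ξ (evolveMany α) (tick ξ (evolveMany α) fun _ =>
          (fixing (insert (p, y) s.proposed)).card * (unmatched s + 1 : ℕ)) π := by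
          refine tick_mono fun π₁ => tick_mono fun π₂ => ?_
          -- The lists of `B` are not renamed, so the answer is the same for all `τ` and the case
          -- distinction can be made outside the sum.
          have hans : ∀ τ, (Query.answer ⟨Sum.inr y, p, p₁⟩ (relabelPrefs τ π₂)) =
              Query.answer ⟨Sum.inr y, p, p₁⟩ π₂ :=
            fun τ => relabelQuery_answer τ ⟨Sum.inr y, p, p₁⟩ π₂
          simp only [hans]
          by_cases hb : Query.answer ⟨Sum.inr y, p, p₁⟩ π₂ = true
          · simp only [hb, if_true]
            refine (hr p₁ a _ π₂ ha (hs.accept hM) hcard).trans ?_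
            rw [unmatched_update_some hM]
          · simp only [hb]
            exact hr p a _ π₂ ha (hs.reject hM) hcard
      _ = _ := by
          simp only [funext (tick_const (ξ := ξ) (κ := evolveMany (n := n) α) _), tick_const]
          ring

/-- The scan takes place in unrenamed coordinates and does not depend on the renaming; only the name
of its winner does, and it is uniform over the players not yet proposed to. A proposal needs
`l.length` ≤ K − 1 comparisons and at most one query to the recipient, so its weight is at most `(ξ
^ 2) ^ K`, which the coupon drift tolerates. -/
theorem sum_wp_propose_le (hξ : 1 ≤ ξ) (hK : 1 ≤ K) (hθ : 2 * n * (ξ ^ 2) ^ K ≤ 2 * n + 1)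
    {L : List (Fin n)}
    (hL : ∀ (a : Approx n) (s : GSState n) (π : Prefs n), (∀ x y, y ∈ a x) → GSInv s L →
      ∑ σ ∈ fixing s.proposed, wp ξ (evolveMany α) id (fun _ _ => 1)
        (matchLoop K (relabelApprox σ a) L s) (relabelPrefs σ π) ≤
          (fixing s.proposed).card * (unmatched s + 1 : ℕ))
    (r : ℕ) (p : Fin n) (a : Approx n) (s : GSState n) (π : Prefs n) (ha : ∀ x y, y ∈ a x)
    (hs : GSInv s (p :: L)) (hfuel : n * n ≤ r + s.proposed.card) :
    ∑ σ ∈ fixing s.proposed, wp ξ (evolveMany α) id (fun _ _ => 1)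
      ((propose K (relabelApprox σ a) r p s).bind (matchLoop K (relabelApprox σ a) L))
        (relabelPrefs σ π) ≤ (fixing s.proposed).card * (unmatched s + 1 : ℕ) := by
  induction r generalizing p a s π with
  | zero => have := hs.card_proposed_lt; omega
  | succ r ih =>
    obtain ⟨b, l, hbl⟩ := List.exists_cons_of_ne_nil (hs.candidates_ne_nil hK ha)
    have hlen : l.length + 1 ≤ K := by
      have := congrArg List.length hbl
      simp only [candidates, List.length_take, List.length_cons] at this
      omega
    set u := unmatched s with hu
    set N := (Finset.univ.filter fun y => (p, y) ∉ s.proposed).card with hN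
    have hu1 : 1 ≤ u := by
      obtain ⟨y, hy⟩ := hs.exists_unmatched
      exact Finset.card_pos.2 ⟨y, by simp [hy]⟩
    have key : ∀ y₀ ∈ b :: l, ∀ π : Prefs n,
        ∑ σ ∈ fixing s.proposed, wp ξ (evolveMany α) id (fun _ _ => 1)
          ((proposal K (relabelApprox σ a) r p s (σ p y₀)).bind (matchLoop K (relabelApprox σ a) L))
          (relabelPrefs σ π) ≤
        (fixing (insert (p, b) s.proposed)).card *
          (ξ ^ 2 * ((∑ y ∈ Finset.univ.filter fun y => (p, y) ∉ s.proposed,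
            if s.M y = none then u else u + 1 : ℕ) : ℝ≥0∞)) := by
      intro y₀ hy₀ π
      rw [← hbl] at hy₀
      have h₀ := not_mem_proposed_of_mem_candidates hy₀
      have hb : (p, b) ∉ s.proposed :=
        not_mem_proposed_of_mem_candidates (K := K) (a := a) (by rw [hbl]; simp)
      rw [sum_fixing h₀, Nat.cast_sum, Finset.mul_sum, Finset.mul_sum]
      refine Finset.sum_le_sum fun y hy => ?_
      have hy : (p, y) ∉ s.proposed := by simpa using hy
      rw [le_antisymm (card_fixing_insert_le hb hy) (card_fixing_insert_le hy hb)]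
      refine le_trans (le_of_eq ?_) (sum_wp_proposal_le (α := α) hξ
        (a := relabelApprox (exchange p y₀ y) a) (mem_relabelApprox ha) hL ih hs (by omega) hy
        (relabelPrefs (exchange p y₀ y) π))
      refine Finset.sum_congr rfl fun τ hτ => ?_
      have : (τ * exchange p y₀ y) p y₀ = y := by
        simp [exchange_self, mem_fixing.1 hτ p y (Finset.mem_insert_self _ _)]
      rw [this, relabelApprox_mul, relabelPrefs_mul]
    -- Undo the renaming during the scan. All summands then run the same scan and differ only in the
    -- continuation, so the sum can be moved inside.
    calc _ = ∑ σ ∈ fixing s.proposed, wp ξ (evolveMany α) id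
          (fun y₀ π => wp ξ (evolveMany α) id (fun _ _ => 1)
            ((proposal K (relabelApprox σ a) r p s (σ p y₀)).bind
              (matchLoop K (relabelApprox σ a) L)) (relabelPrefs σ π))
          (best (Sum.inl p) b l) π := by
          refine Finset.sum_congr rfl fun σ hσ => ?_
          have hc : candidates K (relabelApprox σ a) p s = σ p b :: l.map (σ p) := by
            rw [candidates_relabel hσ, hbl, List.map_cons]
          rw [propose_cons hc, Prog.bind_assoc, wp_bind, ← best_relabel, wp_relabel]
      _ ≤ (ξ ^ 2) ^ l.length * ((fixing (insert (p, b) s.proposed)).card *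
          (ξ ^ 2 * ((∑ y ∈ Finset.univ.filter fun y => (p, y) ∉ s.proposed,
            if s.M y = none then u else u + 1 : ℕ) : ℝ≥0∞))) := by
          rw [← wp_sum]
          exact wp_best_le _ _ _ key π
      _ = (fixing (insert (p, b) s.proposed)).card * ((ξ ^ 2) ^ (l.length + 1) *
          ((∑ y ∈ Finset.univ.filter fun y => (p, y) ∉ s.proposed,
            if s.M y = none then u else u + 1 : ℕ) : ℝ≥0∞)) := by ring
      _ ≤ (fixing (insert (p, b) s.proposed)).card * (N * (u + 1 : ℕ)) := by
          refine mul_le_mul_right ?_ _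
          refine proposal_drift (m := n) (by have := p.2; omega) ?_ hu1
            ((Finset.card_le_univ _).trans (by simp)) ?_
          · refine le_trans (mul_le_mul_right (pow_le_pow_right₀ (one_le_pow₀ hξ) hlen) _) hθ
          -- No unmatched player has been proposed to, so all `u` of them are among the possible
          -- targets.
          · have h1 : u = ∑ y ∈ Finset.univ.filter fun y => (p, y) ∉ s.proposed,
                if s.M y = none then 1 else 0 := by
              rw [hu, unmatched, Finset.card_eq_sum_ones, Finset.sum_filter,
                Finset.sum_filter]
              refine Finset.sum_congr rfl fun y _ => ?_
              by_cases hy : s.M y = none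
              · simp [hy, hs.untouched y hy p]
              · simp [hy]
            have h2 : (∑ y ∈ Finset.univ.filter fun y => (p, y) ∉ s.proposed,
                  if s.M y = none then u else u + 1) +
                (∑ y ∈ Finset.univ.filter fun y => (p, y) ∉ s.proposed,
                  if s.M y = none then 1 else 0) = N * (u + 1) := by
              rw [← Finset.sum_add_distrib, hN, Finset.card_eq_sum_ones, Finset.sum_mul]
              refine Finset.sum_congr rfl fun y _ => ?_
              split_ifs <;> simp
            rwa [← h1] at h2
      _ = _ := by
          have hb : (p, b) ∉ s.proposed :=
            not_mem_proposed_of_mem_candidates (K := K) (a := a) (by rw [hbl]; simp)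
          rw [card_fixing_insert hb, Nat.cast_mul, ← hN]
          ring

theorem sum_wp_matchLoop_le (hξ : 1 ≤ ξ) (hK : 1 ≤ K) (hθ : 2 * n * (ξ ^ 2) ^ K ≤ 2 * n + 1)
    (L : List (Fin n)) (a : Approx n) (s : GSState n) (π : Prefs n) (ha : ∀ x y, y ∈ a x)
    (hs : GSInv s L) :
    ∑ σ ∈ fixing s.proposed, wp ξ (evolveMany α) id (fun _ _ => 1)
        (matchLoop K (relabelApprox σ a) L s) (relabelPrefs σ π) ≤
          (fixing s.proposed).card * (unmatched s + 1 : ℕ) := by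
  induction L generalizing a s π with
  | nil =>
    simp only [matchLoop, wp, Finset.sum_const, nsmul_eq_mul]
    exact mul_le_mul_right (by exact_mod_cast Nat.le_add_left _ _) _
  | cons p L ih =>
    exact sum_wp_propose_le hξ hK hθ ih (n * n) p a s π ha hs (Nat.le_add_right _ _)

/-- On average over all relabellings, the weighted number of queries of a matching run is small. -/
theorem sum_wp_modifiedGS_le (hξ : 1 ≤ ξ) (hK : 1 ≤ K) (hθ : 2 * n * (ξ ^ 2) ^ K ≤ 2 * n + 1)
    (a : Approx n) (π : Prefs n) (ha : ∀ x y, y ∈ a x) :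
    ∑ σ, wp ξ (evolveMany α) id (fun _ _ => 1)
        (modifiedGS K (relabelApprox σ a)) (relabelPrefs σ π) ≤
      (Fintype.card (Fin n → Equiv.Perm (Fin n)) : ℝ≥0∞) * (n + 1 : ℕ) := by
  have h := sum_wp_matchLoop_le (α := α) hξ hK hθ _ a _ π ha GSInv.initial
  simp only [← modifiedGS_eq] at h
  have hu : unmatched (⟨fun _ => none, ∅⟩ : GSState n) = n := by simp [unmatched]
  have hf : fixing (∅ : Finset (Fin n × Fin n)) = Finset.univ := by simp [fixing]
  simpa only [hu, hf, Finset.card_univ] using h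

end Coupon

/-! ## Evolution events -/

/-- An evolution event. -/
abbrev Event (n : ℕ) : Type := Agent n × Fin (n - 1)

/-- The event `e` moves the element `u` of the list of `z`. -/
def Moves (π : Prefs n) (e : Event n) (z : Agent n) (u : Fin n) : Prop :=
  e.1 = z ∧ ((π z u).val = e.2.val ∨ (π z u).val = e.2.val + 1)

instance (π : Prefs n) (e : Event n) (z : Agent n) (u : Fin n) : Decidable (Moves π e z u) := by
  unfold Moves; infer_instance

theorem card_event (n : ℕ) : Fintype.card (Event n) = 2 * n * (n - 1) := by
  simp [two_mul]

theorem expect_evolve (hn : 2 ≤ n) (π : Prefs n) (f : Prefs n → ℝ≥0∞) :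
    expect (evolve π) f =
      ((2 * n * (n - 1) : ℕ) : ℝ≥0∞)⁻¹ * ∑ e : Event n, f (swapAt π e.1 e.2) := by
  unfold evolve
  rw [dif_pos hn, expect_map]
  have : Nonempty (Event n) := ⟨(Sum.inl ⟨0, by omega⟩, ⟨0, by omega⟩)⟩
  rw [expect_uniform, card_event]

theorem card_moves_le (π : Prefs n) (z : Agent n) (u : Fin n) :
    (Finset.univ.filter fun e : Event n => Moves π e z u).card ≤ 2 := by
  calc _ ≤ (({(π z u).val, (π z u).val - 1} : Finset ℕ)).card := by
        refine Finset.card_le_card_of_injOn (fun e => e.2.val) (fun e he => ?_)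
          (fun e he e' he' h => ?_)
        · obtain ⟨-, -, he⟩ := Finset.mem_filter.1 he
          simp only [Finset.coe_insert, Finset.coe_singleton, Set.mem_insert_iff,
            Set.mem_singleton_iff]
          omega
        · obtain ⟨-, he, -⟩ := Finset.mem_filter.1 he
          obtain ⟨-, he', -⟩ := Finset.mem_filter.1 he'
          exact Prod.ext (he.trans he'.symm) (Fin.ext h)
    _ ≤ 2 := Finset.card_le_two

theorem swapAt_apply_of_ne {π : Prefs n} {z z' : Agent n} (h : z' ≠ z) (i : Fin (n - 1)) :
    swapAt π z i z' = π z' := by simp [swapAt, h]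

theorem swapAt_val (π : Prefs n) (z : Agent n) (i : Fin (n - 1)) (u : Fin n) :
    (swapAt π z i z u).val = if (π z u).val = i.val then i.val + 1 else
      if (π z u).val = i.val + 1 then i.val else (π z u).val := by
  simp only [swapAt, Function.update_self, Equiv.trans_apply, Equiv.swap_apply_def, Fin.ext_iff]
  split_ifs <;> rfl

theorem swapAt_eq_of_not_moves {π : Prefs n} {e : Event n} {z : Agent n} {u : Fin n}
    (h : ¬ Moves π e z u) : swapAt π e.1 e.2 z u = π z u := by
  by_cases hz : z = e.1
  · subst hz
    simp only [Moves, true_and, not_or] at h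
    rw [Fin.ext_iff, swapAt_val, if_neg h.1, if_neg h.2]
  · rw [swapAt_apply_of_ne hz]

/-- An adjacent swap changes the order of the two swapped elements only. Hence the set of elements
before `u` can change only if `u` itself moves. -/
theorem swapAt_lt_iff {π : Prefs n} {e : Event n} {z : Agent n} {u : Fin n}
    (h : ¬ Moves π e z u) (v : Fin n) :
    swapAt π e.1 e.2 z v < swapAt π e.1 e.2 z u ↔ π z v < π z u := by
  rw [swapAt_eq_of_not_moves h]
  by_cases hz : z = e.1
  · subst hz
    simp only [Moves, true_and, not_or] at h
    rw [Fin.lt_def, Fin.lt_def, swapAt_val]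
    split_ifs <;> omega
  · rw [swapAt_apply_of_ne hz]

/-- The positions of `p` in both lists of `z` are the same, relative to the other elements. -/
def SameOrder (z : Agent n) (p : Fin n) (π π' : Prefs n) : Prop :=
  ∀ v, π' z v < π' z p ↔ π z v < π z p

/-- At most two of the 2n(n−1) events move `p` in the list of `z`; on these the crude bound `C` is
used, with probability at most 1/(n(n−1)). -/
theorem expect_evolve_le_of_sameOrder (hn : 2 ≤ n) {z : Agent n} {p : Fin n} {π : Prefs n}
    {f : Prefs n → ℝ≥0∞} {c C : ℝ≥0∞} (hc : ∀ π', SameOrder z p π π' → f π' ≤ c)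
    (hC : ∀ π', f π' ≤ C) :
    expect (evolve π) f ≤ c + ((n * (n - 1) : ℕ) : ℝ≥0∞)⁻¹ * C := by
  have hpos : ((2 * n * (n - 1) : ℕ) : ℝ≥0∞) ≠ 0 :=
    Nat.cast_ne_zero.2 (Nat.mul_ne_zero (by omega) (by omega))
  rw [expect_evolve hn]
  calc _ ≤ ((2 * n * (n - 1) : ℕ) : ℝ≥0∞)⁻¹ *
        ∑ e : Event n, (c + if Moves π e z p then C else 0) := by
        refine mul_le_mul_right (Finset.sum_le_sum fun e _ => ?_) _
        split_ifs with h
        · exact (hC _).trans le_add_self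
        · rw [add_zero]; exact hc _ (swapAt_lt_iff h)
    _ ≤ ((2 * n * (n - 1) : ℕ) : ℝ≥0∞)⁻¹ * ((2 * n * (n - 1) : ℕ) * c + 2 * C) := by
        refine mul_le_mul_right ?_ _
        rw [Finset.sum_add_distrib, Finset.sum_const, Finset.card_univ, card_event, nsmul_eq_mul,
          ← Finset.sum_filter, Finset.sum_const, nsmul_eq_mul]
        gcongr
        exact_mod_cast card_moves_le π z p
    _ = _ := by
        rw [mul_add, ← mul_assoc, ENNReal.inv_mul_cancel hpos (ENNReal.natCast_ne_top _), one_mul,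
          ← mul_assoc]
        congr 2
        rw [mul_assoc, Nat.cast_mul 2, ENNReal.mul_inv (by simp) (by simp), mul_right_comm,
          Nat.cast_two, ENNReal.inv_mul_cancel (by simp) (by simp), one_mul]

theorem expect_evolveMany_le_of_sameOrder (hn : 2 ≤ n) (α : ℕ) {z : Agent n} {p : Fin n}
    {π : Prefs n} {f : Prefs n → ℝ≥0∞} {c C : ℝ≥0∞}
    (hc : ∀ π', SameOrder z p π π' → f π' ≤ c) (hC : ∀ π', f π' ≤ C) :
    expect (evolveMany α π) f ≤ c + α * ((n * (n - 1) : ℕ) : ℝ≥0∞)⁻¹ * C := by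
  induction α generalizing π with
  | zero => simpa [evolveMany] using hc π fun _ => Iff.rfl
  | succ α ih =>
    rw [evolveMany, expect_bind]
    refine (expect_evolve_le_of_sameOrder hn (z := z) (p := p) (C := C)
      (fun π₁ h₁ => ih fun π₂ h₂ => hc π₂ fun v => (h₂ v).trans (h₁ v))
      (fun π₁ => (expect_mono hC).trans (expect_const _ _).le)).trans (le_of_eq ?_)
    push_cast
    ring

theorem tick_tick_le_of_sameOrder (hn : 2 ≤ n) (ξ : ℝ≥0∞) (α : ℕ) {z : Agent n} {p : Fin n}
    {π : Prefs n} {f : Prefs n → ℝ≥0∞} {c C : ℝ≥0∞}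
    (hc : ∀ π', SameOrder z p π π' → f π' ≤ c) (hC : ∀ π', f π' ≤ C) :
    tick ξ (evolveMany α) (tick ξ (evolveMany α) f) π ≤
      ξ ^ 2 * (c + 2 * α * ((n * (n - 1) : ℕ) : ℝ≥0∞)⁻¹ * C) := by
  rw [sq, mul_assoc]
  refine mul_le_mul_right ?_ _
  refine (expect_evolveMany_le_of_sameOrder hn α (z := z) (p := p)
    (c := ξ * (c + α * ((n * (n - 1) : ℕ) : ℝ≥0∞)⁻¹ * C)) (C := ξ * C)
    (fun π₁ h₁ => ?_) (fun π₁ => ?_)).trans (le_of_eq ?_)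
  · exact mul_le_mul_right (expect_evolveMany_le_of_sameOrder hn α
      (fun π₂ h₂ => hc π₂ fun v => (h₂ v).trans (h₁ v)) hC) _
  · exact mul_le_mul_right ((expect_mono hC).trans (expect_const _ _).le) _
  · ring

/-! ## The number of queries of a sorting run -/

theorem wp_partition_le_of_le {E : Type*} {ξ : ℝ≥0∞} {κ : E → PMF E} {pr : E → Prefs n}
    (z : Agent n) (p : Fin n) (l : List (Fin n)) {F : List (Fin n) × List (Fin n) → E → ℝ≥0∞}
    {C : ℝ≥0∞} (hC : ∀ q e, q.1.length + q.2.length = l.length → F q e ≤ C) (e : E) :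
    wp ξ κ pr F (partition z p l) e ≤ (ξ ^ 2) ^ l.length * C := by
  induction l generalizing F e with
  | nil => simpa [partition_nil, wp] using hC ([], []) e rfl
  | cons v l ih =>
    rw [partition_cons, wp]
    calc _ ≤ tick ξ κ (tick ξ κ fun _ => (ξ ^ 2) ^ l.length * C) e := by
          refine tick_mono fun e₁ => tick_mono fun e₂ => ?_
          rw [wp_bind]
          refine ih (fun q e' hq => ?_) e₂
          split_ifs
          · exact hC _ _ (by simp only [List.length_cons]; omega)
          · exact hC _ _ (by simp only [List.length_cons]; omega)
      _ = _ := by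
          simp only [funext (tick_const (ξ := ξ) (κ := κ) _), tick_const, List.length_cons]
          ring

/-- The number of elements of `l` that `z` ranks before `p`. -/
def numBefore (π : Prefs n) (z : Agent n) (p : Fin n) (l : List (Fin n)) : ℕ :=
  l.countP fun v => π z v < π z p

theorem SameOrder.numBefore_eq {z : Agent n} {p : Fin n} {π π' : Prefs n}
    (h : SameOrder z p π π') (l : List (Fin n)) : numBefore π' z p l = numBefore π z p l := by
  unfold numBefore
  congr 1
  funext v
  simp [h v]

/-- Unless the pivot itself is moved, the sizes of the parts are dictated by its rank at the start,
even if other elements move while they are being compared. Each query is preceded by 2α events that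
may move the pivot, and a union bound over the queries gives the error term. -/
theorem wp_partition_le (hn : 2 ≤ n) {ξ : ℝ≥0∞} {α : ℕ} (z : Agent n) (p : Fin n)
    (l : List (Fin n)) {F : List (Fin n) × List (Fin n) → Prefs n → ℝ≥0∞} {c C : ℝ≥0∞}
    {π : Prefs n} (hC : ∀ q e, q.1.length + q.2.length = l.length → F q e ≤ C)
    (hc : ∀ q e, q.1.length + q.2.length = l.length → q.1.length = numBefore π z p l → F q e ≤ c) :
    wp ξ (evolveMany α) id F (partition z p l) π ≤
      (ξ ^ 2) ^ l.length * (c + l.length * (2 * α * ((n * (n - 1) : ℕ) : ℝ≥0∞)⁻¹) * C) := by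
  induction l generalizing F π with
  | nil => simpa [partition_nil, wp] using hc ([], []) π rfl rfl
  | cons v l ih =>
    rw [partition_cons, wp]
    refine (tick_tick_le_of_sameOrder hn ξ α (z := z) (p := p)
      (c := (ξ ^ 2) ^ l.length * (c + l.length * (2 * α * ((n * (n - 1) : ℕ) : ℝ≥0∞)⁻¹) * C))
      (C := (ξ ^ 2) ^ l.length * C) (fun π' h => ?_) (fun π' => ?_)).trans (le_of_eq ?_)
    · rw [wp_bind]
      refine ih (fun q e hq => ?_) (fun q e hq hq' => ?_)
      · split_ifs
        · exact hC _ _ (by simp only [List.length_cons]; omega)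
        · exact hC _ _ (by simp only [List.length_cons]; omega)
      · rw [h.numBefore_eq] at hq'
        have hv : numBefore π z p (v :: l) =
            numBefore π z p l + if π z v < π z p then 1 else 0 := by
          simp [numBefore, List.countP_cons]
        have hans : Query.answer ⟨z, v, p⟩ (id π') = decide (π z v < π z p) := by
          simp [Query.answer, h v]
        rw [hans]
        by_cases hlt : π z v < π z p
        · simp only [hlt, decide_true, if_true, wp] at hv ⊢
          exact hc _ _ (by simp only [List.length_cons]; omega)
            (by simp only [List.length_cons]; omega)
        · simp only [hlt, decide_false, if_false, Bool.false_eq_true, wp] at hv ⊢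
          refine hc _ _ (by simp only [List.length_cons]; omega) ?_
          dsimp only
          omega
    · rw [wp_bind]
      refine wp_partition_le_of_le z p l (fun q e hq => ?_) π'
      split_ifs
      · exact hC _ _ (by simp only [List.length_cons]; omega)
      · exact hC _ _ (by simp only [List.length_cons]; omega)
    · rw [List.length_cons]
      push_cast
      ring

/-- Every rank occurs exactly once among the possible pivots. -/
theorem sum_numBefore (π : Prefs n) (z : Agent n) {l : List (Fin n)} (hl : l.Nodup)
    (φ : ℕ → ℝ≥0∞) :
    ∑ i : Fin l.length, φ (numBefore π z (l.get i) (l.eraseIdx i)) =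
      ∑ r ∈ Finset.range l.length, φ r := by
  have hr : ∀ i : Fin l.length, numBefore π z (l.get i) (l.eraseIdx i) =
      (Finset.univ.filter fun j : Fin l.length => π z (l.get j) < π z (l.get i)).card := by
    intro i
    have h1 : numBefore π z (l.get i) (l.eraseIdx i) = numBefore π z (l.get i) l := by
      unfold numBefore
      rw [← (List.getElem_cons_eraseIdx_perm i.2).countP_eq _, List.countP_cons]
      simp
    rw [h1, numBefore]
    have h2 : ∀ P : Fin n → Bool, l.countP P = ((List.finRange l.length).map l.get).countP P :=
      fun P => by rw [List.map_get_finRange]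
    rw [h2, List.countP_map, List.countP_eq_length_filter,
      ← List.toFinset_card_of_nodup ((List.nodup_finRange _).filter _)]
    congr 1
    ext j
    simp
  simp only [hr]
  set g : Fin l.length → ℕ := fun i =>
    (Finset.univ.filter fun j : Fin l.length => π z (l.get j) < π z (l.get i)).card with hg
  have hmono : ∀ i j, π z (l.get i) < π z (l.get j) → g i < g j := fun i j hij =>
    Finset.card_lt_card ⟨fun k hk => by
      simp only [Finset.mem_filter, Finset.mem_univ, true_and] at hk ⊢
      exact hk.trans hij, fun hsub => by
      have := hsub (Finset.mem_filter.2 ⟨Finset.mem_univ i, hij⟩)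
      simp at this⟩
  have hinj : Function.Injective g := by
    intro i j hij
    rcases lt_trichotomy (π z (l.get i)) (π z (l.get j)) with h | h | h
    · exact absurd hij (hmono i j h).ne
    · exact List.nodup_iff_injective_get.1 hl ((π z).injective h)
    · exact absurd hij (hmono j i h).ne'
  have himg : Finset.univ.image g = Finset.range l.length := by
    refine Finset.eq_of_subset_of_card_le (fun r hr => ?_) ?_
    · obtain ⟨i, -, rfl⟩ := Finset.mem_image.1 hr
      rw [Finset.mem_range]
      refine (Finset.card_lt_card (Finset.filter_ssubset.2 ⟨i, Finset.mem_univ _, by simp⟩)).trans_eq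
        (by simp)
    · rw [Finset.card_image_of_injective _ hinj]; simp
  rw [← himg, Finset.sum_image fun i _ j _ h => hinj h]

theorem wp_const {E : Type*} {R : Type} {ξ : ℝ≥0∞} {κ : E → PMF E} {pr : E → Prefs n} (c : ℝ≥0∞)
    (p : Prog n R) (e : E) :
    wp ξ κ pr (fun _ _ => c) p e = c * wp ξ κ pr (fun _ _ => 1) p e := by
  induction p generalizing e with
  | done r => simp [wp]
  | ask q k ih => simp only [wp, ih, tick_tick_mul_left]
  | rand m k ih => simp only [wp, ih, ← Finset.mul_sum, mul_left_comm]

/-! ### Drift of the exponential moment of quicksort. -/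

/-- A bound on the weighted number of queries for sorting `m` elements. -/
noncomputable def sortBound (n m : ℕ) : ℝ := Real.exp (3 * (m * Real.log m) / n)

theorem sortBound_pos (n m : ℕ) : 0 < sortBound n m := Real.exp_pos _

theorem mul_log_add_le {r s m : ℕ} {b : ℝ} (hm : r + s + 1 = m) (hb : 1 ≤ b) (hr : (r : ℝ) ≤ b)
    (hs : (s : ℝ) ≤ b) : r * Real.log r + s * Real.log s ≤ m * Real.log b := by
  have hlog : 0 ≤ Real.log b := Real.log_nonneg hb
  have h : ∀ k : ℕ, (k : ℝ) ≤ b → k * Real.log k ≤ k * Real.log b := fun k hk => by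
    rcases Nat.eq_zero_or_pos k with rfl | hk0
    · simp
    · exact mul_le_mul_of_nonneg_left (Real.log_le_log (by exact_mod_cast hk0) hk) (by positivity)
  have : (m : ℝ) = r + s + 1 := by exact_mod_cast hm.symm
  nlinarith [h r hr, h s hs]

theorem sortBound_mul_le {n r s m : ℕ} (hm : r + s + 1 = m) :
    sortBound n r * sortBound n s ≤ sortBound n m := by
  have h := mul_log_add_le (b := m) hm (by exact_mod_cast (by omega : 1 ≤ m))
    (by exact_mod_cast (by omega : r ≤ m)) (by exact_mod_cast (by omega : s ≤ m))
  rw [sortBound, sortBound, sortBound, ← Real.exp_add, Real.exp_le_exp, ← add_div]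
  gcongr
  linarith

/-- If both parts have at most 3m/4 elements, each logarithm drops by log(4/3), which gives the
factor (27/64)^(m/n). Bernoulli's inequality for the exponent m/n ≤ 1 bounds it by 1 − (37/64)(m/n).
-/
theorem sortBound_mul_le_of_balanced {n r s m : ℕ} (hmn : m ≤ n) (hm2 : 2 ≤ m)
    (hm : r + s + 1 = m) (hr : 4 * r ≤ 3 * m) (hs : 4 * s ≤ 3 * m) :
    sortBound n r * sortBound n s ≤ sortBound n m * (1 - 37 / 64 * (m / n)) := by
  have hm2' : (2 : ℝ) ≤ m := by exact_mod_cast hm2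
  have hmn' : (m : ℝ) ≤ n := by exact_mod_cast hmn
  have hn : (0 : ℝ) < n := by linarith
  have h := mul_log_add_le (b := 3 / 4 * m) hm (by linarith)
    (by have : (4 * r : ℝ) ≤ 3 * m := by exact_mod_cast hr
        linarith)
    (by have : (4 * s : ℝ) ≤ 3 * m := by exact_mod_cast hs
        linarith)
  rw [Real.log_mul (by norm_num) (by positivity)] at h
  have hb : Real.exp (3 * (m * Real.log (3 / 4)) / n) ≤ 1 - 37 / 64 * (m / n) := by
    have : (1 + (-37 / 64 : ℝ)) ^ ((m : ℝ) / n) ≤ 1 + (m / n) * (-37 / 64) :=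
      rpow_one_add_le_one_add_mul_self (by norm_num) (by positivity)
        ((div_le_one hn).2 hmn')
    rw [Real.rpow_def_of_pos (by norm_num)] at this
    have hlog : Real.log (1 + (-37 / 64 : ℝ)) = 3 * Real.log (3 / 4) := by
      rw [show (1 + (-37 / 64) : ℝ) = (3 / 4) ^ (3 : ℕ) by norm_num, Real.log_pow]; norm_num
    rw [hlog] at this
    refine le_trans (le_of_eq (congrArg Real.exp ?_)) (this.trans (by linarith))
    ring
  refine le_trans ?_ (mul_le_mul_of_nonneg_left hb (sortBound_pos n m).le)
  rw [sortBound, sortBound, sortBound, ← Real.exp_add, ← Real.exp_add, Real.exp_le_exp, ← add_div,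
    ← add_div]
  refine div_le_div_of_nonneg_right ?_ hn.le
  linarith

/-- At least half of the ranks are balanced and gain 37/64; the others lose nothing. On average the
gain is at least 37/128. -/
theorem sum_sortBound_le {n m : ℕ} (hmn : m ≤ n) (hm2 : 2 ≤ m) :
    ∑ r ∈ Finset.range m, sortBound n r * sortBound n (m - 1 - r) ≤
      m * (sortBound n m * (1 - 37 / 128 * (m / n))) := by
  set good := (Finset.range m).filter fun r => 4 * r ≤ 3 * m ∧ 4 * (m - 1 - r) ≤ 3 * m with hg
  have hm0 : (0 : ℝ) ≤ m / n := by positivity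
  have hcard : m ≤ 2 * good.card := by
    -- The unbalanced ranks lie in the first or the last quarter.
    have hsub : Finset.range m ⊆ good ∪ (Finset.range (m / 4) ∪ Finset.Ico (3 * m / 4 + 1) m) := by
      intro r hr
      simp only [hg, Finset.mem_union, Finset.mem_filter, Finset.mem_range, Finset.mem_Ico] at hr ⊢
      omega
    have h1 := Finset.card_le_card hsub
    have h2 := Finset.card_union_le good (Finset.range (m / 4) ∪ Finset.Ico (3 * m / 4 + 1) m)
    have h3 := Finset.card_union_le (Finset.range (m / 4)) (Finset.Ico (3 * m / 4 + 1) m)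
    simp only [Finset.card_range, Nat.card_Ico] at h1 h2 h3
    omega
  have hle : ∀ r ∈ Finset.range m, sortBound n r * sortBound n (m - 1 - r) ≤
      sortBound n m - if r ∈ good then sortBound n m * (37 / 64 * (m / n)) else 0 := by
    intro r hr
    rw [Finset.mem_range] at hr
    split_ifs with h
    · simp only [hg, Finset.mem_filter] at h
      have := sortBound_mul_le_of_balanced (n := n) (s := m - 1 - r) hmn hm2 (by omega) h.2.1 h.2.2
      linarith
    · rw [sub_zero]; exact sortBound_mul_le (by omega)
  refine (Finset.sum_le_sum hle).trans ?_
  rw [Finset.sum_sub_distrib, Finset.sum_const, Finset.card_range, nsmul_eq_mul,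
    ← Finset.sum_filter, Finset.sum_const, nsmul_eq_mul,
    Finset.filter_mem_eq_inter, Finset.inter_eq_right.2 (Finset.filter_subset _ _)]
  have hc : (m : ℝ) ≤ 2 * good.card := by exact_mod_cast hcard
  have hx : 0 ≤ sortBound n m * (37 / 64 * (m / n)) :=
    mul_nonneg (sortBound_pos n m).le (by positivity)
  nlinarith

/-- The balance sheet, with μ = m/n: balanced pivots gain 37μ/128; moved pivots cost at most μ/32,
which is where 64α + 1 ≤ n enters; the weights of the m − 1 queries cost at most a factor e^(μ/16).
It closes because 1 − 33μ/128 ≤ 1 − μ/16 ≤ e^(−μ/16). -/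
theorem quicksort_drift {n m α : ℕ} (hmn : m ≤ n) (hm2 : 2 ≤ m) (hα : 64 * α + 1 ≤ n) :
    (m : ℝ)⁻¹ * (((1 + 1 / (32 * n) : ℝ) ^ 2) ^ (m - 1) *
      (∑ r ∈ Finset.range m, sortBound n r * sortBound n (m - 1 - r) +
        m * ((m - 1 : ℕ) * (2 * α * ((n * (n - 1) : ℕ) : ℝ)⁻¹) * sortBound n m))) ≤
      sortBound n m := by
  have hm2' : (2 : ℝ) ≤ m := by exact_mod_cast hm2
  have hmn' : (m : ℝ) ≤ n := by exact_mod_cast hmn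
  have hn : (0 : ℝ) < n := by linarith
  have hn1 : ((n - 1 : ℕ) : ℝ) = n - 1 := by push_cast [Nat.cast_sub (by omega : 1 ≤ n)]; ring
  have hα' : 64 * (α : ℝ) ≤ n - 1 := by
    have : (64 * α + 1 : ℝ) ≤ n := by exact_mod_cast hα
    linarith
  set μ : ℝ := m / n with hμ
  have hμ0 : 0 ≤ μ := by positivity
  have hμ1 : μ ≤ 1 := (div_le_one hn).2 hmn'
  have hf := sortBound_pos n m
  have herr : ((m - 1 : ℕ) : ℝ) * (2 * α * ((n * (n - 1) : ℕ) : ℝ)⁻¹) ≤ μ / 32 := by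
    have h1 : ((m - 1 : ℕ) : ℝ) ≤ m := by exact_mod_cast Nat.sub_le _ _
    have h2 : 2 * (α : ℝ) * ((n * (n - 1) : ℕ) : ℝ)⁻¹ ≤ 1 / (32 * n) := by
      rw [Nat.cast_mul, hn1, ← div_eq_mul_inv, div_le_div_iff₀ (by nlinarith) (by positivity)]
      nlinarith
    calc _ ≤ (m : ℝ) * (1 / (32 * n)) := mul_le_mul h1 h2 (by positivity) (by positivity)
      _ = μ / 32 := by rw [hμ]; field_simp
  have hpow : ((1 + 1 / (32 * n) : ℝ) ^ 2) ^ (m - 1) ≤ Real.exp (μ / 16) := by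
    have h1 : (1 : ℝ) + 1 / (32 * n) ≤ Real.exp (1 / (32 * n)) := by
      linarith [Real.add_one_le_exp (1 / (32 * n) : ℝ)]
    calc _ = (1 + 1 / (32 * n) : ℝ) ^ (2 * (m - 1)) := by rw [pow_mul]
      _ ≤ (Real.exp (1 / (32 * n))) ^ (2 * (m - 1)) := pow_le_pow_left₀ (by positivity) h1 _
      _ = Real.exp ((2 * (m - 1) : ℕ) * (1 / (32 * n))) := by rw [← Real.exp_nat_mul]
      _ ≤ Real.exp ((2 * m) * (1 / (32 * n))) := by
          refine Real.exp_le_exp.2 (mul_le_mul_of_nonneg_right ?_ (by positivity))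
          exact_mod_cast (by omega : 2 * (m - 1) ≤ 2 * m)
      _ = _ := by rw [hμ]; congr 1; field_simp; norm_num
  have hsum := sum_sortBound_le hmn hm2
  have hq : 1 - 33 / 128 * μ ≤ Real.exp (-(μ / 16)) := by
    have := Real.add_one_le_exp (-(μ / 16))
    linarith
  rw [inv_mul_le_iff₀ (by positivity)]
  calc _ ≤ Real.exp (μ / 16) * (m * (sortBound n m * (1 - 37 / 128 * μ)) +
        m * (μ / 32 * sortBound n m)) := by
        refine mul_le_mul hpow (add_le_add hsum ?_) ?_ (Real.exp_pos _).le
        · gcongr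
        · have : ∀ r, 0 ≤ sortBound n r := fun r => (sortBound_pos n r).le
          have : 0 ≤ ∑ r ∈ Finset.range m, sortBound n r * sortBound n (m - 1 - r) :=
            Finset.sum_nonneg fun r _ => mul_nonneg (this _) (this _)
          positivity
    _ = Real.exp (μ / 16) * (1 - 33 / 128 * μ) * (m * sortBound n m) := by ring
    _ ≤ Real.exp (μ / 16) * Real.exp (-(μ / 16)) * (m * sortBound n m) := by gcongr
    _ = _ := by rw [← Real.exp_add]; simp

/-- The weight of a query of the sorting process. -/
noncomputable def sortWeight (n : ℕ) : ℝ≥0∞ := ENNReal.ofReal (1 + 1 / (32 * n))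

/-- The bound is multiplicative over the two recursive calls because it holds for every state of the
lists, so the evolution between the calls is irrelevant. Only the current partition step has to be
compared with the lists at its start. -/
theorem wp_quicksort_le {α : ℕ} (hα : 64 * α + 1 ≤ n) (z : Agent n) (d : ℕ) (l : List (Fin n))
    (hl : l.Nodup) (hd : l.length ≤ d) (π : Prefs n) :
    wp (sortWeight n) (evolveMany α) id (fun _ _ => 1) (quicksort z d l) π ≤
      ENNReal.ofReal (sortBound n l.length) := by
  have hone : ∀ m, m ≤ 1 → ENNReal.ofReal (sortBound n m) = 1 := fun m hm => by
    have : sortBound n m = 1 := by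
      interval_cases m <;> simp [sortBound]
    simp [this]
  induction d generalizing l π with
  | zero =>
    obtain rfl := List.length_eq_zero_iff.1 (Nat.le_zero.1 hd)
    simp [quicksort_zero, wp, hone]
  | succ d ih =>
    cases l with
    | nil => simp [quicksort_nil, wp, hone]
    | cons a l =>
      set f : ℕ → ℝ≥0∞ := fun m => ENNReal.ofReal (sortBound n m) with hf
      rw [quicksort_cons, wp]
      have hmn : (a :: l).length ≤ n := by simpa using hl.length_le_card
      simp only [List.length_cons] at hmn hd
      have hinner : ∀ i : Fin (l.length + 1), ∀ π,
          wp (sortWeight n) (evolveMany α) id (fun _ _ => 1)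
            ((partition z ((a :: l).get i) ((a :: l).eraseIdx i)).bind fun q =>
              (quicksort z d q.1).bind fun lo => (quicksort z d q.2).bind fun hi =>
                done (lo ++ (a :: l).get i :: hi)) π ≤
          wp (sortWeight n) (evolveMany α) id (fun q _ => f q.1.length * f q.2.length)
            (partition z ((a :: l).get i) ((a :: l).eraseIdx i)) π := by
        intro i π
        rw [wp_bind]
        refine wp_mono_of (I := fun _ => True) (fun _ _ _ _ => trivial) (fun q π' hq _ => ?_)
          (leaves_partition _ _ _) trivial
        have hnd : (q.1 ++ q.2).Nodup := hq.nodup_iff.2 (hl.sublist (List.eraseIdx_sublist _ _))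
        have hlen := hq.length_eq
        rw [List.length_append, List.length_eraseIdx_of_lt i.2] at hlen
        simp only [List.length_cons] at hlen
        rw [wp_bind]
        have h2 : ∀ (lo : List (Fin n)) (π₁ : Prefs n),
            wp (sortWeight n) (evolveMany α) id (fun _ _ => 1)
              ((quicksort z d q.2).bind fun hi => done (lo ++ (a :: l).get i :: hi)) π₁ ≤
            f q.2.length := fun lo π₁ => by
          rw [wp_bind]
          exact ih q.2 (List.Nodup.of_append_right hnd) (by omega) π₁
        refine (wp_mono h2 _ _).trans ?_
        rw [mul_comm (f q.1.length)]
        rw [wp_const]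
        exact mul_le_mul_right (ih q.1 (List.Nodup.of_append_left hnd) (by omega) _) _
      -- A single element causes no queries, while the drift estimate needs at least two.
      rcases Nat.lt_or_ge (l.length + 1) 2 with hm | hm2
      · obtain rfl := List.length_eq_zero_iff.1 (by omega : l.length = 0)
        simp only [List.length_nil, List.length_cons, zero_add]
        rw [hone 1 le_rfl]
        refine le_trans (mul_le_mul_right (Finset.sum_le_sum fun i _ => hinner i π) _) ?_
        have hf0 : f 0 = 1 := hone 0 (by norm_num)
        have hi : ∀ i : Fin 1, i = 0 := fun i => Subsingleton.elim _ _
        simp [partition_nil, wp, hf0, hi]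
      · set m := l.length + 1 with hm
        have hn2 : 2 ≤ n := by omega
        have hfmul : ∀ r s, r + s + 1 = m → f r * f s ≤ f m := fun r s h => by
          rw [hf]
          dsimp only
          rw [← ENNReal.ofReal_mul (sortBound_pos n r).le]
          exact ENNReal.ofReal_le_ofReal (sortBound_mul_le h)
        have hpart : ∀ i : Fin m, wp (sortWeight n) (evolveMany α) id
            (fun q _ => f q.1.length * f q.2.length)
            (partition z ((a :: l).get i) ((a :: l).eraseIdx i)) π ≤
            (sortWeight n ^ 2) ^ (m - 1) *
              (f (numBefore π z ((a :: l).get i) ((a :: l).eraseIdx i)) *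
                f (m - 1 - numBefore π z ((a :: l).get i) ((a :: l).eraseIdx i)) +
                (m - 1 : ℕ) * (2 * α * ((n * (n - 1) : ℕ) : ℝ≥0∞)⁻¹) * f m) := by
          intro i
          have hlen : ((a :: l).eraseIdx i).length = m - 1 := by
            rw [List.length_eraseIdx_of_lt i.2, List.length_cons]
          rw [← hlen]
          refine wp_partition_le hn2 z _ _ (fun q _ hq => hfmul _ _ (by omega))
            (fun q _ hq hq' => ?_)
          rw [← hq', ← hq, Nat.add_sub_cancel_left]
        calc _ ≤ ((m : ℕ) : ℝ≥0∞)⁻¹ * ∑ i : Fin m, (sortWeight n ^ 2) ^ (m - 1) *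
              (f (numBefore π z ((a :: l).get i) ((a :: l).eraseIdx i)) *
                f (m - 1 - numBefore π z ((a :: l).get i) ((a :: l).eraseIdx i)) +
                (m - 1 : ℕ) * (2 * α * ((n * (n - 1) : ℕ) : ℝ≥0∞)⁻¹) * f m) :=
              mul_le_mul_right (Finset.sum_le_sum fun i _ => (hinner i π).trans (hpart i)) _
          _ = ((m : ℕ) : ℝ≥0∞)⁻¹ * ((sortWeight n ^ 2) ^ (m - 1) *
              (∑ r ∈ Finset.range m, f r * f (m - 1 - r) +
                m * ((m - 1 : ℕ) * (2 * α * ((n * (n - 1) : ℕ) : ℝ≥0∞)⁻¹) * f m))) := by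
              rw [← Finset.mul_sum, Finset.sum_add_distrib]
              have hsum := sum_numBefore π z hl fun r => f r * f (m - 1 - r)
              simp only [List.length_cons] at hsum
              rw [hsum, Finset.sum_const, Finset.card_univ, Fintype.card_fin, nsmul_eq_mul]
          _ = ENNReal.ofReal ((m : ℝ)⁻¹ * (((1 + 1 / (32 * n) : ℝ) ^ 2) ^ (m - 1) *
              (∑ r ∈ Finset.range m, sortBound n r * sortBound n (m - 1 - r) +
              m * ((m - 1 : ℕ) * (2 * α * ((n * (n - 1) : ℕ) : ℝ)⁻¹) * sortBound n m)))) := by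
              have hpos : ∀ r, 0 ≤ sortBound n r := fun r => (sortBound_pos n r).le
              have hS : 0 ≤ ∑ r ∈ Finset.range m, sortBound n r * sortBound n (m - 1 - r) :=
                Finset.sum_nonneg fun r _ => mul_nonneg (hpos _) (hpos _)
              have hnn : (0 : ℝ) < ((n * (n - 1) : ℕ) : ℝ) :=
                Nat.cast_pos.2 (Nat.mul_pos (by omega) (by omega))
              have := hpos m
              rw [ENNReal.ofReal_mul (by positivity), ENNReal.ofReal_mul (by positivity),
                ENNReal.ofReal_add hS (by positivity), ENNReal.ofReal_mul (by positivity),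
                ENNReal.ofReal_mul (by positivity), ENNReal.ofReal_mul (by positivity),
                ENNReal.ofReal_mul (by positivity), ENNReal.ofReal_mul (by positivity),
                ENNReal.ofReal_inv_of_pos (by positivity), ENNReal.ofReal_inv_of_pos hnn,
                ENNReal.ofReal_pow (by positivity), ENNReal.ofReal_pow (by positivity),
                ENNReal.ofReal_sum_of_nonneg fun r _ => mul_nonneg (hpos _) (hpos _)]
              simp only [ENNReal.ofReal_natCast, ENNReal.ofReal_mul (hpos _), sortWeight, hf]
              norm_num
          _ ≤ _ := ENNReal.ofReal_le_ofReal (quicksort_drift hmn hm2 hα)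

theorem sortBound_self (hn : 1 ≤ n) : ENNReal.ofReal (sortBound n n) = (n : ℝ≥0∞) ^ 3 := by
  have hn0 : (0 : ℝ) < n := by exact_mod_cast hn
  have : sortBound n n = (n : ℝ) ^ 3 := by
    rw [sortBound, show 3 * ((n : ℝ) * Real.log n) / n = (3 : ℕ) * Real.log n by
      push_cast; field_simp, Real.exp_nat_mul, Real.exp_log hn0]
  rw [this, ENNReal.ofReal_pow hn0.le, ENNReal.ofReal_natCast]

theorem wp_sequentialSort_le {α : ℕ} (hα : 64 * α + 1 ≤ n) {a : Approx n} (ha : IsPermApprox a)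
    (π : Prefs n) : wp (sortWeight n) (evolveMany α) id (fun _ _ => 1) (sequentialSort a) π ≤
      ((n : ℝ≥0∞) ^ 3) ^ n := by
  rw [sequentialSort_eq]
  have h : ∀ L : List (Fin n), wp (sortWeight n) (evolveMany α) id (fun _ _ => 1) (sortLoop L a) π ≤
      ((n : ℝ≥0∞) ^ 3) ^ L.length := by
    intro L
    induction L generalizing a π with
    | nil => simp [sortLoop, wp]
    | cons x L ih =>
      rw [sortLoop, wp_bind]
      have hx : ∀ π, wp (sortWeight n) (evolveMany α) id (fun _ _ => 1)
          (quicksort (Sum.inl x) n (a x)) π ≤ (n : ℝ≥0∞) ^ 3 := fun π => by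
        rw [← sortBound_self (by omega : 1 ≤ n)]
        have hlen : (a x).length = n := by simp [(ha x).length_eq]
        have := wp_quicksort_le hα (Sum.inl x) n (a x)
          ((ha x).nodup_iff.2 (List.nodup_finRange n)) hlen.le π
        rwa [hlen] at this
      refine (wp_mono_of (I := fun _ => True) (G := fun _ _ => ((n : ℝ≥0∞) ^ 3) ^ L.length)
        (fun _ _ _ _ => trivial) (fun l π' hl _ => ih (fun x' => ?_) π')
        (leaves_quicksort _ n (a x) (by simp [(ha x).length_eq])) trivial).trans ?_
      · by_cases hx' : x' = x
        · subst hx'; simpa using hl.trans (ha x')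
        · simpa [hx'] using ha x'
      · rw [wp_const, List.length_cons, pow_succ]
        exact mul_le_mul_right (hx π) _
  simpa using h (List.finRange n)

/-! ## Preference lists with counters of the moves -/

/-- The preference lists together with a counter, for every `x ∈ A` and every `u ∈ B`, of the events
that have moved `u` in the list of `x`. -/
abbrev CountedPrefs (n : ℕ) : Type := Prefs n × (Fin n → Fin n → ℕ)

/-- The effect of an event on the preference lists and the counters. -/
def CountedPrefs.apply (e : CountedPrefs n) (ev : Event n) : CountedPrefs n :=
  (swapAt e.1 ev.1 ev.2, fun x u => e.2 x u + if Moves e.1 ev (Sum.inl x) u then 1 else 0)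

/-- One evolution event, with counters. -/
noncomputable def countedEvolve (e : CountedPrefs n) : PMF (CountedPrefs n) :=
  if h : 2 ≤ n then
    haveI : Nonempty (Event n) := ⟨(Sum.inl ⟨0, by omega⟩, ⟨0, by omega⟩)⟩
    (PMF.uniformOfFintype (Event n)).map e.apply
  else PMF.pure e

/-- Several evolution events, with counters. -/
noncomputable def countedEvolveMany : ℕ → CountedPrefs n → PMF (CountedPrefs n)
  | 0, e => PMF.pure e
  | k + 1, e => (countedEvolve e).bind (countedEvolveMany k)

theorem countedEvolve_map_fst (e : CountedPrefs n) :
    (countedEvolve e).map Prod.fst = evolve e.1 := by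
  unfold countedEvolve evolve
  split_ifs
  · rw [PMF.map_comp]; rfl
  · rw [PMF.pure_map]

theorem countedEvolveMany_map_fst (k : ℕ) (e : CountedPrefs n) :
    (countedEvolveMany k e).map Prod.fst = evolveMany k e.1 := by
  induction k generalizing e with
  | zero => simp [countedEvolveMany, evolveMany, PMF.pure_map]
  | succ k ih =>
    rw [countedEvolveMany, evolveMany, PMF.map_bind, ← countedEvolve_map_fst, PMF.bind_map]
    congr 1
    funext e'
    exact ih e'

theorem expect_countedEvolveMany_fst (k : ℕ) (e : CountedPrefs n) (f : Prefs n → ℝ≥0∞) :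
    expect (countedEvolveMany k e) (fun e' => f e'.1) = expect (evolveMany k e.1) f := by
  rw [← countedEvolveMany_map_fst, expect_map]

theorem expect_countedEvolve (hn : 2 ≤ n) (e : CountedPrefs n) (f : CountedPrefs n → ℝ≥0∞) :
    expect (countedEvolve e) f =
      ((2 * n * (n - 1) : ℕ) : ℝ≥0∞)⁻¹ * ∑ ev : Event n, f (e.apply ev) := by
  unfold countedEvolve
  rw [dif_pos hn, expect_map]
  have : Nonempty (Event n) := ⟨(Sum.inl ⟨0, by omega⟩, ⟨0, by omega⟩)⟩
  rw [expect_uniform, card_event]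

/-- A property that is preserved by all events. -/
def EventStable (I : CountedPrefs n → Prop) : Prop := ∀ e ev, I e → I (e.apply ev)

theorem EventStable.countedEvolveMany {I : CountedPrefs n → Prop} (hI : EventStable I) {k : ℕ}
    {e e' : CountedPrefs n} (he : I e) (h : e' ∈ (countedEvolveMany k e).support) : I e' := by
  induction k generalizing e with
  | zero =>
    simp only [EvolvingMatching.countedEvolveMany, PMF.support_pure, Set.mem_singleton_iff] at h
    exact h ▸ he
  | succ k ih =>
    rw [EvolvingMatching.countedEvolveMany, PMF.mem_support_bind_iff] at h
    obtain ⟨e₁, h₁, h₂⟩ := h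
    refine ih ?_ h₂
    unfold countedEvolve at h₁
    split_ifs at h₁
    · rw [PMF.mem_support_map_iff] at h₁
      obtain ⟨ev, -, rfl⟩ := h₁
      exact hI e ev he
    · simp only [PMF.support_pure, Set.mem_singleton_iff] at h₁
      exact h₁ ▸ he

theorem expect_countedEvolveMany_le {f : CountedPrefs n → ℝ≥0∞} {c : ℝ≥0∞}
    (h : ∀ e, expect (countedEvolve e) f ≤ c * f e) (k : ℕ) (e : CountedPrefs n) :
    expect (countedEvolveMany k e) f ≤ c ^ k * f e := by
  induction k generalizing e with
  | zero => simp [countedEvolveMany]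
  | succ k ih =>
    rw [countedEvolveMany, expect_bind, pow_succ, mul_assoc]
    refine (expect_mono ih).trans ?_
    rw [expect_mul_left]
    exact mul_le_mul_right (h e) _

/-- The maximal number of moves of an element of the list of `x`. -/
def radius (c : Fin n → Fin n → ℕ) (x : Fin n) : ℕ := Finset.univ.sup (c x)

theorem le_radius (c : Fin n → Fin n → ℕ) (x u : Fin n) : c x u ≤ radius c x :=
  Finset.le_sup (f := c x) (Finset.mem_univ u)

theorem radius_mono {c c' : Fin n → Fin n → ℕ} (h : c ≤ c') : radius c ≤ radius c' :=
  fun x => Finset.sup_mono_fun fun u _ => h x u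

theorem CountedPrefs.le_apply (e : CountedPrefs n) (ev : Event n) : e.2 ≤ (e.apply ev).2 :=
  fun _ _ => Nat.le_add_right _ _

/-- The counters bound the displacements with respect to the lists `π₀`. -/
def Tracks (π₀ : Prefs n) (e : CountedPrefs n) : Prop :=
  ∀ x u, (π₀ (Sum.inl x) u).val ≤ (e.1 (Sum.inl x) u).val + e.2 x u ∧
    (e.1 (Sum.inl x) u).val ≤ (π₀ (Sum.inl x) u).val + e.2 x u

theorem tracks_self (π₀ : Prefs n) : Tracks π₀ (π₀, fun _ _ => 0) := fun _ _ => ⟨le_rfl, le_rfl⟩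

theorem eventStable_tracks (π₀ : Prefs n) : EventStable (Tracks π₀) := by
  intro e ev h x u
  have := h x u
  simp only [CountedPrefs.apply]
  split_ifs with hm
  · have h2 := hm.2
    rw [hm.1, swapAt_val]
    split_ifs <;> omega
  · rw [swapAt_eq_of_not_moves hm]; simpa using this

theorem eventStable_le (c : Fin n → Fin n → ℕ) : EventStable fun e : CountedPrefs n => c ≤ e.2 :=
  fun e ev h => h.trans (e.le_apply ev)

/-! ## The total excess of the displacements -/

/-- The part of the displacement that the number `K` of candidates does not compensate. -/
def excess (K R : ℕ) : ℕ := if K ≤ 10 * R then 6 * R else 0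

theorem excess_mono (K : ℕ) : Monotone (excess K) := by
  intro R R' h
  unfold excess
  split_ifs <;> omega

/-- The total excess. -/
def totalExcess (K : ℕ) (c : Fin n → Fin n → ℕ) : ℕ := ∑ x, excess K (radius c x)

/-- A potential that controls the total excess. -/
noncomputable def movePotential (β : ℝ≥0∞) (c : Fin n → Fin n → ℕ) : ℝ≥0∞ :=
  ∏ x, (1 + β * ∑ u, 2 ^ (16 * c x u))

/-- If K ≤ 10R, then 6R ≤ 16R − K, and the largest counter alone contributes 2^(16R − K) to the
factor of `x`; otherwise the excess vanishes. This explains the exponent 16 = 6 + 10. -/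
theorem two_pow_totalExcess_le (K : ℕ) (c : Fin n → Fin n → ℕ) :
    (2 : ℝ≥0∞) ^ totalExcess K c ≤ movePotential ((2 ^ K)⁻¹) c := by
  rw [totalExcess, ← Finset.prod_pow_eq_pow_sum]
  refine Finset.prod_le_prod' fun x _ => ?_
  unfold excess
  split_ifs with h
  · refine le_trans ?_ le_add_self
    rw [mul_comm (_⁻¹), ← div_eq_mul_inv, ENNReal.le_div_iff_mul_le (by simp) (by simp), ← pow_add]
    rcases (Finset.univ : Finset (Fin n)).eq_empty_or_nonempty with he | hne
    · exact absurd (Finset.mem_univ x) (by simp [he])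
    · obtain ⟨u, -, hu⟩ := Finset.exists_mem_eq_sup _ hne (c x)
      have hu : radius c x = c x u := hu
      calc (2 : ℝ≥0∞) ^ (6 * radius c x + K) ≤ 2 ^ (16 * c x u) :=
            pow_le_pow_right₀ (by norm_num) (by omega)
        _ ≤ _ := Finset.single_le_sum (f := fun u => (2 : ℝ≥0∞) ^ (16 * c x u))
            (fun _ _ => zero_le) (Finset.mem_univ u)
  · simp

/-- These are the terms of order zero and one in `b` of the expanded product; the others are
nonnegative. -/
theorem prod_add_sum_le {ι : Type*} [DecidableEq ι] (s : Finset ι) (a b : ι → ℝ≥0∞) :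
    ∏ i ∈ s, a i + ∑ i ∈ s, b i * ∏ j ∈ s.erase i, a j ≤ ∏ i ∈ s, (a i + b i) := by
  induction s using Finset.induction_on with
  | empty => simp
  | insert i s hi ih =>
    rw [Finset.prod_insert hi, Finset.prod_insert hi, Finset.sum_insert hi,
      Finset.erase_insert hi]
    have h : ∀ j ∈ s, b j * ∏ k ∈ (insert i s).erase j, a k =
        a i * (b j * ∏ k ∈ s.erase j, a k) := fun j hj => by
      have hij : i ≠ j := by rintro rfl; exact hi hj
      rw [Finset.erase_insert_of_ne hij, Finset.prod_insert (by simp [hi])]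
      ring
    rw [Finset.sum_congr rfl h, ← Finset.mul_sum]
    calc _ = a i * (∏ k ∈ s, a k + ∑ j ∈ s, b j * ∏ k ∈ s.erase j, a k) + b i * ∏ k ∈ s, a k := by
          ring
      _ ≤ a i * ∏ k ∈ s, (a k + b k) + b i * ∏ k ∈ s, (a k + b k) := by
          gcongr with k
          exact le_self_add
      _ = _ := by ring

/-- An event touches one factor only, and inside it multiplies the terms of the moved elements by
2^16. -/
theorem movePotential_apply_le (β : ℝ≥0∞) (e : CountedPrefs n) (ev : Event n) :
    movePotential β (e.apply ev).2 ≤ movePotential β e.2 +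
      ∑ x, ∑ u, if Moves e.1 ev (Sum.inl x) u then
        β * 2 ^ 16 * 2 ^ (16 * e.2 x u) *
          ∏ x' ∈ Finset.univ.erase x, (1 + β * ∑ u, 2 ^ (16 * e.2 x' u)) else 0 := by
  obtain ⟨z | z, i⟩ := ev
  · have hother : ∀ x', x' ≠ z → (e.apply (Sum.inl z, i)).2 x' = e.2 x' := fun x' hx' => by
      funext u
      simp [CountedPrefs.apply, Moves, Ne.symm hx']
    refine le_trans ?_ (add_le_add_right (Finset.single_le_sum (fun _ _ => zero_le)
      (Finset.mem_univ z)) _)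
    unfold movePotential
    rw [← Finset.mul_prod_erase _ _ (Finset.mem_univ z),
      ← Finset.mul_prod_erase _ (fun x => 1 + β * ∑ u, (2 : ℝ≥0∞) ^ (16 * e.2 x u))
        (Finset.mem_univ z),
      Finset.prod_congr rfl fun x' hx' => by rw [hother x' (Finset.ne_of_mem_erase hx')]]
    simp only [← Finset.sum_filter, ← Finset.sum_mul, ← Finset.mul_sum]
    rw [← add_mul]
    refine mul_le_mul_left ?_ _
    rw [add_assoc, mul_assoc, ← mul_add]
    gcongr
    rw [Finset.sum_filter, Finset.mul_sum, ← Finset.sum_add_distrib]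
    refine Finset.sum_le_sum fun u _ => ?_
    simp only [CountedPrefs.apply]
    split_ifs
    · rw [mul_add, mul_one, pow_add, mul_comm]; exact le_add_self
    · simp
  · have : (e.apply (Sum.inr z, i)).2 = e.2 := by
      funext x u
      simp [CountedPrefs.apply, Moves]
    rw [this]
    exact le_self_add

/-- Averaging the events adds a first-order increment to every factor, and these increments together
are dominated by slightly enlarging `β`. The growth thus goes into the parameter, not into a factor
in front; with `β` = 2^(−K) the potential stays bounded as long as the enlarged `β` is below about
1/n². -/
theorem expect_movePotential_le (hn : 2 ≤ n) (β : ℝ≥0∞) (e : CountedPrefs n) :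
    expect (countedEvolve e) (fun e' => movePotential β e'.2) ≤
      movePotential (β * (1 + 2 ^ 16 * ((n * (n - 1) : ℕ) : ℝ≥0∞)⁻¹)) e.2 := by
  have hpos : ((2 * n * (n - 1) : ℕ) : ℝ≥0∞) ≠ 0 :=
    Nat.cast_ne_zero.2 (Nat.mul_ne_zero (by omega) (by omega))
  set P : Fin n → ℝ≥0∞ :=
    fun x => ∏ x' ∈ Finset.univ.erase x, (1 + β * ∑ u, 2 ^ (16 * e.2 x' u)) with hP
  rw [expect_countedEvolve hn]
  calc _ ≤ ((2 * n * (n - 1) : ℕ) : ℝ≥0∞)⁻¹ * ∑ ev : Event n, (movePotential β e.2 +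
        ∑ x, ∑ u, if Moves e.1 ev (Sum.inl x) u then
          β * 2 ^ 16 * 2 ^ (16 * e.2 x u) * P x else 0) :=
        mul_le_mul_right (Finset.sum_le_sum fun ev _ => movePotential_apply_le β e ev) _
    _ ≤ ((2 * n * (n - 1) : ℕ) : ℝ≥0∞)⁻¹ * ((2 * n * (n - 1) : ℕ) * movePotential β e.2 +
        ∑ x, ∑ u, 2 * (β * 2 ^ 16 * 2 ^ (16 * e.2 x u) * P x)) := by
        refine mul_le_mul_right ?_ _
        rw [Finset.sum_add_distrib, Finset.sum_const, Finset.card_univ, card_event, nsmul_eq_mul,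
          Finset.sum_comm]
        refine add_le_add_right (Finset.sum_le_sum fun x _ => ?_) _
        rw [Finset.sum_comm]
        refine Finset.sum_le_sum fun u _ => ?_
        rw [← Finset.sum_filter, Finset.sum_const, nsmul_eq_mul]
        refine mul_le_mul_left ?_ _
        exact_mod_cast card_moves_le e.1 (Sum.inl x) u
    _ = movePotential β e.2 + ∑ x, (β * (2 ^ 16 * ((n * (n - 1) : ℕ) : ℝ≥0∞)⁻¹) *
        ∑ u, 2 ^ (16 * e.2 x u)) * P x := by
        have h2 : ((2 * n * (n - 1) : ℕ) : ℝ≥0∞)⁻¹ * 2 = ((n * (n - 1) : ℕ) : ℝ≥0∞)⁻¹ := by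
          rw [mul_assoc, Nat.cast_mul 2, ENNReal.mul_inv (by simp) (by simp), mul_right_comm,
            Nat.cast_two, ENNReal.inv_mul_cancel (by simp) (by simp), one_mul]
        rw [mul_add, ← mul_assoc, ENNReal.inv_mul_cancel hpos (ENNReal.natCast_ne_top _), one_mul,
          ← h2, Finset.mul_sum]
        congr 1
        refine Finset.sum_congr rfl fun x _ => ?_
        rw [← Finset.mul_sum, ← Finset.sum_mul, ← Finset.mul_sum]
        ring
    _ ≤ ∏ x, ((1 + β * ∑ u, 2 ^ (16 * e.2 x u)) +
        β * (2 ^ 16 * ((n * (n - 1) : ℕ) : ℝ≥0∞)⁻¹) * ∑ u, 2 ^ (16 * e.2 x u)) :=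
        prod_add_sum_le _ _ _
    _ = _ := by
        unfold movePotential
        refine Finset.prod_congr rfl fun x _ => ?_
        ring

theorem expect_movePotential_many_le (hn : 2 ≤ n) (k : ℕ) (β : ℝ≥0∞) (e : CountedPrefs n) :
    expect (countedEvolveMany k e) (fun e' => movePotential β e'.2) ≤
      movePotential (β * (1 + 2 ^ 16 * ((n * (n - 1) : ℕ) : ℝ≥0∞)⁻¹) ^ k) e.2 := by
  induction k generalizing e with
  | zero => simp [countedEvolveMany]
  | succ k ih =>
    rw [countedEvolveMany, expect_bind]
    refine (expect_mono ih).trans ((expect_movePotential_le hn _ _).trans ?_)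
    rw [mul_assoc, ← pow_succ]

/-! ## Accuracy of the sorted lists -/

/-- The approximations `a` differ from the lists `π₀` by small displacements, bounded by `ρ`. -/
def Accurate (π₀ : Prefs n) (a : Approx n) (ρ : Fin n → ℕ) : Prop :=
  ∀ x, (a x).Pairwise fun u v => (π₀ (Sum.inl x) u).val ≤ (π₀ (Sum.inl x) v).val + 4 * ρ x

theorem Accurate.mono {π₀ : Prefs n} {a : Approx n} {ρ ρ' : Fin n → ℕ} (h : Accurate π₀ a ρ)
    (hρ : ρ ≤ ρ') : Accurate π₀ a ρ' := fun x =>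
  (h x).imp fun huv => huv.trans (by have : ρ x ≤ ρ' x := hρ x; omega)

/-- The answer `b` to the query `q` is possible after displacements by at most `ρ`. -/
def Query.Consistent (π₀ : Prefs n) (ρ : Fin n → ℕ) (b : Bool) : Query n → Prop
  | ⟨Sum.inl x, u, v⟩ =>
      (b = true → (π₀ (Sum.inl x) u).val ≤ (π₀ (Sum.inl x) v).val + 2 * ρ x) ∧
      (b = false → (π₀ (Sum.inl x) v).val ≤ (π₀ (Sum.inl x) u).val + 2 * ρ x)
  | ⟨Sum.inr _, _, _⟩ => True

/-- Each of the two compared elements is displaced by at most the radius, hence the error 2ρ. -/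
theorem Tracks.consistent {π₀ : Prefs n} {e : CountedPrefs n} (h : Tracks π₀ e) (q : Query n) :
    q.Consistent π₀ (radius e.2) (q.answer e.1) := by
  obtain ⟨x | y, u, v⟩ := q
  · have hu := h x u
    have hv := h x v
    have h1 := le_radius e.2 x u
    have h2 := le_radius e.2 x v
    simp only [Query.Consistent, Query.answer, decide_eq_true_eq, decide_eq_false_iff_not,
      Fin.lt_def]
    constructor <;> intro h3 <;> omega
  · trivial

/-- All results of the program satisfy `Q`, if all answers are consistent with displacements that
are bounded by an increasing family which is at least `ρ` at the beginning. -/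
def Prog.Safe {R : Type} (π₀ : Prefs n) (Q : R → (Fin n → ℕ) → Prop) :
    Prog n R → (Fin n → ℕ) → Prop
  | done r, ρ => Q r ρ
  | ask q k, ρ => ∀ ρ' b, ρ ≤ ρ' → q.Consistent π₀ ρ' b → Prog.Safe π₀ Q (k b) ρ'
  | rand _ k, ρ => ∀ i, Prog.Safe π₀ Q (k i) ρ

section Safe

variable {R R' : Type} {π₀ : Prefs n} {Q : R → (Fin n → ℕ) → Prop}

theorem Prog.Safe.mono (hQ : ∀ r ρ ρ', ρ ≤ ρ' → Q r ρ → Q r ρ') {p : Prog n R}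
    {ρ ρ' : Fin n → ℕ} (h : p.Safe π₀ Q ρ) (hρ : ρ ≤ ρ') : p.Safe π₀ Q ρ' := by
  induction p with
  | done r => exact hQ r ρ ρ' hρ h
  | ask q k ih => exact fun ρ₁ b h₁ hb => h ρ₁ b (hρ.trans h₁) hb
  | rand m k ih => exact fun i => ih i (h i)

theorem Prog.Safe.bind {Q' : R' → (Fin n → ℕ) → Prop} {p : Prog n R} {g : R → Prog n R'}
    {ρ : Fin n → ℕ} (hp : p.Safe π₀ Q ρ)
    (hg : ∀ r ρ', ρ ≤ ρ' → Q r ρ' → (g r).Safe π₀ Q' ρ') : (p.bind g).Safe π₀ Q' ρ := by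
  induction p generalizing ρ with
  | done r => exact hg r ρ le_rfl hp
  | ask q k ih =>
    exact fun ρ' b h hb => ih b (hp ρ' b h hb) fun r ρ₁ h₁ => hg r ρ₁ (h.trans h₁)
  | rand m k ih => exact fun i => ih i (hp i) hg

theorem Prog.Safe.settle {p p' : Prog n R} {ρ : Fin n → ℕ} (hp : p.Safe π₀ Q ρ)
    (h : p' ∈ (Prog.settle p).support) : p'.Safe π₀ Q ρ := by
  induction p with
  | done r => simp only [Prog.settle, PMF.support_pure, Set.mem_singleton_iff] at h; exact h ▸ hp
  | ask q k ih => simp only [Prog.settle, PMF.support_pure, Set.mem_singleton_iff] at h; exact h ▸ hp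
  | rand m k ih =>
    simp only [Prog.settle, PMF.mem_support_bind_iff] at h
    obtain ⟨i, -, hi⟩ := h
    exact ih i (hp i) hi

theorem Prog.Safe.turn {p p' : Prog n R} {e : CountedPrefs n} (he : Tracks π₀ e)
    (hp : p.Safe π₀ Q (radius e.2)) (h : p' ∈ (Prog.turn e.1 p).support) :
    p'.Safe π₀ Q (radius e.2) := by
  rcases mem_support_turn h with ⟨h, -⟩ | ⟨q, k, h₁, h⟩
  · exact hp.settle h
  · exact Prog.Safe.settle ((hp.settle h₁) _ _ le_rfl (he.consistent q)) h

end Safe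

theorem safe_partition (π₀ : Prefs n) (x p : Fin n) (l : List (Fin n)) (ρ : Fin n → ℕ) :
    (partition (Sum.inl x) p l).Safe π₀ (fun q ρ =>
      (∀ v ∈ q.1, v ∈ l ∧ (π₀ (Sum.inl x) v).val ≤ (π₀ (Sum.inl x) p).val + 2 * ρ x) ∧
      (∀ v ∈ q.2, v ∈ l ∧ (π₀ (Sum.inl x) p).val ≤ (π₀ (Sum.inl x) v).val + 2 * ρ x)) ρ := by
  induction l generalizing ρ with
  | nil => simp [partition_nil, Prog.Safe]
  | cons v l ih =>
    rw [partition_cons]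
    intro ρ₁ b _ hb
    refine (ih ρ₁).bind fun q ρ₂ h₂ hq => ?_
    have hρ : ρ₁ x ≤ ρ₂ x := h₂ x
    cases b
    · refine ⟨fun w hw => ⟨List.mem_cons_of_mem _ (hq.1 w hw).1, (hq.1 w hw).2⟩, fun w hw => ?_⟩
      rcases List.mem_cons.1 hw with rfl | hw
      · exact ⟨List.mem_cons_self, (hb.2 rfl).trans (by omega)⟩
      · exact ⟨List.mem_cons_of_mem _ (hq.2 w hw).1, (hq.2 w hw).2⟩
    · refine ⟨fun w hw => ?_, fun w hw => ⟨List.mem_cons_of_mem _ (hq.2 w hw).1, (hq.2 w hw).2⟩⟩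
      rcases List.mem_cons.1 hw with rfl | hw
      · exact ⟨List.mem_cons_self, (hb.1 rfl).trans (by omega)⟩
      · exact ⟨List.mem_cons_of_mem _ (hq.1 w hw).1, (hq.1 w hw).2⟩

/-- Elements of different parts are related through the pivot, by two comparisons that are each off
by at most 2ρ; this is the 4 in `Accurate`. Answers given at different times cause no harm since the
radii only increase. -/
theorem safe_quicksort (π₀ : Prefs n) (x : Fin n) (d : ℕ) (l : List (Fin n)) (ρ : Fin n → ℕ) :
    (quicksort (Sum.inl x) d l).Safe π₀ (fun l' ρ => (∀ v ∈ l', v ∈ l) ∧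
      l'.Pairwise fun u v => (π₀ (Sum.inl x) u).val ≤ (π₀ (Sum.inl x) v).val + 4 * ρ x) ρ := by
  induction d generalizing l ρ with
  | zero => simp [quicksort_zero, Prog.Safe]
  | succ d ih =>
    cases l with
    | nil => simp [quicksort_nil, Prog.Safe]
    | cons a l =>
      rw [quicksort_cons]
      intro i
      refine (safe_partition π₀ x _ _ ρ).bind fun q ρ₁ h₁ hq => ?_
      refine (ih q.1 ρ₁).bind fun lo ρ₂ h₂ hlo => ?_
      refine (ih q.2 ρ₂).bind fun hi ρ₃ h₃ hhi => ?_
      have hρ₁ : ρ₁ x ≤ ρ₂ x := h₂ x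
      have hρ₂ : ρ₂ x ≤ ρ₃ x := h₃ x
      have hsub : ∀ v ∈ (a :: l).eraseIdx i, v ∈ a :: l := fun v hv => List.mem_of_mem_eraseIdx hv
      have hlo' : ∀ v ∈ lo, (π₀ (Sum.inl x) v).val ≤
          (π₀ (Sum.inl x) ((a :: l).get i)).val + 2 * ρ₃ x := fun v hv =>
        (hq.1 v (hlo.1 v hv)).2.trans (by omega)
      have hhi' : ∀ v ∈ hi, (π₀ (Sum.inl x) ((a :: l).get i)).val ≤
          (π₀ (Sum.inl x) v).val + 2 * ρ₃ x := fun v hv =>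
        (hq.2 v (hhi.1 v hv)).2.trans (by omega)
      refine ⟨fun v hv => ?_, ?_⟩
      · rcases List.mem_append.1 hv with hv | hv
        · exact hsub v (hq.1 v (hlo.1 v hv)).1
        · rcases List.mem_cons.1 hv with rfl | hv
          · exact List.get_mem _ _
          · exact hsub v (hq.2 v (hhi.1 v hv)).1
      · rw [List.pairwise_append]
        refine ⟨hlo.2.imp fun h => h.trans (by omega), List.pairwise_cons.2 ⟨fun v hv => ?_, hhi.2⟩,
          fun u hu v hv => ?_⟩
        · have := hhi' v hv; omega
        · have h1 := hlo' u hu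
          rcases List.mem_cons.1 hv with rfl | hv
          · omega
          · have := hhi' v hv; omega

theorem safe_sequentialSort (π₀ : Prefs n) (a : Approx n) (ρ : Fin n → ℕ) :
    (sequentialSort a).Safe π₀ (Accurate π₀) ρ := by
  rw [sequentialSort_eq]
  -- Generalized to the players outside the remaining list, that is, those already sorted. At the
  -- beginning there are none.
  have hL : ∀ x, x ∉ List.finRange n → (a x).Pairwise fun u v =>
      (π₀ (Sum.inl x) u).val ≤ (π₀ (Sum.inl x) v).val + 4 * ρ x := by simp
  revert hL
  generalize List.finRange n = L
  intro hL
  induction L generalizing a ρ with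
  | nil => exact fun x => hL x (by simp)
  | cons x L ih =>
    refine (safe_quicksort π₀ x n (a x) ρ).bind fun l ρ' h hl => ih _ _ fun x' hx' => ?_
    by_cases hxx : x' = x
    · subst hxx
      simpa using hl.2
    · rw [Function.update_of_ne hxx]
      refine (hL x' (by simp [hxx, hx'])).imp fun huv => huv.trans ?_
      have : ρ x' ≤ ρ' x' := h x'
      omega

/-! ## A potential for blocking pairs -/

/-- The number of elements of `cand z` that `z` prefers to the element `hold z` that it holds. -/
def violations (π : Prefs n) (hold : Agent n → Option (Fin n)) (cand : Agent n → Finset (Fin n))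
    (z : Agent n) : ℕ :=
  match hold z with
  | none => 0
  | some h => ((cand z).filter fun u => π z u < π z h).card

theorem violations_none {π : Prefs n} {hold : Agent n → Option (Fin n)}
    {cand : Agent n → Finset (Fin n)} {z : Agent n} (h : hold z = none) :
    violations π hold cand z = 0 := by simp [violations, h]

theorem violations_some {π : Prefs n} {hold : Agent n → Option (Fin n)}
    {cand : Agent n → Finset (Fin n)} {z : Agent n} {u : Fin n} (h : hold z = some u) :
    violations π hold cand z = ((cand z).filter fun v => π z v < π z u).card := by
  simp [violations, h]

theorem violations_le_of {π : Prefs n} {hold hold' : Agent n → Option (Fin n)}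
    {cand cand' : Agent n → Finset (Fin n)} {z : Agent n} {h h' : Fin n} (hh : hold z = some h)
    (hh' : hold' z = some h')
    (H : ∀ u ∈ cand z, π z u < π z h → u ∈ cand' z ∧ π z u < π z h') :
    violations π hold cand z ≤ violations π hold' cand' z := by
  rw [violations_some hh, violations_some hh']
  refine Finset.card_le_card fun u hu => ?_
  rw [Finset.mem_filter] at hu ⊢
  exact H u hu.1 hu.2

/-- The tolerance of `z`. -/
def tolerance (K : ℕ) (c : Fin n → Fin n → ℕ) : Agent n → ℕ
  | Sum.inl x => excess K (radius c x)
  | Sum.inr _ => 0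

theorem tolerance_mono (K : ℕ) {c c' : Fin n → Fin n → ℕ} (h : c ≤ c') :
    tolerance K c ≤ tolerance K c' := by
  rintro (x | y)
  · exact excess_mono K (radius_mono h x)
  · exact le_rfl

theorem sum_tolerance (K : ℕ) (c : Fin n → Fin n → ℕ) : ∑ z, tolerance K c z = totalExcess K c := by
  simp [tolerance, totalExcess]

/-- The exponential potential of the violations that exceed the tolerances. -/
noncomputable def blockPotential (K : ℕ) (hold : Agent n → Option (Fin n))
    (cand : Agent n → Finset (Fin n)) (e : CountedPrefs n) : ℝ≥0∞ :=
  2 ^ ∑ z, (violations e.1 hold cand z - tolerance K e.2 z)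

/-- The subtraction in the exponent is truncated, so violations within the tolerance count as zero.
-/
theorem blockPotential_le_of {K : ℕ} {hold hold' : Agent n → Option (Fin n)}
    {cand cand' : Agent n → Finset (Fin n)} {e : CountedPrefs n}
    (h : ∀ z, violations e.1 hold cand z ≤ tolerance K e.2 z ∨
      violations e.1 hold cand z ≤ violations e.1 hold' cand' z) :
    blockPotential K hold cand e ≤ blockPotential K hold' cand' e :=
  pow_le_pow_right₀ (by norm_num) (Finset.sum_le_sum fun z _ => by
    rcases h z with h | h <;> omega)

/-- Only a swap that moves the held element can create a violation, and just one neighbour can pass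
it. -/
theorem violations_swapAt_le (π : Prefs n) (ev : Event n) (hold : Agent n → Option (Fin n))
    (cand : Agent n → Finset (Fin n)) (z : Agent n) :
    violations (swapAt π ev.1 ev.2) hold cand z ≤ violations π hold cand z +
      if ∃ h, hold z = some h ∧ Moves π ev z h then 1 else 0 := by
  cases hh : hold z with
  | none => simp [violations_none hh]
  | some h =>
    rw [violations_some hh, violations_some hh]
    by_cases hm : Moves π ev z h
    · rw [if_pos ⟨h, rfl, hm⟩]
      obtain ⟨hz, hm⟩ := hm
      have hi := ev.2.2
      -- `w` is the other element of the swapped pair.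
      obtain ⟨w, hw⟩ : ∃ w, (π z w).val =
          if (π z h).val = ev.2.val then ev.2.val + 1 else ev.2.val :=
        ⟨(π z).symm ⟨if (π z h).val = ev.2.val then ev.2.val + 1 else ev.2.val, by
          split_ifs <;> omega⟩, by simp⟩
      refine (Finset.card_le_card (t := insert w ((cand z).filter fun u => π z u < π z h))
        fun u hu => ?_).trans (Finset.card_insert_le _ _)
      rw [Finset.mem_filter, hz, Fin.lt_def, swapAt_val, swapAt_val] at hu
      rw [Finset.mem_insert, Finset.mem_filter, Fin.lt_def]
      by_cases huw : (π z u).val = (π z w).val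
      · exact Or.inl ((π z).injective (Fin.ext huw))
      · refine Or.inr ⟨hu.1, ?_⟩
        have := hu.2
        split_ifs at this hw <;> omega
    · rw [if_neg (by rintro ⟨h', hh', hm'⟩; cases hh'; exact hm hm'), add_zero]
      refine Finset.card_le_card fun u hu => ?_
      rw [Finset.mem_filter] at hu ⊢
      exact ⟨hu.1, (swapAt_lt_iff hm u).1 hu.2⟩

/-- An event concerns one list and adds at most one to the exponent, so the potential at most
doubles. The increase is written as a sum over all players, with at most one nonzero term, in order
to be averaged over events. -/
theorem blockPotential_apply_le (K : ℕ) (hold : Agent n → Option (Fin n))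
    (cand : Agent n → Finset (Fin n)) (e : CountedPrefs n) (ev : Event n) :
    blockPotential K hold cand (e.apply ev) ≤ blockPotential K hold cand e +
      ∑ z, if ∃ h, hold z = some h ∧ Moves e.1 ev z h then blockPotential K hold cand e else 0 := by
  set m : Agent n → ℕ := fun z => if ∃ h, hold z = some h ∧ Moves e.1 ev z h then 1 else 0 with hm
  have h1 : ∑ z, (violations (e.apply ev).1 hold cand z - tolerance K (e.apply ev).2 z) ≤
      ∑ z, (violations e.1 hold cand z - tolerance K e.2 z) + ∑ z, m z := by
    rw [← Finset.sum_add_distrib]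
    refine Finset.sum_le_sum fun z _ => ?_
    have h2 : _ ≤ _ + m z := violations_swapAt_le e.1 ev hold cand z
    have h3 : tolerance K e.2 z ≤ tolerance K (e.apply ev).2 z :=
      tolerance_mono K (e.le_apply ev) z
    simp only [CountedPrefs.apply] at h3 ⊢
    omega
  have h0 : ∀ z, z ≠ ev.1 → ¬ ∃ h, hold z = some h ∧ Moves e.1 ev z h :=
    fun z hz ⟨h, _, hm⟩ => hz hm.1.symm
  have h2 : ∑ z, m z = m ev.1 :=
    Finset.sum_eq_single _ (fun z _ hz => if_neg (h0 z hz)) (by simp)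
  have h3 : (∑ z, if ∃ h, hold z = some h ∧ Moves e.1 ev z h then blockPotential K hold cand e
      else 0) = if ∃ h, hold ev.1 = some h ∧ Moves e.1 ev ev.1 h then blockPotential K hold cand e
      else 0 :=
    Finset.sum_eq_single _ (fun z _ hz => if_neg (h0 z hz)) (by simp)
  rw [h3]
  rw [h2] at h1
  refine (pow_le_pow_right₀ (by norm_num : (1 : ℝ≥0∞) ≤ 2) h1).trans (le_of_eq ?_)
  simp only [hm, blockPotential]
  split_ifs
  · rw [pow_succ, mul_two]
  · simp

/-- The growth factor of the potential in one event. -/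
noncomputable def eventGrowth (n : ℕ) : ℝ≥0∞ := 1 + 2 * ((n - 1 : ℕ) : ℝ≥0∞)⁻¹

/-- Each of the 2n players has at most two events that move its held element, out of 2n(n−1), so a
doubling has probability at most 2/(n−1). -/
theorem expect_blockPotential_le (hn : 2 ≤ n) (K : ℕ) (hold : Agent n → Option (Fin n))
    (cand : Agent n → Finset (Fin n)) (e : CountedPrefs n) :
    expect (countedEvolve e) (blockPotential K hold cand) ≤
      eventGrowth n * blockPotential K hold cand e := by
  have hpos : ((2 * n * (n - 1) : ℕ) : ℝ≥0∞) ≠ 0 :=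
    Nat.cast_ne_zero.2 (Nat.mul_ne_zero (by omega) (by omega))
  have hpos' : ((2 * n : ℕ) : ℝ≥0∞) ≠ 0 := Nat.cast_ne_zero.2 (by omega)
  set B := blockPotential K hold cand e
  rw [expect_countedEvolve hn]
  calc _ ≤ ((2 * n * (n - 1) : ℕ) : ℝ≥0∞)⁻¹ * ∑ ev : Event n, (B +
        ∑ z, if ∃ h, hold z = some h ∧ Moves e.1 ev z h then B else 0) :=
        mul_le_mul_right (Finset.sum_le_sum fun ev _ => blockPotential_apply_le K hold cand e ev) _
    _ ≤ ((2 * n * (n - 1) : ℕ) : ℝ≥0∞)⁻¹ * ((2 * n * (n - 1) : ℕ) * B +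
        ∑ _z : Agent n, 2 * B) := by
        refine mul_le_mul_right ?_ _
        rw [Finset.sum_add_distrib, Finset.sum_const, Finset.card_univ, card_event, nsmul_eq_mul,
          Finset.sum_comm]
        refine add_le_add_right (Finset.sum_le_sum fun z _ => ?_) _
        rw [← Finset.sum_filter, Finset.sum_const, nsmul_eq_mul]
        refine mul_le_mul_left ?_ _
        cases hh : hold z with
        | none => simp
        | some h => simpa using (by exact_mod_cast card_moves_le e.1 z h :
            ((Finset.univ.filter fun ev : Event n => Moves e.1 ev z h).card : ℝ≥0∞) ≤ 2)
    _ = _ := by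
        rw [Finset.sum_const, Finset.card_univ, nsmul_eq_mul,
          show Fintype.card (Agent n) = 2 * n by simp [two_mul], mul_add, ← mul_assoc,
          ENNReal.inv_mul_cancel hpos (ENNReal.natCast_ne_top _), one_mul, eventGrowth, add_mul,
          one_mul, ← mul_assoc, Nat.cast_mul (2 * n),
          ENNReal.mul_inv (Or.inl hpos') (Or.inl (ENNReal.natCast_ne_top _)),
          mul_right_comm _ _ ((2 * n : ℕ) : ℝ≥0∞),
          ENNReal.inv_mul_cancel hpos' (ENNReal.natCast_ne_top _), one_mul]
        ring

theorem one_le_eventGrowth (n : ℕ) : 1 ≤ eventGrowth n := le_self_add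

theorem eventGrowth_ne_top (hn : 2 ≤ n) : eventGrowth n ≠ ⊤ := by
  have : ((n - 1 : ℕ) : ℝ≥0∞) ≠ 0 := Nat.cast_ne_zero.2 (by omega)
  exact ENNReal.add_ne_top.2 ⟨by simp, ENNReal.mul_ne_top (by simp) (ENNReal.inv_ne_top.2 this)⟩

theorem tick_le_of_growth {f : CountedPrefs n → ℝ≥0∞} (hn : 2 ≤ n)
    (h : ∀ e, expect (countedEvolve e) f ≤ eventGrowth n * f e) (α : ℕ) (e : CountedPrefs n) :
    tick ((eventGrowth n ^ α)⁻¹) (countedEvolveMany α) f e ≤ f e := by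
  have h0 : eventGrowth n ^ α ≠ 0 := by
    have := one_le_pow₀ (one_le_eventGrowth n) (n := α)
    exact (zero_lt_one.trans_le this).ne'
  have ht : eventGrowth n ^ α ≠ ⊤ := ENNReal.pow_ne_top (eventGrowth_ne_top hn)
  unfold tick
  calc _ ≤ (eventGrowth n ^ α)⁻¹ * (eventGrowth n ^ α * f e) :=
        mul_le_mul_right (expect_countedEvolveMany_le h α e) _
    _ = f e := by rw [← mul_assoc, ENNReal.inv_mul_cancel h0 ht, one_mul]

/-! ## The potential of the states of a matching run -/

open Classical in
/-- The partner of `x ∈ A`. -/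
noncomputable def partner (M : Assignment n) (x : Fin n) : Option (Fin n) :=
  if h : ∃ y, M y = some x then some h.choose else none

theorem partner_eq_some {M : Assignment n} (hM : ∀ y y' x, M y = some x → M y' = some x → y = y')
    {x y : Fin n} (h : M y = some x) : partner M x = some y := by
  have hex : ∃ y, M y = some x := ⟨y, h⟩
  rw [partner, dif_pos hex, hM _ _ _ hex.choose_spec h]

theorem partner_eq_none {M : Assignment n} {x : Fin n} (h : ∀ y, M y ≠ some x) :
    partner M x = none := dif_neg fun ⟨y, hy⟩ => h y hy

/-- Every player holds its partner. -/
noncomputable def holdPartner (M : Assignment n) : Agent n → Option (Fin n)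
  | Sum.inl x => partner M x
  | Sum.inr y => M y

/-- The players of `B` should not prefer those who have proposed to them, and the players of `A`
should not prefer those to whom they have not proposed. -/
def candProposed (P : Finset (Fin n × Fin n)) : Agent n → Finset (Fin n)
  | Sum.inl x => Finset.univ.filter fun y => (x, y) ∉ P
  | Sum.inr y => Finset.univ.filter fun x => (x, y) ∈ P

/-- The potential between two proposals. -/
noncomputable def gsPotential (K : ℕ) (s : GSState n) : CountedPrefs n → ℝ≥0∞ :=
  blockPotential K (holdPartner s.M) (candProposed s.proposed)

/-- The potential while `p` scans its candidates, where `h` is the best one so far and `l` are the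
remaining ones. -/
noncomputable def scanPotential (K : ℕ) (s : GSState n) (p h : Fin n) (l : List (Fin n)) :
    CountedPrefs n → ℝ≥0∞ :=
  blockPotential K (Function.update (holdPartner s.M) (Sum.inl p) (some h))
    (Function.update (candProposed s.proposed) (Sum.inl p)
      (Finset.univ.filter fun y => (p, y) ∉ s.proposed ∧ y ∉ l))

/-- The element `v` leaves the unscanned list and becomes a possible violation, but at the moment of
the query it is not preferred to the new best element. Replacing the best element by a better one
only removes violations. -/
theorem scanPotential_step {K : ℕ} {s : GSState n} {p h v : Fin n} {l : List (Fin n)}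
    (e : CountedPrefs n) :
    scanPotential K s p (if Query.answer ⟨Sum.inl p, v, h⟩ e.1 then v else h) l e ≤
      scanPotential K s p h (v :: l) e := by
  refine blockPotential_le_of fun z => Or.inr ?_
  by_cases hz : z = Sum.inl p
  · subst hz
    refine violations_le_of (Function.update_self ..) (Function.update_self ..) fun u hu hlt => ?_
    simp only [Function.update_self, Finset.mem_filter, Finset.mem_univ, true_and, List.mem_cons,
      not_or] at hu ⊢
    by_cases hvh : e.1 (Sum.inl p) v < e.1 (Sum.inl p) h
    · simp only [Query.answer, hvh, decide_true, if_true] at hlt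
      exact ⟨⟨hu.1, by rintro rfl; exact lt_irrefl _ hlt, hu.2⟩, hlt.trans hvh⟩
    · simp only [Query.answer, hvh, decide_false, Bool.false_eq_true, if_false] at hlt
      exact ⟨⟨hu.1, by rintro rfl; exact hvh hlt, hu.2⟩, hlt⟩
  · simp [violations, hz]

theorem violations_gs_le_scan {s : GSState n} {p y : Fin n} {M : Assignment n}
    {π : Prefs n} {z : Agent n} (hz : z ≠ Sum.inl p) (hzy : z ≠ Sum.inr y)
    (h : holdPartner M z = none ∨ holdPartner M z = holdPartner s.M z) :
    violations π (holdPartner M) (candProposed (insert (p, y) s.proposed)) z ≤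
      violations π (Function.update (holdPartner s.M) (Sum.inl p) (some y))
        (Function.update (candProposed s.proposed) (Sum.inl p)
          (Finset.univ.filter fun y => (p, y) ∉ s.proposed ∧ y ∉ ([] : List (Fin n)))) z := by
  rcases h with h | h
  · rw [violations_none h]; exact Nat.zero_le _
  · have hc : candProposed (insert (p, y) s.proposed) z = candProposed s.proposed z := by
      cases z with
      | inl x =>
        have hx : x ≠ p := fun hx => hz (by rw [hx])
        simp [candProposed, hx]
      | inr y' =>
        have hy' : y' ≠ y := fun hx => hzy (by rw [hx])
        simp [candProposed, hy']
    simp [violations, hz, h, hc]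

theorem violations_proposer_le {s : GSState n} {p y : Fin n} {M : Assignment n} {π : Prefs n}
    (h : holdPartner M (Sum.inl p) = some y ∨ holdPartner M (Sum.inl p) = none) :
    violations π (holdPartner M) (candProposed (insert (p, y) s.proposed)) (Sum.inl p) ≤
      violations π (Function.update (holdPartner s.M) (Sum.inl p) (some y))
        (Function.update (candProposed s.proposed) (Sum.inl p)
          (Finset.univ.filter fun y => (p, y) ∉ s.proposed ∧ y ∉ ([] : List (Fin n))))
        (Sum.inl p) := by
  rcases h with h | h
  · refine violations_le_of h (Function.update_self ..) fun u hu hlt => ⟨?_, hlt⟩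
    simp only [candProposed, Finset.mem_filter, Finset.mem_univ, true_and, Finset.mem_insert,
      not_or, Function.update_self, List.not_mem_nil, not_false_eq_true, and_true] at hu ⊢
    exact hu.2
  · rw [violations_none h]; exact Nat.zero_le _

theorem partner_update_of_ne {s : GSState n} {p p₁ y x : Fin n} (hx : x ≠ p)
    (hinj : ∀ y y' x, s.M y = some x → s.M y' = some x → y = y')
    (hinj' : ∀ y' y'' x, Function.update s.M y (some p) y' = some x →
      Function.update s.M y (some p) y'' = some x → y' = y'')
    (hy : s.M y = none ∨ s.M y = some p₁) :
    partner (Function.update s.M y (some p)) x = none ∨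
      partner (Function.update s.M y (some p)) x = partner s.M x := by
  by_cases hex : ∃ y', s.M y' = some x
  · obtain ⟨y', hy'⟩ := hex
    by_cases hyy : y' = y
    · subst hyy
      left
      refine partner_eq_none fun y'' h'' => ?_
      rw [Function.update_apply] at h''
      split_ifs at h'' with h3
      · cases h''; exact hx rfl
      · exact h3 (hinj _ _ _ h'' hy')
    · right
      rw [partner_eq_some hinj hy']
      exact partner_eq_some hinj' (by rw [Function.update_of_ne hyy, hy'])
  · left
    refine partner_eq_none fun y'' h'' => ?_
    rw [Function.update_apply] at h''
    split_ifs at h'' with h3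
    · cases h''; exact hx rfl
    · exact hex ⟨_, h''⟩

theorem gsPotential_accept_free {K : ℕ} {s : GSState n} {p y : Fin n} {L : List (Fin n)}
    (hs : GSInv s (p :: L)) (hy : s.M y = none) (e : CountedPrefs n) :
    gsPotential K ⟨Function.update s.M y (some p), insert (p, y) s.proposed⟩ e ≤
      scanPotential K s p y [] e := by
  have hinj' := (hs.accept_free hy).inj
  refine blockPotential_le_of fun z => Or.inr ?_
  by_cases hz : z = Sum.inl p
  · subst hz
    exact violations_proposer_le (Or.inl (partner_eq_some hinj' (by simp)))
  by_cases hzy : z = Sum.inr y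
  · subst hzy
    rw [violations_some (u := p) (by simp [holdPartner])]
    refine (Nat.le_of_eq (Finset.card_eq_zero.2 ?_)).trans (Nat.zero_le _)
    refine Finset.filter_eq_empty_iff.2 fun x hx => ?_
    have : x = p := by simpa [candProposed, hs.untouched y hy] using hx
    simp [this]
  · refine violations_gs_le_scan hz hzy ?_
    cases z with
    | inl x =>
      exact partner_update_of_ne (p₁ := p) (fun hx => hz (by rw [hx])) hs.inj hinj' (Or.inl hy)
    | inr y' =>
      right
      have hy' : y' ≠ y := fun hx => hzy (by rw [hx])
      simp [holdPartner, hy']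

/-- The recipient trades up: any earlier proposer that it prefers to `p` it also preferred to `p₁`.
The displaced `p₁` holds nothing and therefore has no violations until it scans again. -/
theorem gsPotential_accept {K : ℕ} {s : GSState n} {p p₁ y : Fin n} {L : List (Fin n)}
    (hs : GSInv s (p :: L)) (hy : s.M y = some p₁) {e : CountedPrefs n}
    (he : e.1 (Sum.inr y) p < e.1 (Sum.inr y) p₁) :
    gsPotential K ⟨Function.update s.M y (some p), insert (p, y) s.proposed⟩ e ≤
      scanPotential K s p y [] e := by
  have hinj' := (hs.accept hy).inj
  refine blockPotential_le_of fun z => Or.inr ?_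
  by_cases hz : z = Sum.inl p
  · subst hz
    exact violations_proposer_le (Or.inl (partner_eq_some hinj' (by simp)))
  by_cases hzy : z = Sum.inr y
  · subst hzy
    refine violations_le_of (h := p) (h' := p₁) (by simp [holdPartner]) (by simp [holdPartner, hy])
      fun u hu hlt => ⟨?_, hlt.trans he⟩
    have hup : u ≠ p := by rintro rfl; exact lt_irrefl _ hlt
    simpa [candProposed, hup] using hu
  · refine violations_gs_le_scan hz hzy ?_
    cases z with
    | inl x => exact partner_update_of_ne (fun hx => hz (by rw [hx])) hs.inj hinj' (Or.inr hy)
    | inr y' =>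
      right
      have hy' : y' ≠ y := fun hx => hzy (by rw [hx])
      simp [holdPartner, hy']

theorem gsPotential_reject {K : ℕ} {s : GSState n} {p p₁ y : Fin n} {L : List (Fin n)}
    (hs : GSInv s (p :: L)) (hy : s.M y = some p₁) {e : CountedPrefs n}
    (he : ¬ e.1 (Sum.inr y) p < e.1 (Sum.inr y) p₁) :
    gsPotential K ⟨s.M, insert (p, y) s.proposed⟩ e ≤ scanPotential K s p y [] e := by
  refine blockPotential_le_of fun z => Or.inr ?_
  by_cases hz : z = Sum.inl p
  · subst hz
    exact violations_proposer_le (Or.inr (partner_eq_none (hs.free p (by simp))))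
  by_cases hzy : z = Sum.inr y
  · subst hzy
    refine violations_le_of (h := p₁) (h' := p₁) (by simp [holdPartner, hy])
      (by simp [holdPartner, hy]) fun u hu hlt => ⟨?_, hlt⟩
    have hup : u ≠ p := by rintro rfl; exact he hlt
    simpa [candProposed, hup] using hu
  · exact violations_gs_le_scan hz hzy (Or.inr rfl)

/-- The element with the highest approximate rank is not much worse than the elements that are not
candidates. -/
theorem scanPotential_start {K : ℕ} {a : Approx n} (ha : IsPermApprox a) {π₀ : Prefs n}
    {s : GSState n} {p b : Fin n} {l : List (Fin n)} (hbl : candidates K a p s = b :: l)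
    {e : CountedPrefs n} (he : Tracks π₀ e)
    (hacc : Accurate π₀ a (radius e.2)) : scanPotential K s p b l e ≤ gsPotential K s e := by
  refine blockPotential_le_of fun z => ?_
  by_cases hz : z = Sum.inl p
  swap
  · right; simp [violations, hz]
  left
  subst hz
  rw [violations_some (Function.update_self ..), Function.update_self, tolerance]
  set R := radius e.2 p with hR
  set S := (Finset.univ.filter fun y => (p, y) ∉ s.proposed ∧ y ∉ l).filter
    (fun v => e.1 (Sum.inl p) v < e.1 (Sum.inl p) b) with hS
  set Lst := (a p).filter fun y => (p, y) ∉ s.proposed with hLst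
  have hsplit : (b :: l) ++ Lst.drop K = Lst := by
    rw [← hbl]; exact List.take_append_drop K Lst
  have hnd : Lst.Nodup := ((ha p).nodup_iff.2 (List.nodup_finRange n)).filter _
  have hpw : Lst.Pairwise fun u v =>
      (π₀ (Sum.inl p) u).val ≤ (π₀ (Sum.inl p) v).val + 4 * R :=
    (hacc p).sublist List.filter_sublist
  have hinjOn : ∀ T : Finset (Fin n), ∀ A B : ℕ, (∀ u ∈ T, A ≤ (π₀ (Sum.inl p) u).val ∧
      (π₀ (Sum.inl p) u).val < B) → T.card ≤ B - A := fun T A B h => by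
    rw [← Nat.card_Ico]
    exact Finset.card_le_card_of_injOn (fun u => (π₀ (Sum.inl p) u).val)
      (fun u hu => by simpa using h u hu)
      (fun u _ v _ huv => (π₀ (Sum.inl p)).injective (Fin.ext huv))
  rw [← hsplit, List.pairwise_append] at hpw
  obtain ⟨hpw₁, -, hpw₂⟩ := hpw
  -- A violating `v` is not a candidate. That it is now ranked before `b` costs a displacement of
  -- 2R; that it comes after `b` in the approximation costs 4R.
  have hmem : ∀ v ∈ S, v ∈ Lst.drop K ∧ (π₀ (Sum.inl p) v).val < (π₀ (Sum.inl p) b).val + 2 * R ∧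
      (π₀ (Sum.inl p) b).val ≤ (π₀ (Sum.inl p) v).val + 4 * R := by
    intro v hv
    simp only [hS, Finset.mem_filter, Finset.mem_univ, true_and] at hv
    obtain ⟨⟨hv1, hv2⟩, hv3⟩ := hv
    have hvb : v ≠ b := by rintro rfl; exact lt_irrefl _ hv3
    have hvL : v ∈ Lst := by simp [hLst, ha.mem, hv1]
    rw [← hsplit, List.mem_append] at hvL
    have hvd : v ∈ Lst.drop K := by
      rcases hvL with h | h
      · simp [hvb, hv2] at h
      · exact h
    have h1 := (he p v).1
    have h2 := (he p b).2
    have h3 := le_radius e.2 p v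
    have h4 := le_radius e.2 p b
    rw [Fin.lt_def] at hv3
    exact ⟨hvd, by omega, hpw₂ b (by simp) v hvd⟩
  rcases S.eq_empty_or_nonempty with hemp | ⟨v₀, hv₀⟩
  · rw [hemp, Finset.card_empty]; exact Nat.zero_le _
  obtain ⟨hd₀, hlt₀, -⟩ := hmem v₀ hv₀
  have hlen : K < Lst.length := by
    by_contra hK
    rw [List.drop_eq_nil_of_le (by omega)] at hd₀
    simp at hd₀
  have hK : (b :: l).length = K := by
    rw [← hbl]; unfold candidates; rw [List.length_take]; exact min_eq_left hlen.le
  have hbnd : (b :: l).Nodup := by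
    rw [← hsplit] at hnd; exact List.Nodup.of_append_left hnd
  -- Every candidate comes before `v₀` in the approximation, hence at most 4R beyond it. So a single
  -- violation forces all K candidates into a window of 10R positions of `π₀`.
  have hK10 : K ≤ 10 * R := by
    rw [← hK, ← List.toFinset_card_of_nodup hbnd]
    refine (hinjOn _ ((π₀ (Sum.inl p) b).val - 4 * R) ((π₀ (Sum.inl p) b).val + 6 * R)
      fun u hu => ?_).trans (by omega)
    rw [List.mem_toFinset] at hu
    have h1 := hpw₂ u hu v₀ hd₀
    have h2 : (π₀ (Sum.inl p) b).val ≤ (π₀ (Sum.inl p) u).val + 4 * R := by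
      rcases List.mem_cons.1 hu with rfl | hu
      · omega
      · exact (List.pairwise_cons.1 hpw₁).1 u hu
    omega
  rw [excess, if_pos hK10]
  -- The violating elements themselves lie in a window of 6R positions.
  refine (hinjOn S ((π₀ (Sum.inl p) b).val - 4 * R) ((π₀ (Sum.inl p) b).val + 2 * R)
    fun u hu => ?_).trans (by omega)
  have := hmem u hu
  omega

/-! ## Blocking pairs at the end of a matching run -/

/-- The potential of the result of a matching run. -/
noncomputable def outputPotential (K : ℕ) (M : Assignment n) (e : CountedPrefs n) : ℝ≥0∞ :=
  ⨅ P : Finset (Fin n × Fin n), gsPotential K ⟨M, P⟩ e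

/-- A blocking pair is charged to its `B`-side if it belongs to `P`, and to its `A`-side otherwise.
This works for every `P`, so the set of proposals may be forgotten once a run is over;
`outputPotential` takes the infimum for this reason. -/
theorem numBlocking_le_sum_violations (π : Prefs n) {M : Assignment n} (hM : IsMatching M)
    (P : Finset (Fin n × Fin n)) :
    numBlocking π M ≤ ∑ z, violations π (holdPartner M) (candProposed P) z := by
  classical
  obtain ⟨m, hm⟩ := hM
  have hval : ∀ y, M y = some (m.symm y) := fun y => by simpa using hm (m.symm y)
  have hinj : ∀ y y' x, M y = some x → M y' = some x → y = y' := fun y y' x h h' => by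
    rw [hval] at h h'
    exact m.symm.injective ((Option.some.inj h).trans (Option.some.inj h').symm)
  have hpart : ∀ x, partner M x = some (m x) := fun x => partner_eq_some hinj (hm x)
  have h1 : numBlocking π M ≤ ((Finset.univ.filter fun q : Agent n × Fin n =>
      q.2 ∈ candProposed P q.1 ∧ ∃ h, holdPartner M q.1 = some h ∧ π q.1 q.2 < π q.1 h).card) := by
    rw [numBlocking, ← Set.ncard_coe_finset]
    refine Set.ncard_le_ncard_of_injOn
      (fun q => if q ∈ P then (Sum.inr q.2, q.1) else (Sum.inl q.1, q.2)) (fun q hq => ?_)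
      (fun q _ q' _ h => ?_) (Set.toFinite _)
    · obtain ⟨h1, h2⟩ := hq
      simp only [Finset.coe_filter, Finset.mem_univ, true_and]
      by_cases hP : q ∈ P
      · simp only [if_pos hP]
        exact ⟨by simpa [candProposed] using hP, m.symm q.2, hval q.2, h1 _ (hval q.2)⟩
      · simp only [if_neg hP]
        exact ⟨by simpa [candProposed] using hP, m q.1, hpart q.1, h2 _ (hm q.1)⟩
    · dsimp only at h
      split_ifs at h
      all_goals simp only [Prod.mk.injEq, Sum.inr.injEq, Sum.inl.injEq, reduceCtorEq,
        false_and] at h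
      · exact Prod.ext h.2 h.1
      · exact Prod.ext h.1 h.2
  refine h1.trans (le_of_eq ?_)
  rw [Finset.card_filter, Fintype.sum_prod_type]
  refine Finset.sum_congr rfl fun z _ => ?_
  rw [← Finset.card_filter]
  cases hz : holdPartner M z with
  | none => simp [violations_none hz, hz]
  | some h =>
    rw [violations_some hz]
    congr 1
    ext u
    simp [hz]

theorem two_pow_numBlocking_le (K : ℕ) {M : Assignment n} (hM : IsMatching M)
    (e : CountedPrefs n) :
    (2 : ℝ≥0∞) ^ (numBlocking e.1 M - totalExcess K e.2) ≤ outputPotential K M e := by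
  refine le_iInf fun P => pow_le_pow_right₀ (by norm_num) ?_
  have h := numBlocking_le_sum_violations e.1 hM P
  rw [tsub_le_iff_right, ← sum_tolerance, ← Finset.sum_add_distrib]
  exact h.trans (Finset.sum_le_sum fun z _ => by dsimp only; omega)

/-- The growth bound passes to the infimum, since the expectation of an infimum is at most the
infimum of the expectations. -/
theorem expect_outputPotential_le (hn : 2 ≤ n) (K : ℕ) (M : Assignment n) (e : CountedPrefs n) :
    expect (countedEvolve e) (outputPotential K M) ≤ eventGrowth n * outputPotential K M e := by
  unfold outputPotential
  refine (expect_iInf_le _ _).trans ?_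
  rw [ENNReal.mul_iInf_of_ne (zero_lt_one.trans_le (one_le_eventGrowth n)).ne'
    (eventGrowth_ne_top hn)]
  exact iInf_mono fun P => expect_blockPotential_le hn K _ _ e

/-- The weight of the evolution blocks that compensates the growth of the potential. -/
noncomputable def decayWeight (n α : ℕ) : ℝ≥0∞ := (eventGrowth n ^ α)⁻¹

theorem tick_tick_blockPotential_le (hn : 2 ≤ n) (K α : ℕ) (hold : Agent n → Option (Fin n))
    (cand : Agent n → Finset (Fin n)) (e : CountedPrefs n) :
    tick (decayWeight n α) (countedEvolveMany α)
      (tick (decayWeight n α) (countedEvolveMany α) (blockPotential K hold cand)) e ≤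
      blockPotential K hold cand e := by
  have h := tick_le_of_growth hn (expect_blockPotential_le hn K hold cand) α
  exact (tick_mono h).trans (h e)

section Run

variable {K α : ℕ} {a : Approx n} {π₀ : Prefs n}

/-- The environments in which the approximations are useful. -/
def Useful (π₀ : Prefs n) (a : Approx n) (e : CountedPrefs n) : Prop :=
  Tracks π₀ e ∧ Accurate π₀ a (radius e.2)

theorem eventStable_useful (π₀ : Prefs n) (a : Approx n) : EventStable (Useful π₀ a) :=
  fun e ev h => ⟨eventStable_tracks π₀ e ev h.1, h.2.mono (radius_mono (e.le_apply ev))⟩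

theorem wp_best_le_scanPotential (hn : 2 ≤ n) {s : GSState n} {p : Fin n}
    {F : Fin n → CountedPrefs n → ℝ≥0∞} (b : Fin n) (l : List (Fin n))
    (hF : ∀ y ∈ b :: l, ∀ e, Useful π₀ a e → F y e ≤ scanPotential K s p y [] e)
    {e : CountedPrefs n} (he : Useful π₀ a e) :
    wp (decayWeight n α) (countedEvolveMany α) Prod.fst F (best (Sum.inl p) b l) e ≤
      scanPotential K s p b l e := by
  induction l generalizing b e with
  | nil => exact hF b (by simp) e he
  | cons v l ih =>
    rw [best_cons, wp]
    refine le_trans (tick_mono_support fun e₁ h₁ => tick_mono_support fun e₂ h₂ => ?_)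
      (tick_tick_blockPotential_le hn K α _ _ e)
    have he₁ := (eventStable_useful π₀ a).countedEvolveMany he h₁
    have he₂ := (eventStable_useful π₀ a).countedEvolveMany he₁ h₂
    refine (ih _ (fun y hy => hF y ?_) he₂).trans (scanPotential_step e₂)
    split_ifs at hy <;> simp only [List.mem_cons] at hy ⊢ <;> tauto

/-- Under the decay weights the potential is a supermartingale: evolution is paid for by the
weights, the choice of the first candidate by the tolerance, and comparing, accepting and rejecting
do not increase it. -/
theorem wp_propose_le_gsPotential (hn : 2 ≤ n) (hK : 1 ≤ K) (ha : IsPermApprox a) (r : ℕ)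
    {p : Fin n} {s : GSState n} {L : List (Fin n)} (hs : GSInv s (p :: L))
    (hfuel : n * n ≤ r + s.proposed.card) {e : CountedPrefs n} (he : Useful π₀ a e) :
    wp (decayWeight n α) (countedEvolveMany α) Prod.fst (gsPotential K) (propose K a r p s) e ≤
      gsPotential K s e := by
  induction r generalizing p s e with
  | zero => have := hs.card_proposed_lt; omega
  | succ r ih =>
    obtain ⟨b, l, hbl⟩ := List.exists_cons_of_ne_nil (hs.candidates_ne_nil hK ha.mem)
    rw [propose_cons hbl, wp_bind]
    refine (wp_best_le_scanPotential hn b l (fun y hy e he => ?_) he).trans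
      (scanPotential_start ha hbl he.1 he.2)
    rw [← hbl] at hy
    have hcard : n * n ≤ r + (insert (p, y) s.proposed).card := by
      rw [Finset.card_insert_of_notMem (not_mem_proposed_of_mem_candidates hy)]; omega
    unfold proposal
    cases hM : s.M y with
    | none => exact gsPotential_accept_free hs hM e
    | some p₁ =>
      simp only [wp]
      refine le_trans (tick_mono_support fun e₁ h₁ => tick_mono_support fun e₂ h₂ => ?_)
        (tick_tick_blockPotential_le hn K α _ _ e)
      have he₁ := (eventStable_useful π₀ a).countedEvolveMany he h₁
      have he₂ := (eventStable_useful π₀ a).countedEvolveMany he₁ h₂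
      by_cases hlt : e₂.1 (Sum.inr y) p < e₂.1 (Sum.inr y) p₁
      · simp only [Query.answer, hlt, decide_true, if_true]
        exact (ih (hs.accept hM) hcard he₂).trans (gsPotential_accept hs hM hlt)
      · simp only [Query.answer, hlt, decide_false, Bool.false_eq_true, if_false]
        exact (ih (hs.reject hM) hcard he₂).trans (gsPotential_reject hs hM hlt)

/-- At the start nobody holds anything, so the potential is 1. -/
theorem wp_modifiedGS_le_one (hn : 2 ≤ n) (hK : 1 ≤ K) (ha : IsPermApprox a)
    {e : CountedPrefs n} (he : Useful π₀ a e) :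
    wp (decayWeight n α) (countedEvolveMany α) Prod.fst (outputPotential K) (modifiedGS K a) e ≤
      1 := by
  have hL : ∀ (L : List (Fin n)) (s : GSState n) (e : CountedPrefs n), GSInv s L →
      Useful π₀ a e → wp (decayWeight n α) (countedEvolveMany α) Prod.fst (outputPotential K)
        (matchLoop K a L s) e ≤ gsPotential K s e := by
    intro L
    induction L with
    | nil => exact fun s e _ _ => iInf_le _ s.proposed
    | cons x L ih =>
      intro s e hs he
      rw [matchLoop, wp_bind]
      refine (wp_mono_of (I := Useful π₀ a) (fun e he e' he' =>
        (eventStable_useful π₀ a).countedEvolveMany he he') (fun s' e' hs' he' => ih s' e' hs' he')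
        (leaves_propose hK ha.mem _ hs (Nat.le_add_right _ _)) he).trans ?_
      exact wp_propose_le_gsPotential hn hK ha _ hs (Nat.le_add_right _ _) he
  rw [modifiedGS_eq]
  refine (hL _ _ e GSInv.initial he).trans (le_of_eq ?_)
  have : ∀ z, violations e.1 (holdPartner (fun _ : Fin n => (none : Option (Fin n))))
      (candProposed ∅) z = 0 := fun z => violations_none (by
    cases z with
    | inl x => exact partner_eq_none (by simp)
    | inr y => rfl)
  simp [gsPotential, blockPotential, this]

end Run

/-! ## The joint process with bookkeeping -/

/-- A state of the joint process together with reference lists, the counters of the moves since the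
reference time, and the starting times of the present matching run and of the matching run that
has produced the output. -/
structure TrackedState (n : ℕ) where
  st : State n
  ref : Prefs n
  cnt : Fin n → Fin n → ℕ
  mStart : ℕ
  oStart : ℕ

namespace TrackedState

/-- The environment. -/
def env (g : TrackedState n) : CountedPrefs n := (g.st.prefs, g.cnt)

/-- The environment changes to `e`. -/
def evolveTo (g : TrackedState n) (e : CountedPrefs n) : TrackedState n :=
  { g with st := { g.st with prefs := e.1 }, cnt := e.2 }

/-- The sorting process has used a time-step and what remains is the given program. -/
def afterSort (g : TrackedState n) : Prog n (Approx n) → TrackedState n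
  | done a => { g with st := { g.st with approx := a, sorter := sequentialSort a } }
  | p => { g with st := { g.st with sorter := p } }

/-- The matching process has used the time-step `t` and what remains is the given program. -/
def afterMatch (K t : ℕ) (g : TrackedState n) : Prog n (Assignment n) → TrackedState n
  | done M => { g with
      st := { g.st with output := M, matcher := modifiedGS K g.st.approx }
      mStart := t
      oStart := g.mStart }
  | p => { g with st := { g.st with matcher := p } }

/-- The time-step number `t`. -/
noncomputable def step (K α t : ℕ) (g : TrackedState n) : PMF (TrackedState n) :=
  (if Even t then (g.st.sorter.turn g.st.prefs).map g.afterSort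
    else (g.st.matcher.turn g.st.prefs).map (g.afterMatch K t)).bind fun g₁ =>
    (countedEvolveMany α g₁.env).map g₁.evolveTo

theorem env_afterSort (g : TrackedState n) (p : Prog n (Approx n)) :
    (g.afterSort p).env = g.env := by cases p <;> rfl

theorem env_afterMatch (K t : ℕ) (g : TrackedState n) (p : Prog n (Assignment n)) :
    (g.afterMatch K t p).env = g.env := by cases p <;> rfl

theorem expect_step_even {K α t : ℕ} (ht : Even t) (g : TrackedState n)
    (Φ : TrackedState n → ℝ≥0∞) :
    expect (g.step K α t) Φ = expect (g.st.sorter.turn g.st.prefs) fun p =>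
      expect (countedEvolveMany α g.env) fun e => Φ ((g.afterSort p).evolveTo e) := by
  rw [step, if_pos ht, expect_bind, expect_map]
  simp only [expect_map, env_afterSort]

theorem expect_step_odd {K α t : ℕ} (ht : ¬ Even t) (g : TrackedState n)
    (Φ : TrackedState n → ℝ≥0∞) :
    expect (g.step K α t) Φ = expect (g.st.matcher.turn g.st.prefs) fun p =>
      expect (countedEvolveMany α g.env) fun e => Φ ((g.afterMatch K t p).evolveTo e) := by
  rw [step, if_neg ht, expect_bind, expect_map]
  simp only [expect_map, env_afterMatch]

theorem mem_support_step {K α t : ℕ} {g g' : TrackedState n} (h : g' ∈ (g.step K α t).support) :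
    ∃ e ∈ (countedEvolveMany α g.env).support,
      (Even t ∧ ∃ p ∈ (g.st.sorter.turn g.st.prefs).support, g' = (g.afterSort p).evolveTo e) ∨
      (¬ Even t ∧ ∃ p ∈ (g.st.matcher.turn g.st.prefs).support,
        g' = (g.afterMatch K t p).evolveTo e) := by
  rw [step, PMF.mem_support_bind_iff] at h
  obtain ⟨g₁, h₁, h₂⟩ := h
  rw [PMF.mem_support_map_iff] at h₂
  obtain ⟨e, he, rfl⟩ := h₂
  split_ifs at h₁ with ht
  · rw [PMF.mem_support_map_iff] at h₁
    obtain ⟨p, hp, rfl⟩ := h₁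
    rw [env_afterSort] at he
    exact ⟨e, he, Or.inl ⟨ht, p, hp, rfl⟩⟩
  · rw [PMF.mem_support_map_iff] at h₁
    obtain ⟨p, hp, rfl⟩ := h₁
    rw [env_afterMatch] at he
    exact ⟨e, he, Or.inr ⟨ht, p, hp, rfl⟩⟩

theorem step_map_st (K α t : ℕ) (g : TrackedState n) :
    (g.step K α t).map TrackedState.st = timeStep K α t g.st := by
  unfold step timeStep
  rw [PMF.map_bind]
  have h1 : ∀ g₁ : TrackedState n, ((countedEvolveMany α g₁.env).map g₁.evolveTo).map
      TrackedState.st = (evolveMany α g₁.st.prefs).map fun π => { g₁.st with prefs := π } := by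
    intro g₁
    rw [PMF.map_comp, show evolveMany α g₁.st.prefs = evolveMany α g₁.env.1 from rfl,
      ← countedEvolveMany_map_fst, PMF.map_comp]
    rfl
  simp only [h1]
  split_ifs
  · rw [PMF.bind_map, sortTurn, PMF.bind_map]
    congr 1
    funext p
    cases p <;> rfl
  · rw [PMF.bind_map, matchTurn, PMF.bind_map]
    congr 1
    funext p
    cases p <;> rfl

/-- The distribution of the state `k` time-steps after the time `t`, when `μ` is the distribution at
time `t`. -/
noncomputable def run (K α t : ℕ) (μ : PMF (TrackedState n)) : ℕ → PMF (TrackedState n)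
  | 0 => μ
  | k + 1 => (run K α t μ k).bind (step K α (t + k + 1))

/-- The tracking begins. -/
def start (t : ℕ) (s : State n) : TrackedState n := ⟨s, s.prefs, fun _ _ => 0, t, t⟩

/-- The law of the tracked process, where tracking begins at time `t`. -/
noncomputable def law (n K α t k : ℕ) : PMF (TrackedState n) :=
  run K α t ((EvolvingMatching.law n K α t).map (start t)) k

theorem law_map_st (K α t k : ℕ) :
    (law n K α t k).map TrackedState.st = EvolvingMatching.law n K α (t + k) := by
  induction k with
  | zero =>
    rw [law, run, PMF.map_comp]
    exact PMF.map_id _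
  | succ k ih =>
    rw [law, run, PMF.map_bind, ← add_assoc, EvolvingMatching.law, ← ih, PMF.bind_map]
    simp only [step_map_st]
    rfl

theorem run_add (K α t : ℕ) (μ : PMF (TrackedState n)) (k j : ℕ) :
    run K α t μ (k + j) = run K α (t + k) (run K α t μ k) j := by
  induction j with
  | zero => rfl
  | succ j ih => rw [← add_assoc, run, run, ih, add_assoc t k j]

theorem run_bind {Ω : Type*} (K α t : ℕ) (ν : PMF Ω) (μ : Ω → PMF (TrackedState n)) (k : ℕ) :
    run K α t (ν.bind μ) k = ν.bind fun g => run K α t (μ g) k := by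
  induction k with
  | zero => rfl
  | succ k ih => simp only [run, ih, PMF.bind_bind]

theorem run_induction {K α t : ℕ} {μ : PMF (TrackedState n)} {P : ℕ → TrackedState n → Prop}
    (h0 : ∀ g ∈ μ.support, P t g)
    (hs : ∀ τ g g', t ≤ τ → P τ g → g' ∈ (g.step K α (τ + 1)).support → P (τ + 1) g') (k : ℕ) :
    ∀ g ∈ (run K α t μ k).support, P (t + k) g := by
  induction k with
  | zero => exact h0
  | succ k ih =>
    intro g hg
    rw [run, PMF.mem_support_bind_iff] at hg
    obtain ⟨g₁, h₁, h₂⟩ := hg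
    exact hs _ _ _ (Nat.le_add_right _ _) (ih g₁ h₁) h₂

/-- The properties of all reachable tracked states at time `t`. -/
structure Sound (t : ℕ) (g : TrackedState n) : Prop where
  st : g.st.Sound
  tracks : Tracks g.ref g.env
  mStart : g.mStart ≤ t
  oStart : g.oStart ≤ t

theorem Sound.step {K : ℕ} (hK : 1 ≤ K) {α t : ℕ} {g g' : TrackedState n} (h : g.Sound t)
    (hg : g' ∈ (g.step K α (t + 1)).support) : g'.Sound (t + 1) := by
  have hst : g'.st.Sound := by
    refine sound_timeStep hK α (t + 1) h.st ?_
    rw [← step_map_st, PMF.mem_support_map_iff]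
    exact ⟨g', hg, rfl⟩
  have h1 := h.mStart
  have h2 := h.oStart
  obtain ⟨e, he, ⟨-, p, -, rfl⟩ | ⟨-, p, -, rfl⟩⟩ := mem_support_step hg
  · have htr := (eventStable_tracks g.ref).countedEvolveMany h.tracks he
    cases p <;> exact ⟨hst, htr, h1.trans (Nat.le_succ _), h2.trans (Nat.le_succ _)⟩
  · have htr := (eventStable_tracks g.ref).countedEvolveMany h.tracks he
    cases p
    · exact ⟨hst, htr, le_rfl, h1.trans (Nat.le_succ _)⟩
    all_goals exact ⟨hst, htr, h1.trans (Nat.le_succ _), h2.trans (Nat.le_succ _)⟩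

theorem sound_law {K : ℕ} (hK : 1 ≤ K) {α t k : ℕ} {g : TrackedState n}
    (hg : g ∈ (law n K α t k).support) : g.Sound (t + k) := by
  refine run_induction (P := Sound) (fun g hg => ?_)
    (fun τ g g' _ h hg => h.step hK hg) k g hg
  rw [PMF.mem_support_map_iff] at hg
  obtain ⟨s, hs, rfl⟩ := hg
  exact ⟨EvolvingMatching.sound_law hK α t hs, tracks_self _, le_rfl, le_rfl⟩

/-! ## Weighted numbers of remaining queries -/

section Remaining

variable {R : Type} {ξ : ℝ≥0∞} {α : ℕ}

/-- The weighted number of remaining queries when the next query is made in the next time-step. -/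
noncomputable def ready (ξ : ℝ≥0∞) (α : ℕ) (p : Prog n R) (e : CountedPrefs n) : ℝ≥0∞ :=
  wpNow ξ (countedEvolveMany α) Prod.fst (fun _ _ => 1) p e

/-- The weighted number of remaining queries when the next query is made in the time-step after the
next one. -/
noncomputable def waiting (ξ : ℝ≥0∞) (α : ℕ) (p : Prog n R) (e : CountedPrefs n) : ℝ≥0∞ :=
  tick ξ (countedEvolveMany α) (ready ξ α p) e

theorem expect_of_tick {E : Type*} {κ : E → PMF E} (h0 : ξ ≠ 0) (ht : ξ ≠ ⊤) (f : E → ℝ≥0∞)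
    (e : E) : expect (κ e) f = ξ⁻¹ * tick ξ κ f e := by
  rw [tick, ← mul_assoc, ENNReal.inv_mul_cancel h0 ht, one_mul]

theorem one_le_ready (hξ : 1 ≤ ξ) (p : Prog n R) (e : CountedPrefs n) : 1 ≤ ready ξ α p e :=
  one_le_wpNow hξ p e

theorem one_le_waiting (hξ : 1 ≤ ξ) (p : Prog n R) (e : CountedPrefs n) : 1 ≤ waiting ξ α p e := by
  calc (1 : ℝ≥0∞) ≤ ξ * 1 := by simpa using hξ
    _ = tick ξ (countedEvolveMany α) (fun _ => 1) e := (tick_const _ _).symm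
    _ ≤ _ := tick_mono fun e' => one_le_ready hξ p e'

theorem expect_ready (h0 : ξ ≠ 0) (ht : ξ ≠ ⊤) (p : Prog n R) (e : CountedPrefs n) :
    expect (countedEvolveMany α e) (ready ξ α p) = ξ⁻¹ * waiting ξ α p e :=
  expect_of_tick h0 ht _ _

theorem expect_waiting_ask (h0 : ξ ≠ 0) (ht : ξ ≠ ⊤) (q : Query n) (k : Bool → Prog n R)
    (e : CountedPrefs n) : expect (countedEvolveMany α e) (waiting ξ α (ask q k)) =
      ξ⁻¹ * wp ξ (countedEvolveMany α) Prod.fst (fun _ _ => 1) (ask q k) e := by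
  rw [expect_of_tick h0 ht, wp_ask_eq]; rfl

/-- This bounds a newly started run. In the worst case it returns without a query, and then its two
waiting blocks are not covered by `wp`; one of them is the present block, whose weight has been
divided out, so a single extra `ξ` remains. -/
theorem expect_waiting_le (h1 : 1 ≤ ξ) (ht : ξ ≠ ⊤) (p : Prog n R) (e : CountedPrefs n) :
    expect (countedEvolveMany α e) (waiting ξ α p) ≤
      ξ * wp ξ (countedEvolveMany α) Prod.fst (fun _ _ => 1) p e := by
  have h0 : ξ ≠ 0 := (zero_lt_one.trans_le h1).ne'
  rw [expect_of_tick h0 ht]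
  calc _ ≤ ξ⁻¹ * (ξ ^ 2 * wp ξ (countedEvolveMany α) Prod.fst (fun _ _ => 1) p e) := by
        refine mul_le_mul_right (tick_wpNow_le (one_le_pow₀ h1) (fun r e => ?_) p e) _
        simp only [funext (tick_const (ξ := ξ) (κ := countedEvolveMany (n := n) α) _), tick_const]
        exact le_of_eq (by ring)
    _ = _ := by
        rw [← mul_assoc, sq, ← mul_assoc, ENNReal.inv_mul_cancel h0 ht, one_mul]

theorem tick_counted_fst (f : Prefs n → ℝ≥0∞) (e : CountedPrefs n) :
    tick ξ (countedEvolveMany α) (fun e' => f e'.1) e = tick ξ (evolveMany α) f e.1 := by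
  rw [tick, expect_countedEvolveMany_fst, tick]

theorem wp_counted_eq (F : R → Prefs n → ℝ≥0∞) (p : Prog n R) (e : CountedPrefs n) :
    wp ξ (countedEvolveMany α) Prod.fst (fun r e' => F r e'.1) p e =
      wp ξ (evolveMany α) id F p e.1 := by
  induction p generalizing e with
  | done r => rfl
  | ask q k ih =>
    simp only [wp, ih, id]
    rw [← tick_counted_fst]
    congr 1
    funext e'
    rw [← tick_counted_fst]
  | rand m k ih => simp only [wp, ih]

/-- The weighted number of remaining queries of the sorting process at time `t`. -/
noncomputable def sortLeft (ξ : ℝ≥0∞) (α t : ℕ) (g : TrackedState n) : ℝ≥0∞ :=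
  if Even t then waiting ξ α g.st.sorter g.env else ready ξ α g.st.sorter g.env

/-- The weighted number of remaining queries of the matching process at time `t`. -/
noncomputable def matchLeft (ξ : ℝ≥0∞) (α t : ℕ) (g : TrackedState n) : ℝ≥0∞ :=
  if Even t then ready ξ α g.st.matcher g.env else waiting ξ α g.st.matcher g.env

theorem one_le_sortLeft (hξ : 1 ≤ ξ) (t : ℕ) (g : TrackedState n) : 1 ≤ sortLeft ξ α t g := by
  unfold sortLeft
  split_ifs
  · exact one_le_waiting hξ _ _
  · exact one_le_ready hξ _ _

theorem one_le_matchLeft (hξ : 1 ≤ ξ) (t : ℕ) (g : TrackedState n) : 1 ≤ matchLeft ξ α t g := by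
  unfold matchLeft
  split_ifs
  · exact one_le_ready hξ _ _
  · exact one_le_waiting hξ _ _

theorem expect_turn_scaled_le {F : R → CountedPrefs n → ℝ≥0∞} {G : Prog n R → ℝ≥0∞}
    {p : Prog n R} {e : CountedPrefs n} {c b : ℝ≥0∞}
    (hdone : ∀ r, done r ∈ (turn e.1 p).support → G (done r) ≤ c * F r e + b)
    (hask : ∀ q k, ask q k ∈ (turn e.1 p).support → G (ask q k) ≤
      c * wp ξ (countedEvolveMany α) Prod.fst F (ask q k) e + b) :
    expect (turn e.1 p) G ≤ c * wpNow ξ (countedEvolveMany α) Prod.fst F p e + b := by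
  rw [wpNow, ← expect_mul_left]
  calc _ ≤ expect (turn e.1 p) fun p' =>
        c * wp ξ (countedEvolveMany α) Prod.fst F p' e + b := by
        refine expect_mono_support fun p' hp' => ?_
        have := isSettled_turn hp'
        cases p' with
        | done r => exact hdone r hp'
        | ask q k => exact hask q k hp'
        | rand m k => exact this.elim
    _ = _ := by rw [expect_add, expect_const]

/-- One step for a potential that is a coefficient times the weighted number of remaining queries of
the sorting process. -/
theorem expect_step_sortLeft_le (h1 : 1 ≤ ξ) (ht : ξ ≠ ⊤) {K t : ℕ} {g : TrackedState n}
    {c : TrackedState n → ℝ≥0∞} {b : ℝ≥0∞}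
    (hmatch : ∀ p ∈ (g.st.matcher.turn g.st.prefs).support,
      ∀ e ∈ (countedEvolveMany α g.env).support, c ((g.afterMatch K (t + 1) p).evolveTo e) ≤ c g)
    (hask : ∀ q k, ask q k ∈ (g.st.sorter.turn g.st.prefs).support →
      ∀ e ∈ (countedEvolveMany α g.env).support, c ((g.afterSort (ask q k)).evolveTo e) ≤ c g)
    (hdone : ∀ a, done a ∈ (g.st.sorter.turn g.st.prefs).support →
      ∃ d, (∀ e ∈ (countedEvolveMany α g.env).support,
        c ((g.afterSort (done a)).evolveTo e) ≤ d) ∧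
        d * (ξ * wp ξ (countedEvolveMany α) Prod.fst (fun _ _ => 1) (sequentialSort a) g.env) ≤
          ξ⁻¹ * c g + b) :
    expect (g.step K α (t + 1)) (fun g' => c g' * sortLeft ξ α (t + 1) g') ≤
      ξ⁻¹ * (c g * sortLeft ξ α t g) + b := by
  have h0 : ξ ≠ 0 := (zero_lt_one.trans_le h1).ne'
  by_cases hev : Even t
  · have hodd : ¬ Even (t + 1) := by simpa [Nat.even_add_one] using hev
    rw [expect_step_odd hodd]
    simp only [sortLeft, if_neg hodd, if_pos hev]
    refine le_trans (le_trans (expect_mono_support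
      (g := fun _ => ξ⁻¹ * (c g * waiting ξ α g.st.sorter g.env)) fun p hp => ?_)
      (expect_const _ _).le) le_self_add
    calc _ ≤ expect (countedEvolveMany α g.env) fun e => c g * ready ξ α g.st.sorter e := by
          refine expect_mono_support fun e he => mul_le_mul' (hmatch p hp e he) ?_
          cases p <;> exact le_rfl
      _ = _ := by rw [expect_mul_left, expect_ready h0 ht, mul_left_comm]
  · have heven : Even (t + 1) := by simpa [Nat.even_add_one] using hev
    rw [expect_step_even heven]
    simp only [sortLeft, if_pos heven, if_neg hev]
    rw [← mul_assoc, ready]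
    refine expect_turn_scaled_le (e := g.env) (fun a ha => ?_) (fun q k hqk => ?_)
    · obtain ⟨d, hd, hb⟩ := hdone a ha
      rw [mul_one]
      refine le_trans (le_trans (expect_mono_support (g := fun e =>
        d * waiting ξ α (sequentialSort a) e) fun e he => mul_le_mul' (hd e he) le_rfl) ?_) hb
      rw [expect_mul_left]
      exact mul_le_mul_right (expect_waiting_le h1 ht _ _) _
    · refine le_trans (le_trans (expect_mono_support (g := fun e =>
        c g * waiting ξ α (ask q k) e) fun e he => mul_le_mul' (hask q k hqk e he) le_rfl) ?_)
        le_self_add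
      rw [expect_mul_left, expect_waiting_ask h0 ht, ← mul_assoc, mul_comm (c g)]

/-- One step for a potential that is a coefficient times the weighted number of remaining queries of
the matching process. -/
theorem expect_step_matchLeft_le (h1 : 1 ≤ ξ) (ht : ξ ≠ ⊤) {K t : ℕ} {g : TrackedState n}
    {c : TrackedState n → ℝ≥0∞} {b : ℝ≥0∞}
    (hsort : ∀ p, ∀ e, c ((g.afterSort p).evolveTo e) ≤ c g)
    (hask : ∀ q k e, c ((g.afterMatch K (t + 1) (ask q k)).evolveTo e) ≤ c g)
    (hdone : ∃ d, (∀ M e, c ((g.afterMatch K (t + 1) (done M)).evolveTo e) ≤ d) ∧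
      d * (ξ * wp ξ (countedEvolveMany α) Prod.fst (fun _ _ => 1)
        (modifiedGS K g.st.approx) g.env) ≤ b) :
    expect (g.step K α (t + 1)) (fun g' => c g' * matchLeft ξ α (t + 1) g') ≤
      ξ⁻¹ * (c g * matchLeft ξ α t g) + b := by
  have h0 : ξ ≠ 0 := (zero_lt_one.trans_le h1).ne'
  by_cases hev : Even t
  · have hodd : ¬ Even (t + 1) := by simpa [Nat.even_add_one] using hev
    rw [expect_step_odd hodd]
    simp only [matchLeft, if_neg hodd, if_pos hev]
    rw [← mul_assoc, ready]
    refine expect_turn_scaled_le (e := g.env) (fun M hM => ?_) (fun q k hqk => ?_)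
    · obtain ⟨d, hd, hb⟩ := hdone
      refine le_trans (le_trans (le_trans (expect_mono (g := fun e =>
        d * waiting ξ α (modifiedGS K g.st.approx) e) fun e => mul_le_mul' (hd M e) le_rfl) ?_) hb)
        le_add_self
      rw [expect_mul_left]
      exact mul_le_mul_right (expect_waiting_le h1 ht _ _) _
    · refine le_trans (le_trans (expect_mono (g := fun e =>
        c g * waiting ξ α (ask q k) e) fun e => mul_le_mul' (hask q k e) le_rfl) ?_)
        le_self_add
      rw [expect_mul_left, expect_waiting_ask h0 ht, ← mul_assoc, mul_comm (c g)]
  · have heven : Even (t + 1) := by simpa [Nat.even_add_one] using hev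
    rw [expect_step_even heven]
    simp only [matchLeft, if_pos heven, if_neg hev]
    refine le_trans (le_trans (expect_mono
      (g := fun _ => ξ⁻¹ * (c g * waiting ξ α g.st.matcher g.env)) fun p => ?_)
      (expect_const _ _).le) le_self_add
    calc _ ≤ expect (countedEvolveMany α g.env) fun e => c g * ready ξ α g.st.matcher e := by
          refine expect_mono fun e => mul_le_mul' (hsort p e) ?_
          cases p <;> exact le_rfl
      _ = _ := by rw [expect_mul_left, expect_ready h0 ht, mul_left_comm]

end Remaining

end TrackedState

/-! ## Symmetry of the joint law of the lists and of the approximations -/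

theorem partition_relabel (σ : Fin n → Equiv.Perm (Fin n)) (x p : Fin n) (l : List (Fin n)) :
    relabelProg σ (Prod.map (List.map (σ x)) (List.map (σ x))) (partition (Sum.inl x) p l) =
      partition (Sum.inl x) (σ x p) (l.map (σ x)) := by
  induction l with
  | nil => rfl
  | cons v l ih =>
    rw [List.map_cons, partition_cons, partition_cons, relabelProg]
    congr 1
    funext b
    rw [← ih]
    refine relabelProg_bind σ _ _ _ _ _ fun q => ?_
    cases b <;> rfl

theorem quicksort_relabel (σ : Fin n → Equiv.Perm (Fin n)) (x : Fin n) (d : ℕ)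
    (l : List (Fin n)) :
    relabelProg σ (List.map (σ x)) (quicksort (Sum.inl x) d l) =
      quicksort (Sum.inl x) d (l.map (σ x)) := by
  induction d generalizing l with
  | zero => rfl
  | succ d ih =>
    cases l with
    | nil => rfl
    | cons a l =>
      have hrand : ∀ (m m' : ℕ) (h : m = m') (k : Fin (m + 1) → Prog n (List (Fin n)))
          (k' : Fin (m' + 1) → Prog n (List (Fin n))),
          (∀ i, k i = k' (i.cast (by rw [h]))) → rand m k = rand m' k' := by
        rintro m _ rfl k k' hk
        exact congrArg _ (funext hk)
      rw [List.map_cons, quicksort_cons, quicksort_cons, relabelProg]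
      refine hrand _ _ (by simp) _ _ fun i => ?_
      have hget : (σ x a :: l.map (σ x)).get (i.cast (by simp)) = σ x ((a :: l).get i) := by
        simp only [List.get_eq_getElem, ← List.map_cons, List.getElem_map, Fin.val_cast]
      rw [hget, Fin.val_cast, ← List.map_cons, List.eraseIdx_map, ← partition_relabel]
      refine relabelProg_bind σ _ _ _ _ _ fun q => ?_
      rw [Prod.map_fst, Prod.map_snd, ← ih, ← ih]
      refine relabelProg_bind σ _ _ _ _ _ fun lo => ?_
      refine relabelProg_bind σ _ _ _ _ _ fun hi => ?_
      simp [relabelProg]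

theorem sequentialSort_relabel (σ : Fin n → Equiv.Perm (Fin n)) (a : Approx n) :
    relabelProg σ (relabelApprox σ) (sequentialSort a) = sequentialSort (relabelApprox σ a) := by
  rw [sequentialSort_eq, sequentialSort_eq]
  generalize List.finRange n = L
  induction L generalizing a with
  | nil => rfl
  | cons x L ih =>
    rw [sortLoop, sortLoop]
    change _ = (quicksort (Sum.inl x) n ((a x).map (σ x))).bind _
    rw [← quicksort_relabel]
    refine relabelProg_bind σ _ _ _ _ _ fun l => ?_
    rw [ih]
    congr 1
    funext x'
    by_cases h : x' = x
    · subst h; simp [relabelApprox]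
    · simp [relabelApprox, h]

section Turn

variable {R R' : Type}

theorem settle_relabel (σ : Fin n → Equiv.Perm (Fin n)) (f : R → R') (p : Prog n R) :
    settle (relabelProg σ f p) = (settle p).map (relabelProg σ f) := by
  induction p with
  | done r => simp [settle, relabelProg, PMF.pure_map]
  | ask q k ih => simp [settle, relabelProg, PMF.pure_map]
  | rand m k ih => simp only [settle, relabelProg, PMF.map_bind, ih]

theorem turn_relabel (σ : Fin n → Equiv.Perm (Fin n)) (f : R → R') (π : Prefs n)
    (p : Prog n R) :
    turn (relabelPrefs σ π) (relabelProg σ f p) = (turn π p).map (relabelProg σ f) := by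
  unfold turn
  rw [settle_relabel, PMF.bind_map, PMF.map_bind]
  congr 1
  funext p'
  cases p' with
  | done r => exact (PMF.pure_map _ _).symm
  | ask q k =>
    simp only [Function.comp_apply, relabelProg, relabelQuery_answer]
    exact settle_relabel σ f _
  | rand m k => exact (PMF.pure_map _ _).symm

end Turn

/-- The approximations and the remaining program of the sorting process after its time-step. -/
noncomputable def sortUpdate (a : Approx n) : Prog n (Approx n) → Approx n × Prog n (Approx n)
  | done b => (b, sequentialSort b)
  | p => (a, p)

theorem sortUpdate_relabel (σ : Fin n → Equiv.Perm (Fin n)) (a : Approx n)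
    (p : Prog n (Approx n)) :
    sortUpdate (relabelApprox σ a) (relabelProg σ (relabelApprox σ) p) =
      Prod.map (relabelApprox σ) (relabelProg σ (relabelApprox σ)) (sortUpdate a p) := by
  cases p with
  | done b => exact Prod.ext rfl (sequentialSort_relabel σ b).symm
  | ask q k => rfl
  | rand m k => rfl

theorem expect_timeStep (K α t : ℕ) (s : State n)
    (f : Prefs n → Approx n × Prog n (Approx n) → ℝ≥0∞) :
    expect (timeStep K α t s) (fun s' => f s'.prefs (s'.approx, s'.sorter)) =
      if Even t then expect (turn s.prefs s.sorter) fun p =>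
        expect (evolveMany α s.prefs) fun π => f π (sortUpdate s.approx p)
      else expect (evolveMany α s.prefs) fun π => f π (s.approx, s.sorter) := by
  unfold timeStep
  rw [expect_bind]
  simp only [expect_map]
  split_ifs
  · rw [sortTurn, expect_map]
    congr 1
    funext p
    cases p <;> rfl
  · rw [matchTurn, expect_map]
    trans expect (turn s.prefs s.matcher) fun _ =>
      expect (evolveMany α s.prefs) fun π => f π (s.approx, s.sorter)
    · congr 1
      funext p
      cases p <;> rfl
    · exact expect_const _ _

theorem relabelPrefs_one (π : Prefs n) : relabelPrefs 1 π = π := by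
  funext z
  cases z <;> rfl

/-- Renaming the elements of the lists, as a permutation of the set of all lists. -/
def relabelEquiv (σ : Fin n → Equiv.Perm (Fin n)) : Prefs n ≃ Prefs n where
  toFun := relabelPrefs σ
  invFun := relabelPrefs σ⁻¹
  left_inv π := by rw [← relabelPrefs_mul, inv_mul_cancel, relabelPrefs_one]
  right_inv π := by rw [← relabelPrefs_mul, mul_inv_cancel, relabelPrefs_one]

theorem expect_uniform_equiv {Ω : Type*} [Fintype Ω] [Nonempty Ω] (e : Ω ≃ Ω)
    (f : Ω → ℝ≥0∞) :
    expect (PMF.uniformOfFintype Ω) (fun ω => f (e ω)) = expect (PMF.uniformOfFintype Ω) f := by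
  rw [expect_uniform, expect_uniform, e.sum_comp]

theorem expect_initial (K : ℕ) (f : Prefs n → Approx n → Prog n (Approx n) →
    Prog n (Assignment n) → ℝ≥0∞) :
    expect (initial n K) (fun s => f s.prefs s.approx s.sorter s.matcher) =
      expect (PMF.uniformOfFintype (Fin n → Equiv.Perm (Fin n))) fun σ =>
        expect (PMF.uniformOfFintype (Prefs n)) fun π =>
          f π (fun x => List.ofFn (σ x)) (sequentialSort fun x => List.ofFn (σ x))
            (modifiedGS K fun x => List.ofFn (σ x)) := by
  rw [initial, expect_bind]
  simp only [expect_map, expect_uniform]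
  rw [← Finset.mul_sum, ← Finset.mul_sum, Finset.sum_comm, mul_left_comm]

/-- Initially the lists and the approximations are uniform and independent, hence invariant, and
evolution and sorting commute with renaming. The matching process is left out since it influences
neither the lists nor the sorter. -/
theorem expect_law_relabel (σ : Fin n → Equiv.Perm (Fin n)) (K α t : ℕ)
    (f : Prefs n → Approx n × Prog n (Approx n) → ℝ≥0∞) :
    expect (law n K α t) (fun s => f (relabelPrefs σ s.prefs)
        (Prod.map (relabelApprox σ) (relabelProg σ (relabelApprox σ)) (s.approx, s.sorter))) =
      expect (law n K α t) fun s => f s.prefs (s.approx, s.sorter) := by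
  induction t generalizing f with
  | zero =>
    rw [law, expect_initial K fun π a p _ => f π (a, p), expect_initial K fun π a p _ =>
      f (relabelPrefs σ π) (Prod.map (relabelApprox σ) (relabelProg σ (relabelApprox σ)) (a, p))]
    simp only [Prod.map_apply, sequentialSort_relabel]
    conv_rhs => rw [← expect_uniform_equiv (Equiv.mulLeft σ)]
    congr 1
    funext ρ
    conv_rhs => rw [← expect_uniform_equiv (relabelEquiv σ)]
    have h : relabelApprox σ (fun x => List.ofFn (ρ x)) =
        fun x => List.ofFn ((Equiv.mulLeft σ ρ) x) := by
      funext x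
      simp [relabelApprox, List.map_ofFn, Function.comp_def]
    rw [h]
    rfl
  | succ t ih =>
    rw [law, expect_bind, expect_bind]
    simp only [expect_timeStep K α (t + 1) _ f, expect_timeStep K α (t + 1) _ fun π q =>
      f (relabelPrefs σ π) (Prod.map (relabelApprox σ) (relabelProg σ (relabelApprox σ)) q)]
    rw [← ih fun π q => if Even (t + 1) then expect (turn π q.2) fun p =>
        expect (evolveMany α π) fun π => f π (sortUpdate q.1 p)
      else expect (evolveMany α π) fun π => f π (q.1, q.2)]
    simp only [Prod.map_apply, evolveMany_relabel, expect_map, turn_relabel, sortUpdate_relabel]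

/-- By invariance the expectation equals its average over all renamings, and the coupon bound then
applies to each reachable state separately. Nothing has to be known about the correlation between
lists and approximations. -/
theorem expect_law_wp_modifiedGS_le {K : ℕ} (hK : 1 ≤ K) {ξ : ℝ≥0∞} (hξ : 1 ≤ ξ)
    (hθ : 2 * n * (ξ ^ 2) ^ K ≤ 2 * n + 1) (α t : ℕ) :
    expect (law n K α t) (fun s => wp ξ (evolveMany α) id (fun _ _ => 1)
      (modifiedGS K s.approx) s.prefs) ≤ (n + 1 : ℕ) := by
  set N : ℝ≥0∞ := (Fintype.card (Fin n → Equiv.Perm (Fin n)) : ℝ≥0∞) with hN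
  have hN0 : N ≠ 0 := by rw [hN]; exact Nat.cast_ne_zero.2 Fintype.card_ne_zero
  have hNt : N ≠ ⊤ := ENNReal.natCast_ne_top _
  rw [← ENNReal.mul_le_mul_iff_right hN0 hNt]
  have h : ∀ σ, expect (law n K α t) (fun s => wp ξ (evolveMany α) id (fun _ _ => 1)
      (modifiedGS K s.approx) s.prefs) =
      expect (law n K α t) (fun s => wp ξ (evolveMany α) id (fun _ _ => 1)
        (modifiedGS K (relabelApprox σ s.approx)) (relabelPrefs σ s.prefs)) := fun σ =>
    (expect_law_relabel σ K α t fun π q => wp ξ (evolveMany α) id (fun _ _ => 1)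
      (modifiedGS K q.1) π).symm
  calc N * _ = ∑ σ : Fin n → Equiv.Perm (Fin n), expect (law n K α t) (fun s =>
        wp ξ (evolveMany α) id (fun _ _ => 1) (modifiedGS K s.approx) s.prefs) := by
        rw [Finset.sum_const, nsmul_eq_mul, Finset.card_univ]
    _ ≤ expect (law n K α t) fun _ => N * (n + 1 : ℕ) := by
        rw [Finset.sum_congr rfl fun σ _ => h σ, ← expect_sum]
        exact expect_mono_support fun s hs =>
          sum_wp_modifiedGS_le hξ hK hθ _ _ (sound_law hK α t hs).approx.mem
    _ = _ := expect_const _ _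

/-! ## Stationarity of the uniform lists -/

theorem swapAt_swapAt (π : Prefs n) (z : Agent n) (i : Fin (n - 1)) :
    swapAt (swapAt π z i) z i = π := by
  funext z'
  by_cases h : z' = z
  · subst h
    ext u
    simp [swapAt]
  · simp [swapAt, h]

/-- Each event is an involution on the set of all lists and so preserves the uniform law. -/
theorem expect_uniform_evolve (f : Prefs n → ℝ≥0∞) :
    expect (PMF.uniformOfFintype (Prefs n)) (fun π => expect (evolve π) f) =
      expect (PMF.uniformOfFintype (Prefs n)) f := by
  unfold evolve
  split_ifs with h
  · have : Nonempty (Agent n × Fin (n - 1)) := ⟨(Sum.inl ⟨0, by omega⟩, ⟨0, by omega⟩)⟩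
    have hcomm : ∀ g : Agent n × Fin (n - 1) → Prefs n → ℝ≥0∞,
        expect (PMF.uniformOfFintype (Prefs n)) (fun π =>
          expect (PMF.uniformOfFintype (Agent n × Fin (n - 1))) fun ev => g ev π) =
        expect (PMF.uniformOfFintype (Agent n × Fin (n - 1))) fun ev =>
          expect (PMF.uniformOfFintype (Prefs n)) fun π => g ev π := by
      intro g
      simp only [expect_uniform]
      rw [← Finset.mul_sum, ← Finset.mul_sum, Finset.sum_comm, mul_left_comm]
    simp only [expect_map]
    rw [hcomm fun ev π => f (swapAt π ev.1 ev.2)]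
    trans expect (PMF.uniformOfFintype (Agent n × Fin (n - 1))) fun _ =>
      expect (PMF.uniformOfFintype (Prefs n)) f
    · congr 1
      funext ev
      exact expect_uniform_equiv ⟨fun π => swapAt π ev.1 ev.2, fun π => swapAt π ev.1 ev.2,
        fun π => swapAt_swapAt π _ _, fun π => swapAt_swapAt π _ _⟩ f
    · exact expect_const _ _
  · simp only [expect_pure]

theorem expect_uniform_evolveMany (α : ℕ) (f : Prefs n → ℝ≥0∞) :
    expect (PMF.uniformOfFintype (Prefs n)) (fun π => expect (evolveMany α π) f) =
      expect (PMF.uniformOfFintype (Prefs n)) f := by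
  induction α with
  | zero => simp only [evolveMany, expect_pure]
  | succ α ih =>
    simp only [evolveMany, expect_bind]
    rw [expect_uniform_evolve fun π => expect (evolveMany α π) f, ih]

theorem expect_uniform_tick (ξ : ℝ≥0∞) (α : ℕ) (f : Prefs n → ℝ≥0∞) :
    expect (PMF.uniformOfFintype (Prefs n)) (tick ξ (evolveMany α) f) =
      ξ * expect (PMF.uniformOfFintype (Prefs n)) f := by
  unfold tick
  rw [expect_mul_left, expect_uniform_evolveMany]

/-- From uniform lists, two preliminary blocks of evolution contribute exactly the factor `ξ ^ 2`,
so they can be inserted for free before comparing with `wp`. -/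
theorem expect_uniform_wpNow_le {R : Type} {ξ : ℝ≥0∞} (h1 : 1 ≤ ξ) (ht : ξ ≠ ⊤) (α : ℕ)
    (p : Prog n R) :
    expect (PMF.uniformOfFintype (Prefs n)) (wpNow ξ (evolveMany α) id (fun _ _ => 1) p) ≤
      expect (PMF.uniformOfFintype (Prefs n)) (wp ξ (evolveMany α) id (fun _ _ => 1) p) := by
  have h0 : ξ ^ 2 ≠ 0 := pow_ne_zero _ (zero_lt_one.trans_le h1).ne'
  rw [← ENNReal.mul_le_mul_iff_right h0 (ENNReal.pow_ne_top ht), sq, mul_assoc,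
    ← expect_uniform_tick ξ α, ← expect_uniform_tick ξ α, ← sq, ← expect_mul_left]
  refine expect_mono fun π => tick_wpNow_le (one_le_pow₀ h1) (fun r e => ?_) p π
  simp only [funext (tick_const (ξ := ξ) (κ := evolveMany (n := n) α) _), tick_const]
  exact le_of_eq (by ring)

/-! ## Probabilities -/

open Classical in
/-- The probability of an event. -/
noncomputable def prob {Ω : Type*} (p : PMF Ω) (P : Ω → Prop) : ℝ≥0∞ :=
  expect p fun a => if P a then 1 else 0

section Prob

variable {Ω Ω' : Type*}

theorem prob_mono_support {p : PMF Ω} {P Q : Ω → Prop} (h : ∀ a ∈ p.support, P a → Q a) :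
    prob p P ≤ prob p Q := by
  refine expect_mono_support fun a ha => ?_
  split_ifs with h1 h2
  · exact le_rfl
  · exact absurd (h a ha h1) h2
  · exact zero_le_one
  · exact le_rfl

theorem prob_or_le (p : PMF Ω) (P Q : Ω → Prop) :
    prob p (fun a => P a ∨ Q a) ≤ prob p P + prob p Q := by
  unfold prob
  rw [← expect_add]
  refine expect_mono fun a => ?_
  by_cases h1 : P a <;> by_cases h2 : Q a <;> simp [h1, h2]

theorem prob_map (p : PMF Ω) (g : Ω → Ω') (P : Ω' → Prop) :
    prob (p.map g) P = prob p fun a => P (g a) := expect_map _ _ _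

theorem prob_bind (p : PMF Ω) (g : Ω → PMF Ω') (P : Ω' → Prop) :
    prob (p.bind g) P = expect p fun a => prob (g a) P := expect_bind _ _ _

theorem prob_le_one (p : PMF Ω) (P : Ω → Prop) : prob p P ≤ 1 := by
  calc prob p P ≤ expect p fun _ => 1 := by
        refine expect_mono fun a => ?_
        split_ifs <;> simp
    _ = 1 := expect_const _ _

/-- Markov's inequality. -/
theorem mul_prob_le {p : PMF Ω} {P : Ω → Prop} {f : Ω → ℝ≥0∞} {c : ℝ≥0∞}
    (h : ∀ a ∈ p.support, P a → c ≤ f a) : c * prob p P ≤ expect p f := by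
  classical
  rw [prob]
  convert expect_indicator_le h

end Prob

/-! ## The weighted numbers of remaining queries in the long run -/

theorem one_le_sortWeight (n : ℕ) : 1 ≤ sortWeight n := by
  rw [sortWeight, ← ENNReal.ofReal_one]
  exact ENNReal.ofReal_le_ofReal (by simp)

theorem sortWeight_ne_top (n : ℕ) : sortWeight n ≠ ⊤ := ENNReal.ofReal_ne_top

namespace TrackedState

section Remaining

variable {R : Type} {ξ : ℝ≥0∞} {α : ℕ}

theorem wp_counted_one (p : Prog n R) (e : CountedPrefs n) :
    wp ξ (countedEvolveMany α) Prod.fst (fun _ _ => 1) p e =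
      wp ξ (evolveMany α) id (fun _ _ => 1) p e.1 := wp_counted_eq (fun _ _ => 1) p e

theorem ready_eq (p : Prog n R) (e : CountedPrefs n) :
    ready ξ α p e = wpNow ξ (evolveMany α) id (fun _ _ => 1) p e.1 := by
  unfold ready wpNow
  simp only [wp_counted_one, id]

theorem waiting_eq (p : Prog n R) (e : CountedPrefs n) :
    waiting ξ α p e = tick ξ (evolveMany α) (wpNow ξ (evolveMany α) id (fun _ _ => 1) p) e.1 := by
  unfold waiting
  rw [← tick_counted_fst]
  congr 1
  funext e'
  exact ready_eq p e'

theorem sortLeft_start (t t₀ : ℕ) (g : TrackedState n) :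
    sortLeft ξ α t (start t₀ g.st) = sortLeft ξ α t g := by
  simp only [sortLeft, ready_eq, waiting_eq]; rfl

theorem matchLeft_start (t t₀ : ℕ) (g : TrackedState n) :
    matchLeft ξ α t (start t₀ g.st) = matchLeft ξ α t g := by
  simp only [matchLeft, ready_eq, waiting_eq]; rfl

end Remaining

theorem expect_law_st (K α t k : ℕ) (f : State n → ℝ≥0∞) :
    expect (law n K α t k) (fun g => f g.st) = expect (EvolvingMatching.law n K α (t + k)) f := by
  rw [← law_map_st, expect_map]

/-! ### Iteration of one-step bounds. -/

section Chain

variable {K α t : ℕ} {μ : PMF (TrackedState n)} {Φ : ℕ → TrackedState n → ℝ≥0∞} {ζ b M : ℝ≥0∞}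

theorem expect_run_succ_le {b : TrackedState n → ℝ≥0∞} {k : ℕ}
    (h : ∀ g ∈ (run K α t μ k).support,
      expect (g.step K α (t + k + 1)) (Φ (t + k + 1)) ≤ ζ * Φ (t + k) g + b g) :
    expect (run K α t μ (k + 1)) (Φ (t + (k + 1))) ≤
      ζ * expect (run K α t μ k) (Φ (t + k)) + expect (run K α t μ k) b := by
  rw [run, expect_bind, ← expect_mul_left, ← expect_add]
  exact expect_mono_support h

theorem expect_run_le_pow (h : ∀ k, ∀ g ∈ (run K α t μ k).support,
      expect (g.step K α (t + k + 1)) (Φ (t + k + 1)) ≤ ζ * Φ (t + k) g + 0) (k : ℕ) :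
    expect (run K α t μ k) (Φ (t + k)) ≤ ζ ^ k * expect μ (Φ t) := by
  induction k with
  | zero => simp [run]
  | succ k ih =>
    refine (expect_run_succ_le (h k)).trans ?_
    rw [expect_const, add_zero, pow_succ', mul_assoc]
    exact mul_le_mul_right ih _

end Chain

/-- The weighted number of remaining queries of the sorting process is bounded in expectation. -/
theorem expect_law_sortLeft_le {K : ℕ} (hK : 1 ≤ K) {α : ℕ} (hα : 64 * α + 1 ≤ n) {M : ℝ≥0∞}
    (hM : (sortWeight n)⁻¹ * M + sortWeight n * ((n : ℝ≥0∞) ^ 3) ^ n ≤ M) (t k : ℕ) :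
    expect (law n K α t k) (sortLeft (sortWeight n) α (t + k)) ≤ M := by
  have h0 : ∀ k, expect (law n K α 0 k) (sortLeft (sortWeight n) α (0 + k)) ≤ M := by
    intro k
    induction k with
    | zero =>
      refine le_trans ?_ (le_add_self.trans hM)
      simp only [law, run, expect_map, EvolvingMatching.law, add_zero, sortLeft, Even.zero,
        if_true, waiting_eq]
      refine (expect_initial K fun π _ p _ => tick (sortWeight n) (evolveMany α)
        (wpNow (sortWeight n) (evolveMany α) id (fun _ _ => 1) p) π).trans_le ?_
      refine le_trans (expect_mono (g := fun _ => sortWeight n * ((n : ℝ≥0∞) ^ 3) ^ n)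
        fun σ => ?_) (expect_const _ _).le
      rw [expect_uniform_tick]
      refine mul_le_mul_right ((expect_uniform_wpNow_le (one_le_sortWeight n)
        (sortWeight_ne_top n) α _).trans ?_) _
      exact (expect_mono fun π => wp_sequentialSort_le hα (isPermApprox_ofFn σ) π).trans
        (expect_const _ _).le
    | succ k ih =>
      refine le_trans (expect_run_succ_le (ζ := (sortWeight n)⁻¹)
        (b := fun _ => sortWeight n * ((n : ℝ≥0∞) ^ 3) ^ n) fun g hg => ?_) (le_trans ?_ hM)
      · have hs := sound_law hK hg
        have := expect_step_sortLeft_le (K := K) (t := 0 + k) (g := g) (α := α)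
          (one_le_sortWeight n) (sortWeight_ne_top n) (c := fun _ => 1)
          (b := sortWeight n * ((n : ℝ≥0∞) ^ 3) ^ n) (fun _ _ _ _ => le_rfl)
          (fun _ _ _ _ _ => le_rfl) fun a ha => ⟨1, fun _ _ => le_rfl, by
            rw [one_mul, wp_counted_one]
            exact (mul_le_mul_right (wp_sequentialSort_le hα (hs.st.sorter.turn ha) _) _).trans
              le_add_self⟩
        simpa using this
      · rw [expect_const]
        gcongr
        exact ih
  -- The quantity does not depend on the bookkeeping, so the bound obtained with tracking from time
  -- 0 holds for every starting time of the tracking.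
  have h := h0 (t + k)
  have hst : ∀ τ, sortLeft (sortWeight n) α τ = fun g : TrackedState n => sortLeft (sortWeight n) α τ (start 0 g.st) :=
    fun τ => funext fun g => (sortLeft_start τ 0 g).symm
  rw [hst] at h ⊢
  rw [expect_law_st K α 0 (t + k) fun s => sortLeft _ α (0 + (t + k)) (start 0 s)] at h
  rw [expect_law_st K α t k fun s => sortLeft _ α (t + k) (start 0 s)]
  simpa using h

/-- The weighted number of remaining queries of the matching process is bounded in expectation. -/
theorem expect_law_matchLeft_le {K : ℕ} (hK : 1 ≤ K) {ξ : ℝ≥0∞} (hξ : 1 ≤ ξ) (hξt : ξ ≠ ⊤)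
    (hθ : 2 * n * (ξ ^ 2) ^ K ≤ 2 * n + 1) {α : ℕ} {M : ℝ≥0∞}
    (hM : ξ⁻¹ * M + ξ * (n + 1 : ℕ) ≤ M) (t k : ℕ) :
    expect (law n K α t k) (matchLeft ξ α (t + k)) ≤ M := by
  have h0 : ∀ k, expect (law n K α 0 k) (matchLeft ξ α (0 + k)) ≤ M := by
    intro k
    induction k with
    | zero =>
      refine le_trans ?_ (le_add_self.trans hM)
      refine le_trans ?_ (le_mul_of_one_le_left' hξ)
      refine le_trans ?_ (expect_law_wp_modifiedGS_le hK hξ hθ α 0)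
      simp only [law, run, expect_map, EvolvingMatching.law, add_zero, matchLeft, Even.zero,
        if_true, ready_eq]
      refine (expect_initial K fun π _ _ p =>
        wpNow ξ (evolveMany α) id (fun _ _ => 1) p π).trans_le ?_
      refine le_trans ?_ (expect_initial K fun π a _ _ =>
        wp ξ (evolveMany α) id (fun _ _ => 1) (modifiedGS K a) π).ge
      exact expect_mono fun σ => expect_uniform_wpNow_le hξ hξt α _
    | succ k ih =>
      refine le_trans (expect_run_succ_le (ζ := ξ⁻¹)
        (b := fun g => ξ * wp ξ (evolveMany α) id (fun _ _ => 1)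
          (modifiedGS K g.st.approx) g.st.prefs) fun g hg => ?_) (le_trans ?_ hM)
      · have := expect_step_matchLeft_le (K := K) (t := 0 + k) (g := g) (α := α)
          hξ hξt (c := fun _ => 1)
          (b := ξ * wp ξ (evolveMany α) id (fun _ _ => 1)
          (modifiedGS K g.st.approx) g.st.prefs) (fun _ _ => le_rfl)
          (fun _ _ _ => le_rfl) ⟨1, fun _ _ => le_rfl, by
            rw [one_mul, wp_counted_one]; rfl⟩
        simpa using this
      · rw [expect_mul_left]
        refine add_le_add (mul_le_mul_right ih _) (mul_le_mul_right ?_ _)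
        refine (expect_law_st K α 0 k fun s => wp ξ (evolveMany α) id (fun _ _ => 1)
          (modifiedGS K s.approx) s.prefs).trans_le ?_
        exact expect_law_wp_modifiedGS_le hK hξ hθ α _
  have h := h0 (t + k)
  have hst : ∀ τ, matchLeft ξ α τ = fun g : TrackedState n => matchLeft ξ α τ (start 0 g.st) :=
    fun τ => funext fun g => (matchLeft_start τ 0 g).symm
  rw [hst] at h ⊢
  rw [expect_law_st K α 0 (t + k) fun s => matchLeft _ α (0 + (t + k)) (start 0 s)] at h
  rw [expect_law_st K α t k fun s => matchLeft _ α (t + k) (start 0 s)]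
  simpa using h

/-! ## Completion of the sorting runs -/

/-- The present sorting run can be trusted with respect to the reference lists. -/
def SafeSorter (g : TrackedState n) : Prop :=
  g.st.sorter.Safe g.ref (Accurate g.ref) (radius g.cnt)

/-- The present approximations are accurate with respect to the reference lists. -/
def AccurateApprox (g : TrackedState n) : Prop := Accurate g.ref g.st.approx (radius g.cnt)

theorem cnt_le_of_mem_support {α : ℕ} {g : TrackedState n} {e : CountedPrefs n}
    (he : e ∈ (countedEvolveMany α g.env).support) : g.cnt ≤ e.2 :=
  (eventStable_le g.cnt).countedEvolveMany (e := g.env) le_rfl he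

theorem safe_accurate_mono {π₀ : Prefs n} {p : Prog n (Approx n)} {ρ ρ' : Fin n → ℕ}
    (h : p.Safe π₀ (Accurate π₀) ρ) (hρ : ρ ≤ ρ') : p.Safe π₀ (Accurate π₀) ρ' :=
  Prog.Safe.mono (Q := Accurate π₀) (fun _ _ _ hρ h => Accurate.mono h hρ) h hρ

section Transfer

variable {α K t : ℕ} {g : TrackedState n} {e : CountedPrefs n}

theorem SafeSorter.afterMatch (he : e ∈ (countedEvolveMany α g.env).support)
    (p : Prog n (Assignment n)) (h : g.SafeSorter) :
    ((g.afterMatch K t p).evolveTo e).SafeSorter := by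
  have := safe_accurate_mono h (radius_mono (cnt_le_of_mem_support he))
  cases p <;> exact this

theorem AccurateApprox.afterMatch (he : e ∈ (countedEvolveMany α g.env).support)
    (p : Prog n (Assignment n)) (h : g.AccurateApprox) :
    ((g.afterMatch K t p).evolveTo e).AccurateApprox := by
  have := Accurate.mono h (radius_mono (cnt_le_of_mem_support he))
  cases p <;> exact this

theorem SafeSorter.of_mem_turn (hg : Tracks g.ref g.env) (he : e ∈ (countedEvolveMany α g.env).support)
    {p : Prog n (Approx n)} (hp : p ∈ (turn g.st.prefs g.st.sorter).support)
    (h : g.SafeSorter) : p.Safe g.ref (Accurate g.ref) (radius e.2) :=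
  safe_accurate_mono (Prog.Safe.turn (e := g.env) hg h hp)
    (radius_mono (cnt_le_of_mem_support he))

theorem safeSorter_done (a : Approx n) (e : CountedPrefs n) :
    ((g.afterSort (done a)).evolveTo e).SafeSorter :=
  safe_sequentialSort _ _ _

theorem SafeSorter.afterSort (hg : Tracks g.ref g.env)
    (he : e ∈ (countedEvolveMany α g.env).support)
    {p : Prog n (Approx n)} (hp : p ∈ (turn g.st.prefs g.st.sorter).support)
    (h : g.SafeSorter) : ((g.afterSort p).evolveTo e).SafeSorter := by
  have := h.of_mem_turn hg he hp
  cases p with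
  | done a => exact safeSorter_done a e
  | ask q k => exact this
  | rand m k => exact this

theorem AccurateApprox.afterSort (hg : Tracks g.ref g.env)
    (he : e ∈ (countedEvolveMany α g.env).support)
    {p : Prog n (Approx n)} (hp : p ∈ (turn g.st.prefs g.st.sorter).support)
    (hs : g.SafeSorter) (h : g.AccurateApprox) :
    ((g.afterSort p).evolveTo e).AccurateApprox := by
  have := hs.of_mem_turn hg he hp
  have h' := Accurate.mono h (radius_mono (cnt_le_of_mem_support he))
  cases p with
  | done a => exact this
  | ask q k => exact h'
  | rand m k => exact h'

end Transfer

/-- Both the approximations and the present sorting run can be trusted. -/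
def Good (g : TrackedState n) : Prop := g.SafeSorter ∧ g.AccurateApprox

theorem Good.step {K α t : ℕ} {g g' : TrackedState n} (h : g.Good) (hg : Tracks g.ref g.env)
    (h' : g' ∈ (g.step K α t).support) : g'.Good := by
  obtain ⟨e, he, ⟨-, p, hp, rfl⟩ | ⟨-, p, hp, rfl⟩⟩ := mem_support_step h'
  · exact ⟨h.1.afterSort hg he hp, h.2.afterSort hg he hp h.1⟩
  · exact ⟨h.1.afterMatch he p, h.2.afterMatch he p⟩

open Classical in
/-- The weight of the sorting runs that have to be completed before the state is good. -/
noncomputable def sortDebt (D : ℝ≥0∞) (g : TrackedState n) : ℝ≥0∞ :=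
  if g.SafeSorter then (if g.AccurateApprox then 0 else 1) else D

theorem sortDebt_le {D : ℝ≥0∞} (hD : 1 ≤ D) {g g' : TrackedState n}
    (h1 : g.SafeSorter → g'.SafeSorter)
    (h2 : g.SafeSorter → g.AccurateApprox → g'.AccurateApprox) :
    sortDebt D g' ≤ sortDebt D g := by
  unfold sortDebt
  by_cases hs : g.SafeSorter
  · by_cases ha : g.AccurateApprox
    · simp [hs, ha, h1 hs, h2 hs ha]
    · simp only [hs, h1 hs, ha, if_false, if_true]
      split_ifs <;> simp
  · simp only [hs, if_false]
    split_ifs <;> simp [hD]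

/-- The probability that the state is not good after some time. -/
theorem prob_not_good_le {K : ℕ} (hK : 1 ≤ K) {α : ℕ} (hα : 64 * α + 1 ≤ n) {M : ℝ≥0∞}
    (hM : (sortWeight n)⁻¹ * M + sortWeight n * ((n : ℝ≥0∞) ^ 3) ^ n ≤ M) (t k : ℕ) :
    prob (law n K α t k) (fun g => ¬ g.Good) ≤
      (sortWeight n)⁻¹ ^ k * (sortWeight n ^ 2 * ((n : ℝ≥0∞) ^ 3) ^ n * M) := by
  -- When a run that cannot be trusted ends, a trusted one of debt 1 begins; `D` is just large
  -- enough for the decrease of the debt to pay for the weighted length of that new run.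
  set D := sortWeight n ^ 2 * ((n : ℝ≥0∞) ^ 3) ^ n with hDdef
  have h1 := one_le_sortWeight n
  have h0 : sortWeight n ≠ 0 := (zero_lt_one.trans_le h1).ne'
  have hn1 : (1 : ℝ≥0∞) ≤ n := by exact_mod_cast (by omega : 1 ≤ n)
  have hD : 1 ≤ D := one_le_mul (one_le_pow₀ h1) (one_le_pow₀ (one_le_pow₀ hn1))
  have hstep : ∀ k, ∀ g ∈ (law n K α t k).support,
      expect (g.step K α (t + k + 1)) (fun g' =>
        sortDebt D g' * sortLeft (sortWeight n) α (t + k + 1) g') ≤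
      (sortWeight n)⁻¹ * (sortDebt D g * sortLeft (sortWeight n) α (t + k) g) + 0 := by
    intro k g hg
    have hs := sound_law hK hg
    refine expect_step_sortLeft_le h1 (sortWeight_ne_top n) (fun p _ e he => ?_)
      (fun q k' hp e he => ?_) (fun a ha => ?_)
    · exact sortDebt_le hD (fun h => h.afterMatch he p) fun _ h => h.afterMatch he p
    · exact sortDebt_le hD (fun h => h.afterSort hs.tracks he hp)
        fun h h' => h'.afterSort hs.tracks he hp h
    · by_cases hsafe : g.SafeSorter
      -- A trusted run has ended, so its result is accurate and nothing is owed.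
      · refine ⟨0, fun e he => ?_, by simp⟩
        have h2 : ((g.afterSort (done a)).evolveTo e).AccurateApprox :=
          hsafe.of_mem_turn hs.tracks he ha
        simp [sortDebt, safeSorter_done a e, h2]
      · refine ⟨1, fun e he => ?_, ?_⟩
        · simp only [sortDebt, safeSorter_done a e, if_true]
          split_ifs <;> simp
        · rw [one_mul, add_zero, sortDebt, if_neg hsafe, wp_counted_one, hDdef, sq, mul_assoc,
            ← mul_assoc, ENNReal.inv_mul_cancel h0 (sortWeight_ne_top n), one_mul]
          exact mul_le_mul_right (wp_sequentialSort_le hα (hs.st.sorter.turn ha) _) _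
  have hpow := expect_run_le_pow
    (Φ := fun τ g => sortDebt D g * sortLeft (sortWeight n) α τ g) hstep k
  rw [← one_mul (prob _ _)]
  refine (mul_prob_le fun g _ hg => ?_).trans (hpow.trans (mul_le_mul_right ?_ _))
  · have hdebt : 1 ≤ sortDebt D g := by
      unfold sortDebt
      split_ifs with h2 h3
      · exact absurd ⟨h2, h3⟩ hg
      · exact le_rfl
      · exact hD
    exact one_le_mul hdebt (one_le_sortLeft h1 _ _)
  · refine le_trans (expect_mono (g := fun g => D * sortLeft (sortWeight n) α t g) fun g =>
      mul_le_mul_left ?_ _) ?_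
    · unfold sortDebt
      split_ifs <;> simp [hD]
    · rw [expect_mul_left]
      exact mul_le_mul_right (expect_law_sortLeft_le hK hα hM t 0) _

/-! ## Completion of the matching runs -/

/-- The probability that the present matching run began long ago. -/
theorem prob_mStart_le {K : ℕ} (hK : 1 ≤ K) {ξ : ℝ≥0∞} (hξ : 1 ≤ ξ) (hξt : ξ ≠ ⊤)
    (hθ : 2 * n * (ξ ^ 2) ^ K ≤ 2 * n + 1) {α : ℕ} {M : ℝ≥0∞}
    (hM : ξ⁻¹ * M + ξ * (n + 1 : ℕ) ≤ M) (t j k : ℕ) :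
    prob (law n K α t (j + k)) (fun g => g.mStart ≤ t + j) ≤ ξ⁻¹ ^ k * M := by
  classical
  have hstep : ∀ k, ∀ g ∈ (run K α (t + j) (law n K α t j) k).support,
      expect (g.step K α (t + j + k + 1)) (fun g' => (if g'.mStart ≤ t + j then 1 else 0) *
        matchLeft ξ α (t + j + k + 1) g') ≤
      ξ⁻¹ * ((if g.mStart ≤ t + j then 1 else 0) * matchLeft ξ α (t + j + k) g) + 0 := by
    intro k g _
    refine expect_step_matchLeft_le (c := fun g => if g.mStart ≤ t + j then 1 else 0) hξ hξt
      (fun p e => ?_) (fun q k' e => le_rfl) ⟨0, fun M e => ?_, by simp⟩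
    · cases p <;> exact le_rfl
    -- Any new run begins after `t + j`, which makes the coefficient zero.
    · rw [if_neg]
      simp only [evolveTo, afterMatch]
      omega
  have hpow := expect_run_le_pow (Φ := fun τ g => (if g.mStart ≤ t + j then 1 else 0) *
    matchLeft ξ α τ g) hstep k
  rw [law, run_add, ← law, ← one_mul (prob _ _)]
  refine (mul_prob_le fun g _ hg => ?_).trans (hpow.trans (mul_le_mul_right ?_ _))
  · rw [if_pos hg, one_mul]
    exact one_le_matchLeft hξ _ _
  · refine le_trans (expect_mono fun g => ?_) (expect_law_matchLeft_le hK hξ hξt hθ hM t j)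
    split_ifs <;> simp

theorem run_eq_bind (K α t : ℕ) (μ : PMF (TrackedState n)) (k : ℕ) :
    run K α t μ k = μ.bind fun g => run K α t (PMF.pure g) k := by
  rw [← run_bind, PMF.bind_pure]

/-- The probability that the output was produced by a matching run that began long ago. -/
theorem prob_oStart_le {K : ℕ} (hK : 1 ≤ K) {ξ : ℝ≥0∞} (hξ : 1 ≤ ξ) (hξt : ξ ≠ ⊤)
    (hθ : 2 * n * (ξ ^ 2) ^ K ≤ 2 * n + 1) {α : ℕ} {M : ℝ≥0∞}
    (hM : ξ⁻¹ * M + ξ * (n + 1 : ℕ) ≤ M) (t j k : ℕ) :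
    prob (law n K α t (j + k + k)) (fun g => g.oStart ≤ t + j) ≤ 2 * (ξ⁻¹ ^ k * M) := by
  have h1 := prob_mStart_le hK hξ hξt hθ hM t j k (α := α)
  have h2 := prob_mStart_le hK hξ hξt hθ hM t (j + k) k (α := α)
  rw [two_mul]
  refine le_trans ?_ (add_le_add h1 h2)
  rw [law, run_add, ← law, run_eq_bind, prob_bind, prob_bind, prob, ← expect_add]
  refine expect_mono_support fun g hg => ?_
  have hs := sound_law hK hg
  by_cases hm : g.mStart ≤ t + j
  · rw [if_pos hm]
    exact (prob_le_one _ _).trans le_self_add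
  · rw [if_neg hm, zero_add]
    refine prob_mono_support fun g' hg' ho => ?_
    -- If the run in progress at time `t + j + k` began after `t + j`, then from the first later
    -- start of a run on, the output comes from a run begun after `t + j`.
    have hinv := run_induction (P := fun τ g => t + j < g.mStart ∧
      (t + (j + k) < g.mStart → t + j < g.oStart)) (fun g₁ hg₁ => ?_)
      (fun τ g₁ g₂ hτ h₁ h₂ => ?_) k g' hg'
    · by_contra hc
      have := hinv.2 (by omega)
      omega
    · rw [PMF.support_pure, Set.mem_singleton_iff] at hg₁
      subst hg₁
      have := hs.mStart
      exact ⟨by omega, fun h => by omega⟩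
    · obtain ⟨e, -, ⟨-, p, -, rfl⟩ | ⟨-, p, -, rfl⟩⟩ := mem_support_step h₂
      · cases p <;> exact h₁
      · cases p with
        | done M =>
          refine ⟨?_, fun _ => h₁.1⟩
          simp only [evolveTo, afterMatch]
          omega
        | ask q k => exact h₁
        | rand m k => exact h₁

end TrackedState

namespace TrackedState

/-! ## The potential of the output -/

/-- The growth factor of the potential in one time-step. -/
noncomputable def stepGrowth (n α : ℕ) : ℝ≥0∞ := eventGrowth n ^ α

theorem one_le_stepGrowth (n α : ℕ) : 1 ≤ stepGrowth n α := one_le_pow₀ (one_le_eventGrowth n)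

theorem expect_eq_stepGrowth_mul_tick (hn : 2 ≤ n) {α : ℕ} {E : Type*} {κ : E → PMF E}
    (f : E → ℝ≥0∞) (e : E) :
    expect (κ e) f = stepGrowth n α * tick (decayWeight n α) κ f e := by
  have h0 : decayWeight n α ≠ 0 :=
    ENNReal.inv_ne_zero.2 (ENNReal.pow_ne_top (eventGrowth_ne_top hn))
  have ht : decayWeight n α ≠ ⊤ :=
    ENNReal.inv_ne_top.2 (zero_lt_one.trans_le (one_le_stepGrowth n α)).ne'
  rw [expect_of_tick h0 ht, decayWeight, inv_inv, stepGrowth]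

/-- The potential of the output of the present matching run, at time `t`. -/
noncomputable def matcherPotential (K α t : ℕ) (g : TrackedState n) : ℝ≥0∞ :=
  if Even t then wpNow (decayWeight n α) (countedEvolveMany α) Prod.fst (outputPotential K)
    g.st.matcher g.env
  else tick (decayWeight n α) (countedEvolveMany α) (wpNow (decayWeight n α) (countedEvolveMany α)
    Prod.fst (outputPotential K) g.st.matcher) g.env

/-- The potential at time `t` of the output and of the output of the present matching run, as far as
these runs began after the time `t₁`. -/
noncomputable def potential (K α t₁ t : ℕ) (g : TrackedState n) : ℝ≥0∞ :=
  (if t₁ < g.oStart then outputPotential K g.st.output g.env else 0) +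
    (if t₁ < g.mStart then matcherPotential K α t g else 0)

theorem expect_outputPotential_many_le (hn : 2 ≤ n) (K α : ℕ) (M : Assignment n)
    (e : CountedPrefs n) : expect (countedEvolveMany α e) (outputPotential K M) ≤
      stepGrowth n α * outputPotential K M e :=
  expect_countedEvolveMany_le (expect_outputPotential_le hn K M) α e

theorem expect_fresh_le (hn : 2 ≤ n) {K : ℕ} (hK : 1 ≤ K) {α : ℕ} {a : Approx n}
    (ha : IsPermApprox a) {π₀ : Prefs n} {e : CountedPrefs n} (he : Useful π₀ a e) :
    expect (countedEvolveMany α e) (tick (decayWeight n α) (countedEvolveMany α)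
      (wpNow (decayWeight n α) (countedEvolveMany α) Prod.fst (outputPotential K)
        (modifiedGS K a))) ≤ stepGrowth n α := by
  rw [expect_eq_stepGrowth_mul_tick hn (α := α)]
  refine mul_le_of_le_one_right' ((tick_wpNow_le le_rfl (fun M e => ?_) _ _).trans ?_)
  · have h := tick_le_of_growth hn (expect_outputPotential_le hn K M) α
    rw [one_mul]
    exact (tick_mono h).trans (h e)
  · rw [one_mul]
    exact wp_modifiedGS_le_one hn hK ha he

/-- Without a completed run, both summands grow by at most the step factor. A completed run moves
its potential from the second summand to the first, where the old output is discarded, and the run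
that starts then contributes the additional 1; goodness is needed only for this new run. -/
theorem expect_step_potential_le (hn : 2 ≤ n) {K : ℕ} (hK : 1 ≤ K) {α t₁ t : ℕ} (ht : t₁ ≤ t)
    {g : TrackedState n} (hs : g.Sound t) (hg : g.Good) :
    expect (g.step K α (t + 1)) (potential K α t₁ (t + 1)) ≤
      stepGrowth n α * (potential K α t₁ t g + 1) := by
  have hO := expect_outputPotential_many_le hn K α
  by_cases hev : Even t
  · have hodd : ¬ Even (t + 1) := by simpa [Nat.even_add_one] using hev
    rw [expect_step_odd hodd]
    have hkey : ∀ p ∈ (turn g.st.prefs g.st.matcher).support,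
        expect (countedEvolveMany α g.env) (fun e =>
          potential K α t₁ (t + 1) ((g.afterMatch K (t + 1) p).evolveTo e)) ≤
        stepGrowth n α * ((if t₁ < g.oStart then outputPotential K g.st.output g.env else 0) +
          (if t₁ < g.mStart then 1 else 0) * wp (decayWeight n α) (countedEvolveMany α) Prod.fst
            (outputPotential K) p g.env + 1) := by
      intro p hp
      have hset := isSettled_turn hp
      cases p with
      | done M =>
        simp only [potential, matcherPotential, if_neg hodd]
        rw [expect_add]
        refine (add_le_add (b := stepGrowth n α * ((if t₁ < g.mStart then 1 else 0) *
          wp (decayWeight n α) (countedEvolveMany α) Prod.fst (outputPotential K) (done M) g.env))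
          (d := stepGrowth n α) ?_ ?_).trans ?_
        · change expect _ (fun e => if t₁ < g.mStart then outputPotential K M e else 0) ≤ _
          split_ifs
          · rw [one_mul]; exact hO M g.env
          · simp
        · change expect _ (fun e => if t₁ < t + 1 then _ else 0) ≤ _
          simp only [if_pos (show t₁ < t + 1 by omega)]
          exact expect_fresh_le hn hK hs.st.approx ⟨hs.tracks, hg.2⟩
        · rw [mul_add, mul_add, mul_one]
          gcongr
          exact le_add_self
      | ask q k =>
        simp only [potential, matcherPotential, if_neg hodd]
        rw [expect_add]
        refine le_trans (add_le_add (b := stepGrowth n α * (if t₁ < g.oStart then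
          outputPotential K g.st.output g.env else 0)) (d := stepGrowth n α *
          ((if t₁ < g.mStart then 1 else 0) * wp (decayWeight n α) (countedEvolveMany α) Prod.fst
            (outputPotential K) (ask q k) g.env)) ?_ ?_) ?_
        · change expect _ (fun e => if t₁ < g.oStart then outputPotential K g.st.output e else 0) ≤ _
          split_ifs
          · exact hO _ g.env
          · simp
        · change expect _ (fun e => if t₁ < g.mStart then tick (decayWeight n α)
            (countedEvolveMany α) (wpNow (decayWeight n α) (countedEvolveMany α)
              Prod.fst (outputPotential K) (ask q k)) e else 0) ≤ _
          split_ifs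
          · rw [expect_eq_stepGrowth_mul_tick hn (α := α), wp_ask_eq, one_mul]
          · simp
        · rw [← mul_add]
          exact mul_le_mul_right le_self_add _
      | rand m k => exact hset.elim
    refine (expect_mono_support hkey).trans (le_of_eq ?_)
    rw [expect_mul_left, expect_add, expect_add, expect_const, expect_const, expect_mul_left,
      potential, matcherPotential, if_pos hev]
    congr 3
    split_ifs
    · rw [one_mul]; rfl
    · rw [zero_mul]
  · have heven : Even (t + 1) := by simpa [Nat.even_add_one] using hev
    rw [expect_step_even heven]
    refine le_trans (expect_mono (g := fun _ => stepGrowth n α * (potential K α t₁ t g + 1))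
      fun p => ?_) (expect_const _ _).le
    have hpot : ∀ e, potential K α t₁ (t + 1) ((g.afterSort p).evolveTo e) =
        (if t₁ < g.oStart then outputPotential K g.st.output e else 0) +
          (if t₁ < g.mStart then wpNow (decayWeight n α) (countedEvolveMany α) Prod.fst
            (outputPotential K) g.st.matcher e else 0) := by
      intro e
      unfold potential matcherPotential
      rw [if_pos heven]
      cases p <;> rfl
    simp only [hpot]
    rw [expect_add, mul_add, potential, matcherPotential, if_neg hev, mul_add]
    refine (add_le_add ?_ ?_).trans le_self_add
    · split_ifs
      · exact hO _ g.env
      · simp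
    · split_ifs
      · rw [expect_eq_stepGrowth_mul_tick hn (α := α)]
      · simp

/-- Neither summand counts at the beginning, because both runs started no later than `t`. Then the
recursion x ↦ g(x + 1) is unrolled. -/
theorem expect_run_potential_le (hn : 2 ≤ n) {K : ℕ} (hK : 1 ≤ K) {α t : ℕ}
    {g : TrackedState n} (hs : g.Sound t) (hg : g.Good) (k : ℕ) :
    expect (run K α t (PMF.pure g) k) (potential K α t (t + k)) ≤ k * stepGrowth n α ^ k := by
  have hinv : ∀ k, ∀ g' ∈ (run K α t (PMF.pure g) k).support, g'.Sound (t + k) ∧ g'.Good :=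
    run_induction (P := fun τ g => g.Sound τ ∧ g.Good)
      (fun g' h => by
        rw [PMF.support_pure, Set.mem_singleton_iff] at h
        exact h ▸ ⟨hs, hg⟩)
      (fun τ g₁ g₂ _ h h' => ⟨h.1.step hK h', h.2.step h.1.tracks h'⟩)
  induction k with
  | zero =>
    simp [run, potential, hs.oStart.not_gt, hs.mStart.not_gt]
  | succ k ih =>
    refine (expect_run_succ_le (ζ := stepGrowth n α) (b := fun _ => stepGrowth n α)
      fun g' hg' => ?_).trans ?_
    · have := hinv k g' hg'
      refine (expect_step_potential_le hn hK (Nat.le_add_right t k) this.1 this.2).trans ?_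
      rw [mul_add, mul_one]
    · rw [expect_const]
      calc _ ≤ stepGrowth n α * (k * stepGrowth n α ^ k) + stepGrowth n α * stepGrowth n α ^ k := by
            gcongr
            exact le_mul_of_one_le_right' (one_le_pow₀ (one_le_stepGrowth n α))
        _ = _ := by push_cast; ring

/-- The probability of many blocking pairs from a good state. -/
theorem prob_run_numBlocking_le (hn : 2 ≤ n) {K : ℕ} (hK : 1 ≤ K) {α t : ℕ}
    {g : TrackedState n} (hs : g.Sound t) (hg : g.Good) (k m : ℕ) :
    prob (run K α t (PMF.pure g) k) (fun g' => t < g'.oStart ∧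
      totalExcess K g'.cnt + m ≤ numBlocking g'.st.prefs g'.st.output) ≤
      (2 ^ m)⁻¹ * (k * stepGrowth n α ^ k) := by
  have h2 : (2 : ℝ≥0∞) ^ m ≠ 0 := pow_ne_zero _ (by norm_num)
  have h2t : (2 : ℝ≥0∞) ^ m ≠ ⊤ := ENNReal.pow_ne_top (by norm_num)
  have hsound : ∀ g' ∈ (run K α t (PMF.pure g) k).support, g'.Sound (t + k) :=
    run_induction (P := fun τ g => g.Sound τ)
      (fun g' h => by
        rw [PMF.support_pure, Set.mem_singleton_iff] at h
        exact h ▸ hs)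
      (fun τ g₁ g₂ _ h h' => h.step hK h') k
  rw [mul_comm, ← div_eq_mul_inv, ENNReal.le_div_iff_mul_le (Or.inl h2) (Or.inl h2t), mul_comm]
  refine (mul_prob_le fun g' hg' h => ?_).trans (expect_run_potential_le hn hK hs hg k)
  rw [potential, if_pos h.1]
  refine le_trans ?_ le_self_add
  refine le_trans ?_ (two_pow_numBlocking_le K (hsound g' hg').st.output g'.env)
  refine pow_le_pow_right₀ (by norm_num) ?_
  have := h.2
  simp only [env]
  omega

/-! ## The total excess in the long run -/

theorem expect_step_cnt (K α t : ℕ) (g : TrackedState n) (f : (Fin n → Fin n → ℕ) → ℝ≥0∞) :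
    expect (g.step K α t) (fun g' => f g'.cnt) =
      expect (countedEvolveMany α g.env) fun e => f e.2 := by
  by_cases ht : Even t
  · rw [expect_step_even ht]
    refine Eq.trans ?_ (expect_const (turn g.st.prefs g.st.sorter) _)
    congr 1
  · rw [expect_step_odd ht]
    refine Eq.trans ?_ (expect_const (turn g.st.prefs g.st.matcher) _)
    congr 1

/-- The growth factor of the parameter of the potential of the moves in one event. -/
noncomputable def moveGrowth (n : ℕ) : ℝ≥0∞ := 1 + 2 ^ 16 * ((n * (n - 1) : ℕ) : ℝ≥0∞)⁻¹

theorem expect_run_movePotential_le (hn : 2 ≤ n) (K α t : ℕ) (μ : PMF (TrackedState n)) (k : ℕ)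
    (β : ℝ≥0∞) : expect (run K α t μ k) (fun g => movePotential β g.cnt) ≤
      expect μ fun g => movePotential (β * moveGrowth n ^ (α * k)) g.cnt := by
  induction k generalizing β with
  | zero => simp [run]
  | succ k ih =>
    rw [run, expect_bind]
    simp only [expect_step_cnt K α _ _ (movePotential β)]
    have h : ∀ g : TrackedState n, expect (countedEvolveMany α g.env) (fun e =>
        movePotential β e.2) ≤ movePotential (β * moveGrowth n ^ α) g.cnt := fun g => by
      rw [moveGrowth]
      exact expect_movePotential_many_le hn α β g.env
    refine (expect_mono h).trans ((ih _).trans (le_of_eq ?_))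
    rw [mul_assoc, ← pow_add, mul_add, mul_one, add_comm]

/-- The probability of a large total excess. -/
theorem prob_totalExcess_le (hn : 2 ≤ n) (K α t k m : ℕ) :
    prob (law n K α t k) (fun g => m ≤ totalExcess K g.cnt) ≤
      (2 ^ m)⁻¹ * (1 + (2 ^ K)⁻¹ * moveGrowth n ^ (α * k) * n) ^ n := by
  have h2 : (2 : ℝ≥0∞) ^ m ≠ 0 := pow_ne_zero _ (by norm_num)
  have h2t : (2 : ℝ≥0∞) ^ m ≠ ⊤ := ENNReal.pow_ne_top (by norm_num)
  rw [mul_comm, ← div_eq_mul_inv, ENNReal.le_div_iff_mul_le (Or.inl h2) (Or.inl h2t), mul_comm]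
  have h := expect_run_movePotential_le hn K α t ((EvolvingMatching.law n K α t).map (start t)) k
    (2 ^ K)⁻¹
  have hzero : ∀ β : ℝ≥0∞, movePotential β (fun _ _ : Fin n => 0) = (1 + β * n) ^ n := fun β => by
    simp [movePotential]
  have hpow : ∀ g : TrackedState n, m ≤ totalExcess K g.cnt →
      (2 : ℝ≥0∞) ^ m ≤ movePotential (2 ^ K)⁻¹ g.cnt := fun g hg =>
    (pow_le_pow_right₀ (by norm_num) hg).trans (two_pow_totalExcess_le K g.cnt)
  refine le_trans (mul_prob_le fun g _ hg => hpow g hg) (h.trans ?_)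
  rw [expect_map]
  simp only [start, hzero, expect_const, le_refl]

/-! ## The tail of the number of blocking pairs -/

/-- With 2m blocking pairs, one of four things has happened: the output comes from a run begun no
later than `t + j`; the total excess since `t` is at least m; the state at `t + j` is not good; or,
from a good state at `t + j`, there are at least m blocking pairs beyond the excess. The interval
`j` lets the sorting settle, and the two intervals `k` let two matching runs end. -/
theorem prob_numBlocking_le (hn : 2 ≤ n) {K : ℕ} (hK : 1 ≤ K) {α : ℕ} (hα : 64 * α + 1 ≤ n)
    {S ξ M : ℝ≥0∞} (hS : (sortWeight n)⁻¹ * S + sortWeight n * ((n : ℝ≥0∞) ^ 3) ^ n ≤ S)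
    (hξ : 1 ≤ ξ) (hξt : ξ ≠ ⊤) (hθ : 2 * n * (ξ ^ 2) ^ K ≤ 2 * n + 1)
    (hM : ξ⁻¹ * M + ξ * (n + 1 : ℕ) ≤ M) (t j k m : ℕ) :
    prob (EvolvingMatching.law n K α (t + (j + k + k)))
        (fun s => m + m ≤ numBlocking s.prefs s.output) ≤
      2 * (ξ⁻¹ ^ k * M) +
      (2 ^ m)⁻¹ * (1 + (2 ^ K)⁻¹ * moveGrowth n ^ (α * (j + k + k)) * n) ^ n +
      ((sortWeight n)⁻¹ ^ j * (sortWeight n ^ 2 * ((n : ℝ≥0∞) ^ 3) ^ n * S) +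
        (2 ^ m)⁻¹ * ((k + k : ℕ) * stepGrowth n α ^ (k + k))) := by
  have h1 := prob_oStart_le hK hξ hξt hθ hM t j k (α := α)
  have h2 := prob_totalExcess_le hn K α t (j + k + k) m
  have h3 := prob_not_good_le hK hα hS t j
  have h4 : prob (law n K α t (j + k + k)) (fun g => t + j < g.oStart ∧
      totalExcess K g.cnt + m ≤ numBlocking g.st.prefs g.st.output) ≤
      prob (law n K α t j) (fun g => ¬ g.Good) +
        (2 ^ m)⁻¹ * ((k + k : ℕ) * stepGrowth n α ^ (k + k)) := by
    rw [law, add_assoc j, run_add, ← law, run_eq_bind, prob_bind,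
      ← expect_const (law n K α t j) ((2 ^ m)⁻¹ * ((k + k : ℕ) * stepGrowth n α ^ (k + k))),
      prob, ← expect_add]
    refine expect_mono_support fun g hg => ?_
    by_cases hgood : g.Good
    · exact (prob_run_numBlocking_le hn hK (sound_law hK hg) hgood _ m).trans le_add_self
    · rw [if_pos hgood]
      exact (prob_le_one _ _).trans le_self_add
  rw [← law_map_st, prob_map]
  refine le_trans ?_ (add_le_add (add_le_add h1 h2) (h4.trans (add_le_add h3 le_rfl)))
  refine le_trans ?_ (add_le_add (prob_or_le _ _ _) le_rfl)
  refine le_trans (prob_mono_support fun g _ h => ?_) (prob_or_le _ _ _)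
  by_contra hc
  simp only [not_or, not_le, not_and] at hc
  have := hc.2 hc.1.1
  omega

end TrackedState

/-! ## Estimates of the weights -/

/-- The weight with `N` in the role of a time scale. -/
noncomputable def scaleWeight (N : ℕ) : ℝ≥0∞ := ENNReal.ofReal (1 + 1 / N)

theorem one_le_scaleWeight (N : ℕ) : 1 ≤ scaleWeight N := by
  rw [scaleWeight, ← ENNReal.ofReal_one]
  exact ENNReal.ofReal_le_ofReal (by simp)

theorem scaleWeight_le_two {N : ℕ} (hN : 1 ≤ N) : scaleWeight N ≤ 2 := by
  rw [scaleWeight, ← ENNReal.ofReal_ofNat]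
  refine ENNReal.ofReal_le_ofReal ?_
  have : (1 : ℝ) / N ≤ 1 := by
    rw [div_le_one (by positivity)]
    exact_mod_cast hN
  linarith

theorem sortWeight_eq (n : ℕ) : sortWeight n = scaleWeight (32 * n) := by
  rw [sortWeight, scaleWeight]
  push_cast
  rfl

theorem inv_scaleWeight {N : ℕ} (hN : 1 ≤ N) :
    (scaleWeight N)⁻¹ = ENNReal.ofReal (N / (N + 1)) := by
  have : (0 : ℝ) < N := by exact_mod_cast hN
  rw [scaleWeight, ← ENNReal.ofReal_inv_of_pos (by positivity)]
  congr 1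
  field_simp

/-- For `ξ` = 1 + 1/N, the number (N+1)b is the fixed point of M ↦ M/ξ + b. -/
theorem renewal_bound {N : ℕ} (hN : 1 ≤ N) (b : ℝ≥0∞) :
    (scaleWeight N)⁻¹ * ((N + 1 : ℕ) * b) + b ≤ (N + 1 : ℕ) * b := by
  have h : (scaleWeight N)⁻¹ * (N + 1 : ℕ) = N := by
    rw [inv_scaleWeight hN, ← ENNReal.ofReal_natCast, ← ENNReal.ofReal_mul (by positivity),
      ← ENNReal.ofReal_natCast]
    congr 1
    push_cast
    field_simp
  rw [← mul_assoc, h]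
  push_cast
  rw [add_mul, one_mul]

theorem inv_scaleWeight_pow_le {N : ℕ} (hN : 1 ≤ N) (k : ℕ) :
    (scaleWeight N)⁻¹ ^ k ≤ ENNReal.ofReal (Real.exp (-(k / (N + 1)))) := by
  rw [inv_scaleWeight hN, ← ENNReal.ofReal_pow (by positivity)]
  refine ENNReal.ofReal_le_ofReal ?_
  calc ((N : ℝ) / (N + 1)) ^ k ≤ (Real.exp (-(1 / (N + 1)))) ^ k := by
        refine pow_le_pow_left₀ (by positivity) ?_ k
        have := Real.add_one_le_exp (-(1 / ((N : ℝ) + 1)))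
        refine le_trans (le_of_eq ?_) this
        field_simp
        ring
    _ = _ := by
        rw [← Real.exp_nat_mul]
        congr 1
        ring

/-- The 2K time-steps of one proposal weigh at most e^(1/(4n)) ≤ 1 + 1/(2n), which is what the
coupon drift allows. -/
theorem scaleWeight_pow_le {K : ℕ} (hn : 1 ≤ n) (hK : 1 ≤ K) :
    2 * n * (scaleWeight (8 * n * K) ^ 2) ^ K ≤ 2 * n + 1 := by
  have hn' : (0 : ℝ) < n := by exact_mod_cast hn
  have hK' : (0 : ℝ) < K := by exact_mod_cast hK
  have hpow : (scaleWeight (8 * n * K) ^ 2) ^ K ≤ ENNReal.ofReal (1 + 1 / (2 * n)) := by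
    rw [← pow_mul, scaleWeight, ← ENNReal.ofReal_pow (by positivity)]
    refine ENNReal.ofReal_le_ofReal ?_
    calc (1 + 1 / ((8 * n * K : ℕ) : ℝ)) ^ (2 * K) ≤
          (Real.exp (1 / (8 * n * K : ℕ))) ^ (2 * K) := by
          refine pow_le_pow_left₀ (by positivity) ?_ _
          rw [add_comm]
          exact Real.add_one_le_exp _
      _ = Real.exp (1 / (4 * n)) := by
          rw [← Real.exp_nat_mul]
          congr 1
          push_cast
          field_simp
          norm_num
      _ ≤ _ := by
          have h4 : (1 : ℝ) / (4 * n) ≤ 1 / 2 := by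
            rw [div_le_div_iff₀ (by positivity) (by norm_num)]
            have : (1 : ℝ) ≤ n := by exact_mod_cast hn
            linarith
          have h1 := Real.add_one_le_exp (-(1 / (4 * (n : ℝ))))
          have h2 : Real.exp (1 / (4 * n)) * Real.exp (-(1 / (4 * (n : ℝ)))) = 1 := by
            rw [← Real.exp_add]; simp
          have h3 : (1 : ℝ) / (2 * n) = 2 * (1 / (4 * n)) := by field_simp; norm_num
          rw [h3]
          have h5 : (0 : ℝ) < 1 / (4 * n) := by positivity
          have h6 := Real.exp_pos (1 / (4 * (n : ℝ)))
          nlinarith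
  calc _ ≤ 2 * n * ENNReal.ofReal (1 + 1 / (2 * n)) := by gcongr
    _ = ENNReal.ofReal (2 * n * (1 + 1 / (2 * n))) := by
        rw [ENNReal.ofReal_mul (by positivity), ENNReal.ofReal_mul (by positivity)]
        simp
    _ = ENNReal.ofReal (2 * n + 1) := by
        congr 1
        field_simp
    _ = _ := by
        rw [ENNReal.ofReal_add (by positivity) (by positivity), ENNReal.ofReal_mul (by positivity)]
        simp

theorem one_add_ofReal_pow_le {x : ℝ} (hx : 0 ≤ x) (k : ℕ) :
    (1 + ENNReal.ofReal x) ^ k ≤ ENNReal.ofReal (Real.exp (k * x)) := by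
  rw [← ENNReal.ofReal_one, ← ENNReal.ofReal_add zero_le_one hx,
    ← ENNReal.ofReal_pow (by positivity), Real.exp_nat_mul]
  refine ENNReal.ofReal_le_ofReal (pow_le_pow_left₀ (by positivity) ?_ _)
  rw [add_comm]
  exact Real.add_one_le_exp x

theorem inv_natCast_eq_ofReal {k : ℕ} (hk : 1 ≤ k) :
    ((k : ℕ) : ℝ≥0∞)⁻¹ = ENNReal.ofReal (1 / k) := by
  have : (0 : ℝ) < k := by exact_mod_cast hk
  rw [one_div, ENNReal.ofReal_inv_of_pos this, ENNReal.ofReal_natCast]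

theorem moveGrowth_pow_le (hn : 2 ≤ n) (k : ℕ) : TrackedState.moveGrowth n ^ k ≤
    ENNReal.ofReal (Real.exp (k * (2 ^ 17 / (n : ℝ) ^ 2))) := by
  have hpos : 1 ≤ n * (n - 1) := Nat.mul_pos (by omega) (by omega)
  have hn' : (2 : ℝ) ≤ n := by exact_mod_cast hn
  have h : (2 : ℝ≥0∞) ^ 16 * ((n * (n - 1) : ℕ) : ℝ≥0∞)⁻¹ ≤
      ENNReal.ofReal (2 ^ 17 / (n : ℝ) ^ 2) := by
    rw [inv_natCast_eq_ofReal hpos, ← ENNReal.ofReal_ofNat 2, ← ENNReal.ofReal_pow (by norm_num),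
      ← ENNReal.ofReal_mul (by positivity)]
    refine ENNReal.ofReal_le_ofReal ?_
    rw [mul_one_div, div_le_div_iff₀ (by exact_mod_cast hpos) (by positivity)]
    push_cast [Nat.cast_sub (by omega : 1 ≤ n)]
    nlinarith
  refine le_trans (pow_le_pow_left₀ zero_le (add_le_add le_rfl h) k) ?_
  exact one_add_ofReal_pow_le (by positivity) k

theorem stepGrowth_pow_le (hn : 2 ≤ n) (α k : ℕ) : TrackedState.stepGrowth n α ^ k ≤
    ENNReal.ofReal (Real.exp ((α * k : ℕ) * (4 / n))) := by
  have hn' : (2 : ℝ) ≤ n := by exact_mod_cast hn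
  have h : 2 * ((n - 1 : ℕ) : ℝ≥0∞)⁻¹ ≤ ENNReal.ofReal (4 / n) := by
    rw [inv_natCast_eq_ofReal (by omega), ← ENNReal.ofReal_ofNat 2,
      ← ENNReal.ofReal_mul (by positivity)]
    refine ENNReal.ofReal_le_ofReal ?_
    rw [Nat.cast_sub (by omega), Nat.cast_one, mul_one_div,
      div_le_div_iff₀ (by linarith) (by linarith)]
    linarith
  rw [TrackedState.stepGrowth, ← pow_mul, eventGrowth]
  refine le_trans (pow_le_pow_left₀ zero_le (add_le_add le_rfl h) _) ?_
  exact one_add_ofReal_pow_le (by positivity) _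

theorem inv_two_pow_le (m : ℕ) :
    ((2 : ℝ≥0∞) ^ m)⁻¹ ≤ ENNReal.ofReal (Real.exp (-(m / 2))) := by
  rw [← ENNReal.ofReal_ofNat 2, ← ENNReal.ofReal_pow (by norm_num),
    ← ENNReal.ofReal_inv_of_pos (by positivity)]
  refine ENNReal.ofReal_le_ofReal ?_
  rw [Real.exp_neg]
  refine inv_anti₀ (Real.exp_pos _) ?_
  rw [show (m : ℝ) / 2 = m * (1 / 2) by ring, Real.exp_nat_mul]
  refine pow_le_pow_left₀ (Real.exp_pos _).le ?_ _
  have : (1 : ℝ) / 2 ≤ Real.log 2 := by linarith [Real.log_two_gt_d9]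
  calc Real.exp (1 / 2) ≤ Real.exp (Real.log 2) := Real.exp_le_exp.2 this
    _ = 2 := Real.exp_log (by norm_num)

theorem natCast_le_ofReal_exp {k : ℕ} {x : ℝ} (h : (k : ℝ) ≤ Real.exp x) :
    (k : ℝ≥0∞) ≤ ENNReal.ofReal (Real.exp x) := by
  rw [← ENNReal.ofReal_natCast]
  exact ENNReal.ofReal_le_ofReal h

theorem ofReal_exp_mul (x y : ℝ) : ENNReal.ofReal (Real.exp x) * ENNReal.ofReal (Real.exp y) =
    ENNReal.ofReal (Real.exp (x + y)) := by
  rw [← ENNReal.ofReal_mul (Real.exp_pos _).le, Real.exp_add]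

theorem ofReal_exp_le {x y : ℝ} (h : x ≤ y) :
    ENNReal.ofReal (Real.exp x) ≤ ENNReal.ofReal (Real.exp y) :=
  ENNReal.ofReal_le_ofReal (Real.exp_le_exp.2 h)

/-! ## The terms of the tail bound -/

theorem exp_mul_log (hn : 1 ≤ n) (k : ℕ) : Real.exp (k * Real.log n) = (n : ℝ) ^ k := by
  rw [Real.exp_nat_mul, Real.exp_log (by exact_mod_cast hn)]

/-- The decay rate is at least 1/(9nK), so `k` of order n log² n yields the exponent −(c+6) log n;
the prefactor, at most n⁴, uses up four of the logarithms. -/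
theorem deadline_term_le {K k : ℕ} (hn : 72 ≤ n) (hK : 1 ≤ K) (hKn : K ≤ n) {c C : ℝ}
    (hc : 0 ≤ c) (hL : 1 ≤ Real.log n) (hKC : (K : ℝ) ≤ 2 * C * Real.log n)
    (hk : 18 * C * (c + 8) * n * Real.log n ^ 2 ≤ k) :
    2 * ((scaleWeight (8 * n * K))⁻¹ ^ k *
      ((8 * n * K + 1 : ℕ) * (scaleWeight (8 * n * K) * (n + 1 : ℕ)))) ≤
      ENNReal.ofReal (Real.exp (-((c + 2) * Real.log n))) := by
  have hN : 1 ≤ 8 * n * K := Nat.mul_pos (by omega) hK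
  have hn' : (0 : ℝ) < n := by exact_mod_cast (by omega : 0 < n)
  have hK' : (1 : ℝ) ≤ K := by exact_mod_cast hK
  set L := Real.log n with hLdef
  have hnat : 2 * ((8 * n * K + 1) * (2 * (n + 1))) ≤ n ^ 4 := by
    have h1 : 8 * n * K + 1 ≤ 9 * n ^ 2 := by nlinarith
    calc 2 * ((8 * n * K + 1) * (2 * (n + 1))) ≤ 2 * (9 * n ^ 2 * (2 * (2 * n))) := by
          gcongr; omega
      _ = 72 * n ^ 3 := by ring
      _ ≤ n * n ^ 3 := by gcongr
      _ = n ^ 4 := by ring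
  have hpre : ((2 * ((8 * n * K + 1) * (2 * (n + 1))) : ℕ) : ℝ≥0∞) ≤
      ENNReal.ofReal (Real.exp (4 * L)) := by
    refine natCast_le_ofReal_exp ?_
    have := exp_mul_log (n := n) (by omega) 4
    push_cast at this
    rw [this]
    exact_mod_cast hnat
  have hexp : (c + 6) * L ≤ k / ((8 * n * K : ℕ) + 1 : ℝ) := by
    rw [le_div_iff₀ (by positivity)]
    have h1 : ((8 * n * K : ℕ) + 1 : ℝ) ≤ 9 * n * K := by
      have : (1 : ℝ) ≤ n * K := by exact_mod_cast Nat.mul_pos (by omega) hK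
      push_cast
      nlinarith
    calc (c + 6) * L * ((8 * n * K : ℕ) + 1 : ℝ) ≤ (c + 8) * L * (9 * n * (2 * C * L)) := by
          refine mul_le_mul ?_ (h1.trans ?_) (by positivity) (by positivity)
          · exact mul_le_mul_of_nonneg_right (by linarith) (by linarith)
          · exact mul_le_mul_of_nonneg_left hKC (by positivity)
      _ = 18 * C * (c + 8) * n * L ^ 2 := by ring
      _ ≤ k := hk
  calc _ = (scaleWeight (8 * n * K))⁻¹ ^ k *
        (2 * ((8 * n * K + 1 : ℕ) * (scaleWeight (8 * n * K) * (n + 1 : ℕ)))) := by ring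
    _ ≤ ENNReal.ofReal (Real.exp (-(k / ((8 * n * K : ℕ) + 1)))) *
        ((2 * ((8 * n * K + 1) * (2 * (n + 1))) : ℕ) : ℝ≥0∞) := by
        refine mul_le_mul' (inv_scaleWeight_pow_le hN k) ?_
        have := scaleWeight_le_two hN
        rw [Nat.cast_mul 2, Nat.cast_mul (8 * n * K + 1), Nat.cast_mul 2 (n + 1), Nat.cast_ofNat]
        gcongr
    _ ≤ ENNReal.ofReal (Real.exp (-(k / ((8 * n * K : ℕ) + 1)))) *
        ENNReal.ofReal (Real.exp (4 * L)) := by gcongr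
    _ ≤ _ := by
        rw [ofReal_exp_mul]
        refine ofReal_exp_le ?_
        linarith

/-- Over 265 n² log n time-steps the moves enlarge 2^(−K) by a power of n that depends only on α.
The condition on `C` makes K/2 exceed this power by 2 log n, so the product over all players stays
below e. It does not involve `c`; only `m` does. -/
theorem excess_term_le {K α p m : ℕ} (hn : 2 ≤ n) {c C : ℝ} (hL : 1 ≤ Real.log n)
    (hC : 2 * (2 ^ 17 * 265 * α + 2) ≤ C) (hKC : C * Real.log n ≤ K)
    (hp : (p : ℝ) ≤ 265 * (n : ℝ) ^ 2 * Real.log n)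
    (hm : 2 * (c + 3) * Real.log n ≤ m) :
    (2 ^ m)⁻¹ * (1 + (2 ^ K)⁻¹ * TrackedState.moveGrowth n ^ (α * p) * n) ^ n ≤
      ENNReal.ofReal (Real.exp (-((c + 2) * Real.log n))) := by
  have hn' : (0 : ℝ) < n := by exact_mod_cast (by omega : 0 < n)
  set L := Real.log n with hLdef
  have hexpL : Real.exp L = n := Real.exp_log hn'
  have hsmall : (2 ^ K)⁻¹ * TrackedState.moveGrowth n ^ (α * p) * n ≤
      ENNReal.ofReal (Real.exp (-L)) := by
    calc (2 ^ K)⁻¹ * TrackedState.moveGrowth n ^ (α * p) * n ≤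
        ENNReal.ofReal (Real.exp (-(K / 2))) *
          ENNReal.ofReal (Real.exp ((α * p : ℕ) * (2 ^ 17 / (n : ℝ) ^ 2))) *
          ENNReal.ofReal (Real.exp L) :=
          mul_le_mul' (mul_le_mul' (inv_two_pow_le K) (moveGrowth_pow_le hn _))
            (natCast_le_ofReal_exp hexpL.ge)
      _ ≤ _ := by
          rw [ofReal_exp_mul, ofReal_exp_mul]
          refine ofReal_exp_le ?_
          have h1 : ((α * p : ℕ) : ℝ) * (2 ^ 17 / (n : ℝ) ^ 2) ≤ 2 ^ 17 * 265 * α * L := by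
            rw [mul_div_assoc', div_le_iff₀ (by positivity)]
            push_cast
            have : (α : ℝ) * p ≤ α * (265 * (n : ℝ) ^ 2 * L) :=
              mul_le_mul_of_nonneg_left hp (Nat.cast_nonneg α)
            nlinarith
          have h2 : 2 * (2 ^ 17 * 265 * α + 2) * L ≤ K :=
            (mul_le_mul_of_nonneg_right hC (by linarith)).trans hKC
          linarith
  calc _ ≤ ENNReal.ofReal (Real.exp (-(m / 2))) *
        ENNReal.ofReal (Real.exp (n * Real.exp (-L))) := by
        refine mul_le_mul' (inv_two_pow_le m) ?_
        refine (pow_le_pow_left₀ zero_le (add_le_add le_rfl hsmall) n).trans ?_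
        exact one_add_ofReal_pow_le (Real.exp_pos _).le n
    _ ≤ _ := by
        rw [ofReal_exp_mul]
        refine ofReal_exp_le ?_
        rw [Real.exp_neg, hexpL, mul_inv_cancel₀ hn'.ne']
        linarith

/-- The decay yields −8 n log n. The two factors n^(3n), one for the run in progress and one for the
next, use 6 n log n, and the remainder covers the polynomial factors and the tail. -/
theorem sort_term_le {j : ℕ} (hn : 264 ≤ n) {c : ℝ} (hcn : c + 4 ≤ n) (hL : 1 ≤ Real.log n)
    (hj : 264 * (n : ℝ) ^ 2 * Real.log n ≤ j) :
    (scaleWeight (32 * n))⁻¹ ^ j * (scaleWeight (32 * n) ^ 2 * ((n : ℝ≥0∞) ^ 3) ^ n *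
      ((32 * n + 1 : ℕ) * (scaleWeight (32 * n) * ((n : ℝ≥0∞) ^ 3) ^ n))) ≤
      ENNReal.ofReal (Real.exp (-((c + 2) * Real.log n))) := by
  have hN : 1 ≤ 32 * n := by omega
  have hn' : (264 : ℝ) ≤ n := by exact_mod_cast hn
  set L := Real.log n with hLdef
  have hB : ((n : ℝ≥0∞) ^ 3) ^ n ≤ ENNReal.ofReal (Real.exp (3 * n * L)) := by
    rw [← pow_mul, ← Nat.cast_pow]
    refine natCast_le_ofReal_exp ?_
    have := exp_mul_log (n := n) (by omega) (3 * n)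
    push_cast at this ⊢
    rw [this]
  have hpre : ((8 * (32 * n + 1) : ℕ) : ℝ≥0∞) ≤ ENNReal.ofReal (Real.exp (2 * L)) := by
    refine natCast_le_ofReal_exp ?_
    have := exp_mul_log (n := n) (by omega) 2
    push_cast at this ⊢
    rw [this]
    nlinarith
  have hexp : 8 * n * L ≤ j / ((32 * n : ℕ) + 1 : ℝ) := by
    rw [le_div_iff₀ (by positivity)]
    refine le_trans ?_ hj
    have h1 : ((32 * n : ℕ) + 1 : ℝ) ≤ 33 * n := by push_cast; linarith
    calc 8 * n * L * ((32 * n : ℕ) + 1 : ℝ) ≤ 8 * n * L * (33 * n) := by gcongr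
      _ = _ := by ring
  calc _ = (scaleWeight (32 * n))⁻¹ ^ j * ((scaleWeight (32 * n)) ^ 3 * (32 * n + 1 : ℕ)) *
        (((n : ℝ≥0∞) ^ 3) ^ n * ((n : ℝ≥0∞) ^ 3) ^ n) := by ring
    _ ≤ ENNReal.ofReal (Real.exp (-(j / ((32 * n : ℕ) + 1)))) *
        ENNReal.ofReal (Real.exp (2 * L)) *
        (ENNReal.ofReal (Real.exp (3 * n * L)) * ENNReal.ofReal (Real.exp (3 * n * L))) := by
        refine mul_le_mul' (mul_le_mul' (inv_scaleWeight_pow_le hN j) (le_trans ?_ hpre))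
          (mul_le_mul' hB hB)
        have : scaleWeight (32 * n) ^ 3 ≤ 8 :=
          (pow_le_pow_left₀ zero_le (scaleWeight_le_two hN) 3).trans (by norm_num)
        rw [Nat.cast_mul 8, Nat.cast_ofNat]
        gcongr
    _ ≤ _ := by
        rw [ofReal_exp_mul, ofReal_exp_mul, ofReal_exp_mul]
        refine ofReal_exp_le ?_
        nlinarith

/-- Here the square of the logarithm arises: over 2k = O(n log² n) steps, with growth rate O(1/n),
the potential can reach exp(O(log² n)). -/
theorem output_term_le {α k m : ℕ} (hn : 2 ≤ n) {b c : ℝ} (hc : 0 ≤ c)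
    (hL : 1 ≤ Real.log n) (hk : (k : ℝ) ≤ 2 * b * n * Real.log n ^ 2)
    (hbn : 4 * b * Real.log n ^ 2 ≤ n)
    (hm : 2 * (16 * α * b + c + 4) * Real.log n ^ 2 ≤ m) :
    (2 ^ m)⁻¹ * ((k + k : ℕ) * TrackedState.stepGrowth n α ^ (k + k)) ≤
      ENNReal.ofReal (Real.exp (-((c + 2) * Real.log n))) := by
  have hn' : (0 : ℝ) < n := by exact_mod_cast (by omega : 0 < n)
  set L := Real.log n with hLdef
  have hkk : ((k + k : ℕ) : ℝ≥0∞) ≤ ENNReal.ofReal (Real.exp (2 * L)) := by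
    refine natCast_le_ofReal_exp ?_
    have := exp_mul_log (n := n) (by omega) 2
    push_cast at this ⊢
    rw [this]
    nlinarith
  calc _ ≤ ENNReal.ofReal (Real.exp (-(m / 2))) * (ENNReal.ofReal (Real.exp (2 * L)) *
        ENNReal.ofReal (Real.exp ((α * (k + k) : ℕ) * (4 / n)))) :=
        mul_le_mul' (inv_two_pow_le m) (mul_le_mul' hkk (stepGrowth_pow_le hn α _))
    _ ≤ _ := by
        rw [ofReal_exp_mul, ofReal_exp_mul]
        refine ofReal_exp_le ?_
        have h1 : ((α * (k + k) : ℕ) : ℝ) * (4 / n) ≤ 16 * α * b * L ^ 2 := by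
          rw [mul_div_assoc', div_le_iff₀ hn']
          push_cast
          have : (α : ℝ) * k ≤ α * (2 * b * n * L ^ 2) :=
            mul_le_mul_of_nonneg_left hk (Nat.cast_nonneg α)
          nlinarith
        have h2 : (c + 4) * L ≤ (c + 4) * L ^ 2 :=
          mul_le_mul_of_nonneg_left (by nlinarith) (by linarith)
        nlinarith

/-- The tail of the number of blocking pairs. -/
theorem prob_law_numBlocking_le {K α t j k m : ℕ} (hn : 264 ≤ n) (hα : 64 * α + 1 ≤ n)
    (hK : 1 ≤ K) (hKn : K ≤ n) {b c C : ℝ} (hc : 0 ≤ c) (hcn : c + 4 ≤ n)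
    (hL : 1 ≤ Real.log n) (hC : 2 * (2 ^ 17 * 265 * α + 2) ≤ C)
    (hKC : C * Real.log n ≤ K) (hKC' : (K : ℝ) ≤ 2 * C * Real.log n)
    (hb : b = 18 * C * (c + 8)) (hk : b * n * Real.log n ^ 2 ≤ k)
    (hk' : (k : ℝ) ≤ 2 * b * n * Real.log n ^ 2) (hbn : 4 * b * Real.log n ^ 2 ≤ n)
    (hj : 264 * (n : ℝ) ^ 2 * Real.log n ≤ j)
    (hjk : ((j + k + k : ℕ) : ℝ) ≤ 265 * (n : ℝ) ^ 2 * Real.log n)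
    (hm : 2 * (16 * α * b + c + 4) * Real.log n ^ 2 ≤ m) :
    prob (law n K α (t + (j + k + k))) (fun s => m + m ≤ numBlocking s.prefs s.output) ≤
      ENNReal.ofReal ((n : ℝ) ^ (-c)) := by
  have hn' : (264 : ℝ) ≤ n := by exact_mod_cast hn
  have hN : 1 ≤ 8 * n * K := Nat.mul_pos (by omega) hK
  have hα0 : (0 : ℝ) ≤ α := Nat.cast_nonneg α
  have hC0 : 0 ≤ C := by linarith
  have hb0 : 0 ≤ b := by rw [hb]; positivity
  have hm' : 2 * (c + 3) * Real.log n ≤ m := by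
    refine le_trans ?_ hm
    have h1 : Real.log n ≤ Real.log n ^ 2 := by nlinarith
    refine mul_le_mul ?_ h1 (by linarith) (by positivity)
    have : 0 ≤ 16 * α * b := by positivity
    linarith
  set T := ENNReal.ofReal (Real.exp (-((c + 2) * Real.log n))) with hT
  have hmain := TrackedState.prob_numBlocking_le (n := n) (by omega) hK hα
    (S := (32 * n + 1 : ℕ) * (sortWeight n * ((n : ℝ≥0∞) ^ 3) ^ n))
    (ξ := scaleWeight (8 * n * K))
    (M := (8 * n * K + 1 : ℕ) * (scaleWeight (8 * n * K) * (n + 1 : ℕ)))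
    (by rw [sortWeight_eq]; exact renewal_bound (by omega) _)
    (one_le_scaleWeight _) ENNReal.ofReal_ne_top (scaleWeight_pow_le (by omega) hK)
    (renewal_bound hN _) t j k m
  have h1 := deadline_term_le (k := k) (C := C) (by omega : 72 ≤ n) hK hKn hc hL hKC' (hb ▸ hk)
  have h2 := excess_term_le (α := α) (by omega : 2 ≤ n) hL hC hKC hjk hm'
  have h3 := sort_term_le hn hcn hL hj
  rw [← sortWeight_eq] at h3
  have h4 := output_term_le (α := α) (by omega : 2 ≤ n) hc hL hk' hbn hm
  refine hmain.trans ((add_le_add (add_le_add h1 h2) (add_le_add h3 h4)).trans ?_)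
  rw [← hT]
  -- Each of the four terms was bounded with exponent c + 2 so that 4 ≤ n² can be absorbed.
  calc T + T + (T + T) = ENNReal.ofReal 4 * T := by
        rw [ENNReal.ofReal_ofNat]; ring
    _ ≤ ENNReal.ofReal (Real.exp (2 * Real.log n)) * T := by
        gcongr
        have := exp_mul_log (n := n) (by omega) 2
        push_cast at this
        rw [this]
        nlinarith
    _ = _ := by
        rw [hT, ofReal_exp_mul, Real.rpow_def_of_pos (by linarith)]
        congr 2
        ring

/-! ## The distribution of the number of blocking pairs -/

theorem numBlocking_le_sq (π : Prefs n) (M : Assignment n) : numBlocking π M ≤ n ^ 2 := by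
  refine (Set.ncard_le_card _).trans ?_
  rw [Nat.card_eq_fintype_card, Fintype.card_prod, Fintype.card_fin, sq]

theorem lintegral_blockingLaw (K α t : ℕ) (f : ℕ → ℝ≥0∞) :
    ∫⁻ k, f k ∂(blockingLaw n K α t).toMeasure =
      expect (law n K α t) fun s => f (numBlocking s.prefs s.output) := by
  rw [MeasureTheory.lintegral_countable', blockingLaw, ← expect_map (law n K α t)
    (fun s => numBlocking s.prefs s.output) f, expect]
  refine tsum_congr fun k => ?_
  rw [PMF.toMeasure_apply_singleton _ _ (MeasurableSet.singleton k), mul_comm]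

theorem blockingLaw_apply (K α t : ℕ) (A : Set ℕ) :
    (blockingLaw n K α t).toMeasure A =
      prob (law n K α t) fun s => numBlocking s.prefs s.output ∈ A := by
  classical
  rw [← MeasureTheory.lintegral_indicator_one (MeasurableSet.of_discrete (s := A)),
    lintegral_blockingLaw, prob]
  congr 1

/-- Outside the typical event the trivial bound n² suffices, as its probability is at most n^(−2).
-/
theorem expect_numBlocking_le {K α t : ℕ} {x : ℝ} (hx : 1 ≤ x)
    (h : prob (law n K α t) (fun s => x < numBlocking s.prefs s.output) ≤
      ((n : ℝ≥0∞) ^ 2)⁻¹) :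
    expect (law n K α t) (fun s => (numBlocking s.prefs s.output : ℝ≥0∞)) ≤
      ENNReal.ofReal (2 * x) := by
  classical
  calc _ ≤ expect (law n K α t) fun s => ENNReal.ofReal x + (n : ℝ≥0∞) ^ 2 *
        if x < numBlocking s.prefs s.output then 1 else 0 := by
        refine expect_mono fun s => ?_
        split_ifs with hs
        · rw [mul_one]
          refine le_add_left ?_
          exact_mod_cast numBlocking_le_sq s.prefs s.output
        · rw [mul_zero, add_zero, ← ENNReal.ofReal_natCast]
          exact ENNReal.ofReal_le_ofReal (not_lt.1 hs)
    _ = ENNReal.ofReal x + (n : ℝ≥0∞) ^ 2 *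
        prob (law n K α t) fun s => x < numBlocking s.prefs s.output := by
        rw [expect_add, expect_const, expect_mul_left, prob]
    _ ≤ ENNReal.ofReal x + 1 := by
        gcongr
        exact (mul_le_mul_right h _).trans (ENNReal.mul_inv_le_one _)
    _ ≤ _ := by
        rw [two_mul, ENNReal.ofReal_add (by linarith) (by linarith)]
        gcongr
        rw [← ENNReal.ofReal_one]
        exact ENNReal.ofReal_le_ofReal hx

theorem exists_log_sq_le (D : ℝ) (N : ℕ) :
    ∃ n₀ : ℕ, ∀ n : ℕ, n₀ ≤ n → N ≤ n ∧ D * Real.log n ^ 2 ≤ n := by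
  have h := ((Real.isLittleO_pow_log_id_atTop (n := 2)).bound
    (show (0 : ℝ) < 1 / (|D| + 1) by positivity))
  have h' := tendsto_natCast_atTop_atTop (R := ℝ) |>.eventually h
  obtain ⟨n₀, hn₀⟩ := Filter.eventually_atTop.1 h'
  refine ⟨max n₀ N, fun n hn => ⟨(le_max_right _ _).trans hn, ?_⟩⟩
  have h1 := hn₀ n ((le_max_left _ _).trans hn)
  simp only [Real.norm_eq_abs, id, abs_pow, sq_abs, Nat.abs_cast] at h1
  rw [one_div, inv_mul_eq_div, le_div_iff₀ (by positivity)] at h1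
  have h2 := mul_le_mul_of_nonneg_right (le_abs_self D) (sq_nonneg (Real.log n))
  nlinarith [sq_nonneg (Real.log n)]

theorem ceil_le_two_mul {x : ℝ} (hx : 1 ≤ x) : (⌈x⌉₊ : ℝ) ≤ 2 * x := by
  have := (Nat.ceil_lt_add_one (zero_le_one.trans hx)).le
  linarith

/-- The tail of the number of blocking pairs, for a number of candidates proportional to
`log n`. -/
theorem exists_tail_bound (α : ℕ) {C : ℝ} (hC : 2 * (2 ^ 17 * 265 * α + 2) ≤ C) {c : ℝ}
    (hc : 0 ≤ c) : ∃ n₀ : ℕ, ∃ d : ℝ, 1 ≤ d ∧ ∀ n t : ℕ, n₀ ≤ n →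
      265 * (n : ℝ) ^ 2 * Real.log n ≤ t → 264 ≤ n ∧ 1 ≤ Real.log n ∧ 1 ≤ numCandidates C n ∧
        prob (law n (numCandidates C n) α t) (fun s =>
          d * Real.log n ^ 2 < numBlocking s.prefs s.output) ≤ ENNReal.ofReal ((n : ℝ) ^ (-c)) := by
  have hα0 : (0 : ℝ) ≤ α := Nat.cast_nonneg α
  have hC4 : 4 ≤ C := by linarith
  set b := 18 * C * (c + 8) with hb
  have hbC : 2 * C ≤ b := by rw [hb]; nlinarith
  set d := 2 * (16 * α * b + c + 4) with hd
  have hd0 : 0 ≤ d := by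
    have : 0 ≤ 16 * α * b := by positivity
    rw [hd]; linarith
  -- The two intervals `k` take up to 4b n log² n steps; the fifth `b` absorbs the rounding of `j`.
  obtain ⟨n₀, hn₀⟩ := exists_log_sq_le (5 * b) (max 264 (max (64 * α + 1) ⌈c + 4⌉₊))
  refine ⟨n₀, 2 * (d + 1), by linarith, fun n t hn ht => ?_⟩
  obtain ⟨hN, hbn⟩ := hn₀ n hn
  simp only [max_le_iff] at hN
  obtain ⟨hn264, hαn, hcn⟩ := hN
  have hcn := (Nat.le_ceil (c + 4)).trans (Nat.cast_le.2 hcn)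
  have hnR : (264 : ℝ) ≤ n := by exact_mod_cast hn264
  have hL : 1 ≤ Real.log n := by
    rw [Real.le_log_iff_exp_le (by linarith)]
    linarith [Real.exp_one_lt_d9]
  set L := Real.log n with hLdef
  have hL2 : L ≤ L ^ 2 := by nlinarith
  have hCL : 1 ≤ C * L := by nlinarith
  have hKC : C * L ≤ numCandidates C n := Nat.le_ceil _
  have hKC' : (numCandidates C n : ℝ) ≤ 2 * C * L := (ceil_le_two_mul hCL).trans_eq (by ring)
  have hK : 1 ≤ numCandidates C n := by exact_mod_cast hCL.trans hKC
  have hKn : numCandidates C n ≤ n := by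
    have : (numCandidates C n : ℝ) ≤ n := by
      refine hKC'.trans (le_trans ?_ hbn)
      nlinarith
    exact_mod_cast this
  have hbnL : 1 ≤ b * n * L ^ 2 := by
    have h1 : 1 ≤ b * n := by nlinarith
    nlinarith
  have hn2L : 1 ≤ 264 * (n : ℝ) ^ 2 * L := by
    have h1 : 1 ≤ 264 * (n : ℝ) ^ 2 := by nlinarith
    nlinarith
  set j := ⌈264 * (n : ℝ) ^ 2 * L⌉₊
  set k := ⌈b * n * L ^ 2⌉₊
  set m := ⌈d * L ^ 2⌉₊
  have hj : (j : ℝ) ≤ 264 * (n : ℝ) ^ 2 * L + 1 := (Nat.ceil_lt_add_one (by linarith)).le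
  have hk : (k : ℝ) ≤ 2 * b * n * L ^ 2 := (ceil_le_two_mul hbnL).trans_eq (by ring)
  have hm : (m : ℝ) ≤ d * L ^ 2 + 1 := (Nat.ceil_lt_add_one (by positivity)).le
  have hjk : ((j + k + k : ℕ) : ℝ) ≤ 265 * (n : ℝ) ^ 2 * L := by
    push_cast
    have h1 : 5 * b * L ^ 2 * n ≤ n * n := mul_le_mul_of_nonneg_right hbn (by linarith)
    have h2 : (n : ℝ) ^ 2 * 1 ≤ (n : ℝ) ^ 2 * L := mul_le_mul_of_nonneg_left hL (by positivity)
    nlinarith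
  have hjkt : j + k + k ≤ t := by exact_mod_cast hjk.trans ht
  -- Tracking begins j + 2k steps before the time considered, so the bound is uniform in all later
  -- times.
  obtain ⟨t', rfl⟩ := Nat.exists_eq_add_of_le' hjkt
  refine ⟨hn264, hL, hK, le_trans (prob_mono_support fun s _ hs => ?_)
    (prob_law_numBlocking_le (t := t') (m := m) hn264 hαn hK hKn hc hcn hL hC hKC hKC' hb
      (Nat.le_ceil _) hk (by nlinarith) (Nat.le_ceil _) hjk (Nat.le_ceil _))⟩
  have h1 : ((m + m : ℕ) : ℝ) ≤ 2 * (d + 1) * L ^ 2 := by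
    push_cast
    nlinarith
  exact_mod_cast h1.trans hs.le

end EvolvingMatching

/-! ### Choice of the constants. -/

theorem mainTheorem1 (α : ℕ) (hα : 1 ≤ α) :
    ∃ C₀ : ℝ, 0 < C₀ ∧ ∀ C : ℝ, C₀ ≤ C →
      ∃ c₀ : ℝ, 0 < c₀ ∧ ∀ c : ℝ,
        ∃ n₀ : ℕ, ∃ c₁ c₂ : ℝ, 0 < c₁ ∧ 0 < c₂ ∧
          ∀ n t : ℕ, n₀ ≤ n → c₀ * (n : ℝ) ^ 2 * Real.log n ≤ (t : ℝ) →
            (∀ s ∈ (EvolvingMatching.law n (EvolvingMatching.numCandidates C n) α t).support,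
              EvolvingMatching.IsMatching s.output) ∧
            (∫⁻ k, (k : ENNReal)
                ∂(EvolvingMatching.blockingLaw n
                  (EvolvingMatching.numCandidates C n) α t).toMeasure
              ≤ ENNReal.ofReal (c₁ * Real.log n ^ 2)) ∧
            ((EvolvingMatching.blockingLaw n
                (EvolvingMatching.numCandidates C n) α t).toMeasure
                  {k : ℕ | c₂ * Real.log n ^ 2 < (k : ℝ)}
              ≤ ENNReal.ofReal ((n : ℝ) ^ (-c))) := by
  refine ⟨2 * (2 ^ 17 * 265 * α + 2), by positivity, fun C hC => ⟨265, by norm_num, fun c => ?_⟩⟩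
  -- An exponent of at least 2 lets the same tail bound also yield the expectation, and covers
  -- negative `c`.
  obtain ⟨n₀, d, hd, h⟩ := EvolvingMatching.exists_tail_bound α hC
    (zero_le_two.trans (le_max_right c 2))
  refine ⟨n₀, 2 * d, d, by linarith, by linarith, fun n t hn ht => ?_⟩
  obtain ⟨hn264, hL, hK, hprob⟩ := h n t hn ht
  have hn1 : (1 : ℝ) ≤ n := by exact_mod_cast (by omega : 1 ≤ n)
  refine ⟨fun s hs => (EvolvingMatching.sound_law hK α t hs).output, ?_, ?_⟩
  · rw [EvolvingMatching.lintegral_blockingLaw, mul_assoc]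
    refine EvolvingMatching.expect_numBlocking_le (by nlinarith) (hprob.trans ?_)
    calc ENNReal.ofReal ((n : ℝ) ^ (-max c 2)) ≤ ENNReal.ofReal ((n : ℝ) ^ (-(2 : ℝ))) :=
          ENNReal.ofReal_le_ofReal
            (Real.rpow_le_rpow_of_exponent_le hn1 (neg_le_neg (le_max_right _ _)))
      _ = _ := by
          rw [Real.rpow_neg (by linarith), Real.rpow_two,
            ENNReal.ofReal_inv_of_pos (by positivity), ENNReal.ofReal_pow (by linarith),
            ENNReal.ofReal_natCast]
  · rw [EvolvingMatching.blockingLaw_apply]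
    exact hprob.trans (ENNReal.ofReal_le_ofReal
      (Real.rpow_le_rpow_of_exponent_le hn1 (neg_le_neg (le_max_left _ _))))
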